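/- For integers $n,d,s$ let $H^s(\mathbb R^n,\mathbb R)$ (with $s\ge 0$) be the space of all $g\in L^2(\mathbb R^n,\mathbb R)$ whose distributional derivatives $\partial^\alpha g$, $|\alpha|\le s$, lie in $L^2$, with norm $\|g\|_s=\big(\sum_{|\alpha|\le s}\|\partial^\alpha g\|_{L^2}^2\big)^{1/2}$, and let $H^s(\mathbb R^n,\mathbb R^d)$ be the space of $f=(f_1,\dots,f_d)$ with all $f_i\in H^s(\mathbb R^n,\mathbb R)$, with norm $\|f\|_s=\big(\sum_i\|f_i\|_s^2\big)^{1/2}$. Let $\mathrm{Diff}^1_+(\mathbb R^n)$ be the set of bijective $C^1$-maps $\varphi:\mathbb R^n\to\mathbb R^n$ with $C^1$ inverse and $\det(d_x\varphi)>0$ for all $x$. For an integer $s>n/2+1$ put $$\mathcal D^s(\mathbb R^n)=\{\varphi\in \mathrm{Diff}^1_+(\mathbb R^n)\;:\;\varphi-\mathrm{id}\in H^s(\mathbb R^n,\mathbb R^n)\},$$ with the topology given by the injective map $\varphi\mapsto\varphi-\mathrm{id}$ into $H^s(\mathbb R^n,\mathbb R^n)$. **Proposition.** Let $s$ be an integer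 with $s>n/2+1$. 1. $(\mathcal D^s(\mathbb R^n),\circ)$ is a topological group: it is closed under composition and under inversion $\varphi\mapsto\varphi^{-1}$, it contains $\mathrm{id}$, and composition $\mathcal D^s\times\mathcal D^s\to\mathcal D^s$ and inversion $\mathcal D^s\to\mathcal D^s$ are continuous. 2. For every integer $s'$ with $0\le s'\le s$, composition $(f,\varphi)\mapsto f\circ\varphi$ is a well-defined continuous map $H^{s'}(\mathbb R^n,\mathbb R)\times\mathcal D^s(\mathbb R^n)\to H^{s'}(\mathbb R^n,\mathbb R)$, and likewise $H^{s'}(\mathbb R^n,\mathbb R^d)\times\mathcal D^s(\mathbb R^n)\to H^{s'}(\mathbb R^n,\mathbb R^d)$ for every $d$ (in particular for $d=n$). Here "well defined" includes that, up to equality almost everywhere, $f\circ\varphi$ does not depend on the representative of $f$. -/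

import Mathlib

open MeasureTheory
open scoped ContDiff

noncomputable section

namespace SobDiff

/-- `ℝⁿ` with its Euclidean norm and Lebesgue measure. -/
abbrev Eucl (n : ℕ) : Type := EuclideanSpace ℝ (Fin n)

/-- The classical partial derivative `∂f/∂xᵢ`. -/
def partialDeriv {n : ℕ} (i : Fin n) (f : Eucl n → ℝ) : Eucl n → ℝ :=
  fun x => fderiv ℝ f x (EuclideanSpace.single i 1)

/-- The order `|α|` of a multi-index. -/
def order {n : ℕ} (α : Fin n → ℕ) : ℕ := ∑ i, α i

/-- The classical derivative `∂^α f = ∂₁^{α₁} ⋯ ∂ₙ^{αₙ} f`. -/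
def multiDeriv {n : ℕ} (α : Fin n → ℕ) (f : Eucl n → ℝ) : Eucl n → ℝ :=
  (List.finRange n).foldr (fun i g => (partialDeriv i)^[α i] g) f

/-- `g` is the distributional derivative `∂^α f` (for locally integrable `f`, `g`):
`∫ f ∂^α ψ = (-1)^{|α|} ∫ g ψ` for every test function `ψ ∈ C_c^∞(ℝⁿ, ℝ)`. -/
def IsWeakDeriv {n : ℕ} (α : Fin n → ℕ) (f g : Eucl n → ℝ) : Prop :=
  ∀ ψ : Eucl n → ℝ, ContDiff ℝ ∞ ψ → HasCompactSupport ψ →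
    ∫ x, f x * multiDeriv α ψ x = (-1) ^ order α * ∫ x, g x * ψ x

/-- `L²(ℝⁿ, ℝ)`. -/
abbrev L2 (n : ℕ) : Type := Lp ℝ 2 (volume : Measure (Eucl n))

/-! Facts on weak derivatives that are needed to define the norm of `H^s`. -/

theorem partialDeriv_test {n : ℕ} (i : Fin n) {ψ : Eucl n → ℝ} (h : ContDiff ℝ ∞ ψ)
    (hc : HasCompactSupport ψ) :
    ContDiff ℝ ∞ (partialDeriv i ψ) ∧ HasCompactSupport (partialDeriv i ψ) := by
  refine ⟨?_, ?_⟩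
  · exact (h.fderiv_right (m := ∞) (by simp)).clm_apply contDiff_const
  · exact hc.fderiv_apply (𝕜 := ℝ) _

theorem iterate_partialDeriv_test {n : ℕ} (i : Fin n) (k : ℕ) {ψ : Eucl n → ℝ}
    (h : ContDiff ℝ ∞ ψ) (hc : HasCompactSupport ψ) :
    ContDiff ℝ ∞ ((partialDeriv i)^[k] ψ) ∧ HasCompactSupport ((partialDeriv i)^[k] ψ) := by
  induction k with
  | zero => exact ⟨h, hc⟩
  | succ k ih =>
    rw [Function.iterate_succ_apply']
    exact partialDeriv_test i ih.1 ih.2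

theorem multiDeriv_test {n : ℕ} (α : Fin n → ℕ) {ψ : Eucl n → ℝ} (h : ContDiff ℝ ∞ ψ)
    (hc : HasCompactSupport ψ) :
    ContDiff ℝ ∞ (multiDeriv α ψ) ∧ HasCompactSupport (multiDeriv α ψ) := by
  unfold multiDeriv
  induction List.finRange n with
  | nil => exact ⟨h, hc⟩
  | cons i l ih =>
    rw [List.foldr_cons]
    exact iterate_partialDeriv_test i (α i) ih.1 ih.2

theorem integrable_mul_test {n : ℕ} (f : L2 n) {ψ : Eucl n → ℝ} (h : ContDiff ℝ ∞ ψ)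
    (hc : HasCompactSupport ψ) : Integrable (fun x => f x * ψ x) := by
  have hψ : MemLp ψ 2 (volume : Measure (Eucl n)) := h.continuous.memLp_of_hasCompactSupport hc
  exact (Lp.memLp f).integrable_mul hψ

theorem IsWeakDeriv.unique {n : ℕ} {α : Fin n → ℕ} {f : Eucl n → ℝ} {g₁ g₂ : L2 n}
    (h₁ : IsWeakDeriv α f g₁) (h₂ : IsWeakDeriv α f g₂) : g₁ = g₂ := by
  have hli : LocallyIntegrable (fun x => g₁ x - g₂ x) (volume : Measure (Eucl n)) :=
    ((Lp.memLp g₁).locallyIntegrable (by norm_num)).sub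
      ((Lp.memLp g₂).locallyIntegrable (by norm_num))
  have key := ae_eq_zero_of_integral_contDiff_smul_eq_zero hli (by
    intro ψ hψ hc
    have e := (h₁ ψ hψ hc).symm.trans (h₂ ψ hψ hc)
    have e' : ∫ x, g₁ x * ψ x = ∫ x, g₂ x * ψ x :=
      mul_left_cancel₀ (pow_ne_zero _ (by norm_num)) e
    have : ∀ x, ψ x • (g₁ x - g₂ x) = g₁ x * ψ x - g₂ x * ψ x := by
      intro x; simp only [smul_eq_mul]; ring
    simp_rw [this]
    rw [integral_sub (integrable_mul_test g₁ hψ hc) (integrable_mul_test g₂ hψ hc), e', sub_self])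
  apply Lp.ext
  filter_upwards [key] with x hx
  exact sub_eq_zero.mp hx

theorem IsWeakDeriv.add {n : ℕ} {α : Fin n → ℕ} {f₁ f₂ g₁ g₂ : L2 n}
    (h₁ : IsWeakDeriv α f₁ g₁) (h₂ : IsWeakDeriv α f₂ g₂) :
    IsWeakDeriv α (f₁ + f₂ : L2 n) (g₁ + g₂ : L2 n) := by
  intro ψ hψ hc
  obtain ⟨hd, hdc⟩ := multiDeriv_test α hψ hc
  have e : ∀ (u v : L2 n) (χ : Eucl n → ℝ), ContDiff ℝ ∞ χ → HasCompactSupport χ →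
      ∫ x, (u + v : L2 n) x * χ x = (∫ x, u x * χ x) + ∫ x, v x * χ x := by
    intro u v χ hχ hχc
    rw [← integral_add (integrable_mul_test u hχ hχc) (integrable_mul_test v hχ hχc)]
    apply integral_congr_ae
    filter_upwards [Lp.coeFn_add u v] with x hx
    rw [hx, Pi.add_apply, add_mul]
  rw [e _ _ _ hd hdc, e _ _ _ hψ hc, h₁ ψ hψ hc, h₂ ψ hψ hc, mul_add]

theorem IsWeakDeriv.smul {n : ℕ} {α : Fin n → ℕ} {f g : L2 n} (c : ℝ)
    (h : IsWeakDeriv α f g) : IsWeakDeriv α (c • f : L2 n) (c • g : L2 n) := by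
  intro ψ hψ hc
  have e : ∀ (u : L2 n) (χ : Eucl n → ℝ),
      ∫ x, (c • u : L2 n) x * χ x = c * ∫ x, u x * χ x := by
    intro u χ
    rw [← integral_const_mul]
    apply integral_congr_ae
    filter_upwards [Lp.coeFn_smul c u] with x hx
    rw [hx, Pi.smul_apply, smul_eq_mul, mul_assoc]
  rw [e, e, h ψ hψ hc]
  ring

theorem IsWeakDeriv.zero {n : ℕ} (α : Fin n → ℕ) :
    IsWeakDeriv α (0 : L2 n) (0 : L2 n) := by
  intro ψ _ _
  have e : ∀ χ : Eucl n → ℝ, ∫ x, (0 : L2 n) x * χ x = 0 := by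
    intro χ
    rw [← integral_zero (Eucl n) ℝ]
    apply integral_congr_ae
    filter_upwards [Lp.coeFn_zero ℝ 2 (volume : Measure (Eucl n))] with x hx
    rw [hx, Pi.zero_apply, zero_mul]
  rw [e, e, mul_zero]

/-- The functions in `L²` all of whose distributional derivatives of order at most `s` are
in `L²`, as a linear subspace of `L²`. -/
def sobolevSubmodule (n s : ℕ) : Submodule ℝ (L2 n) where
  carrier := {f | ∀ α : Fin n → ℕ, order α ≤ s → ∃ g : L2 n, IsWeakDeriv α f g}
  add_mem' := by
    intro f₁ f₂ h₁ h₂ α hα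
    obtain ⟨g₁, hg₁⟩ := h₁ α hα
    obtain ⟨g₂, hg₂⟩ := h₂ α hα
    exact ⟨g₁ + g₂, hg₁.add hg₂⟩
  zero_mem' := fun α _ => ⟨0, IsWeakDeriv.zero α⟩
  smul_mem' := by
    intro c f h α hα
    obtain ⟨g, hg⟩ := h α hα
    exact ⟨c • g, hg.smul c⟩

/-- The Sobolev space `H^s(ℝⁿ, ℝ)`. This is a type of its own, so that it carries the `H^s`-norm
and not the norm of `L²`. -/
def Sobolev (n s : ℕ) : Type := sobolevSubmodule n s

namespace Sobolev

variable {n s : ℕ}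

instance : AddCommGroup (Sobolev n s) := inferInstanceAs (AddCommGroup (sobolevSubmodule n s))

instance : Module ℝ (Sobolev n s) := inferInstanceAs (Module ℝ (sobolevSubmodule n s))

/-- The inclusion of `H^s` into `L²`. -/
def toL2 : Sobolev n s →ₗ[ℝ] L2 n := (sobolevSubmodule n s).subtype

theorem toL2_injective : Function.Injective (toL2 : Sobolev n s → L2 n) :=
  Subtype.coe_injective

theorem exists_weakDeriv (f : Sobolev n s) (α : Fin n → ℕ) (hα : order α ≤ s) :
    ∃ g : L2 n, IsWeakDeriv α (toL2 f) g := f.2 α hα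

end Sobolev

/-- The finite set of multi-indices `α` with `|α| ≤ s`. -/
def multiIndices (n s : ℕ) : Finset (Fin n → ℕ) :=
  (Fintype.piFinset fun _ => Finset.range (s + 1)).filter fun α => order α ≤ s

theorem mem_multiIndices {n s : ℕ} {α : Fin n → ℕ} : α ∈ multiIndices n s ↔ order α ≤ s := by
  simp only [multiIndices, Finset.mem_filter, Fintype.mem_piFinset, Finset.mem_range,
    and_iff_right_iff_imp]
  intro h i
  exact Nat.lt_succ_of_le ((Finset.single_le_sum (fun j _ => Nat.zero_le (α j))
    (Finset.mem_univ i)).trans h)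

namespace Sobolev

variable {n s : ℕ}

/-- The distributional derivative `∂^α f ∈ L²` of `f ∈ H^s`, for `|α| ≤ s`. -/
def weakDeriv (α : multiIndices n s) (f : Sobolev n s) : L2 n :=
  (f.exists_weakDeriv α (mem_multiIndices.mp α.2)).choose

theorem weakDeriv_spec (α : multiIndices n s) (f : Sobolev n s) :
    IsWeakDeriv α.1 (toL2 f) (weakDeriv α f) :=
  (f.exists_weakDeriv α (mem_multiIndices.mp α.2)).choose_spec

/-- The map `f ↦ (∂^α f)_{|α| ≤ s}` into the Hilbert sum of copies of `L²`. -/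
def jet : Sobolev n s →ₗ[ℝ] PiLp 2 (fun _ : multiIndices n s => L2 n) where
  toFun f := WithLp.toLp 2 fun α => weakDeriv α f
  map_add' f g := by
    ext1 α
    have h := (weakDeriv_spec α f).add (weakDeriv_spec α g)
    rw [← map_add] at h
    exact (weakDeriv_spec α (f + g)).unique h
  map_smul' c f := by
    ext1 α
    have h := (weakDeriv_spec α f).smul c
    rw [← map_smul] at h
    exact (weakDeriv_spec α (c • f)).unique h

theorem multiDeriv_zero (ψ : Eucl n → ℝ) : multiDeriv (0 : Fin n → ℕ) ψ = ψ := by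
  unfold multiDeriv
  induction List.finRange n with
  | nil => rfl
  | cons i l ih => simp

theorem isWeakDeriv_zero (f : Eucl n → ℝ) : IsWeakDeriv (0 : Fin n → ℕ) f f := by
  intro ψ _ _
  simp [multiDeriv_zero, order]

theorem jet_injective : Function.Injective (jet : Sobolev n s → _) := by
  intro f g h
  have h0 : (0 : Fin n → ℕ) ∈ multiIndices n s := mem_multiIndices.mpr (by simp [order])
  have e : ∀ u : Sobolev n s, weakDeriv ⟨0, h0⟩ u = toL2 u := fun u =>
    (weakDeriv_spec ⟨0, h0⟩ u).unique (isWeakDeriv_zero _)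
  apply toL2_injective
  rw [← e f, ← e g]
  exact congrArg (fun v : PiLp 2 (fun _ : multiIndices n s => L2 n) => v ⟨0, h0⟩) h

/-- The `H^s`-norm `‖f‖_s = (∑_{|α| ≤ s} ‖∂^α f‖²_{L²})^{1/2}`. -/
instance : NormedAddCommGroup (Sobolev n s) :=
  NormedAddCommGroup.induced _ _ jet jet_injective

instance : NormedSpace ℝ (Sobolev n s) := NormedSpace.induced ℝ _ _ jet

theorem norm_eq (f : Sobolev n s) :
    ‖f‖ = √(∑ α : multiIndices n s, ‖weakDeriv α f‖ ^ 2) :=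
  PiLp.norm_eq_of_L2 (jet f)

end Sobolev

/-- `H^s(ℝⁿ, ℝᵈ)`, with the norm `‖f‖_s = (∑ᵢ ‖fᵢ‖_s²)^{1/2}`. -/
abbrev SobolevVec (n d s : ℕ) : Type := PiLp 2 fun _ : Fin d => Sobolev n s

/-- The function `f : ℝⁿ → ℝ` is (a representative of) the element `u` of `H^s(ℝⁿ, ℝ)`. -/
def Represents {n s : ℕ} (f : Eucl n → ℝ) (u : Sobolev n s) : Prop :=
  f =ᵐ[volume] u.toL2

/-- The function `f : ℝⁿ → ℝᵈ` is (a representative of) the element `u` of `H^s(ℝⁿ, ℝᵈ)`. -/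
def RepresentsVec {n d s : ℕ} (f : Eucl n → Eucl d) (u : SobolevVec n d s) : Prop :=
  ∀ i, Represents (fun x => f x i) (u i)

/-- The bijection `φ` of `ℝⁿ` belongs to `Diff₊¹(ℝⁿ)`. -/
structure IsDiffPlus {n : ℕ} (φ : Eucl n ≃ Eucl n) : Prop where
  contDiff : ContDiff ℝ 1 φ
  contDiff_symm : ContDiff ℝ 1 φ.symm
  det_pos : ∀ x, 0 < (fderiv ℝ φ x).det

/-- The set `D^s(ℝⁿ)` of all `φ ∈ Diff₊¹(ℝⁿ)` with `φ - id ∈ H^s(ℝⁿ, ℝⁿ)`. -/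
@[ext]
structure SobolevDiffeo (n s : ℕ) where
  toEquiv : Eucl n ≃ Eucl n
  isDiffPlus : IsDiffPlus toEquiv
  sub_id_mem : ∃ u : SobolevVec n n s, RepresentsVec (fun x => toEquiv x - x) u

namespace SobolevDiffeo

variable {n s : ℕ}

/-- The element `φ - id` of `H^s(ℝⁿ, ℝⁿ)`. -/
def subId (φ : SobolevDiffeo n s) : SobolevVec n n s := φ.sub_id_mem.choose

theorem subId_spec (φ : SobolevDiffeo n s) :
    RepresentsVec (fun x => φ.toEquiv x - x) φ.subId := φ.sub_id_mem.choose_spec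

/-- The topology of `D^s(ℝⁿ)`, given by the global chart `φ ↦ φ - id` into `H^s(ℝⁿ, ℝⁿ)`. -/
instance : TopologicalSpace (SobolevDiffeo n s) :=
  TopologicalSpace.induced subId inferInstance

end SobolevDiffeo

end SobDiff

end

/-!
# The group `D^s(ℝⁿ)` and composition in Sobolev spaces

All continuity statements are statements on families: `HFam l F` says that the functions `F x`
represent elements of `H^l` that depend continuously on a parameter `x` in a topological space.
A family in `L²` whose weak first derivatives form families in `H^l` is a family in `H^{l+1}`
(`HFam.succ`), so that everything can be proved by induction on the order of differentiability,
without formulas for higher derivatives of compositions. Put `s = k + 1`, so that `k > n/2`.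

* *Analysis in `H^k`.* On the Fourier side the norm of `H^l` is equivalent to the `L²`-norm with
  weight `(1 + |ξ|²)^{l/2}`. This gives the density of Schwartz functions
  (`denseRange_ofSchwartz`), the embedding `H^k ⊂ L^∞` (`exists_ae_abs_le`), and, by the
  inequalities of Peetre and Young, continuity of the multiplication `H^k × H^l → H^l` for `l ≤ k`
  (`HFam.mul`). Hence `ℝ + H^k` is an algebra that acts on `H^l`, and division by its elements that
  are bounded below preserves `H^l` (`HFam.div`).

* *Geometry of `D^s`.* The Jacobian matrix of `φ ∈ D^s` has entries in `ℝ + H^k`. Its determinant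
  is positive and tends to `1` at infinity, so it is bounded below
  (`SobolevDiffeo.exists_pos_le_det`). By the change of variables formula `φ` and `φ⁻¹` distort
  volumes in a bounded way, locally uniformly in `φ`, and by the Sobolev embedding both depend
  continuously on `φ` with respect to uniform convergence. This suffices for the continuity of
  `f ∘ φ` and `f ∘ φ⁻¹` in `L²` (`HFam.comp_zero`).

* *Induction.* By the chain rule `∂ᵢ(f ∘ φ) = ∑ⱼ ∂ᵢφⱼ (∂ⱼf ∘ φ)`, where the first factors lie in
  `ℝ + H^k` and the second ones in `H^{l-1}` by induction (`HFam.comp_diffeo`). Cramer's rule writes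
  `∂ᵢ(f ∘ φ⁻¹)` as `g ∘ φ⁻¹`, where `g` is a sum of products of `∂ⱼf` with cofactors of the Jacobian
  matrix, divided by its determinant (`HFam.comp_diffeo_symm`).

The group operations reduce to these two facts by `φ ∘ ψ - id = (φ - id) ∘ ψ + (ψ - id)` and
`φ⁻¹ - id = -(φ - id) ∘ φ⁻¹`.
-/

noncomputable section

namespace SobDiff

open MeasureTheory Filter Topology
open scoped ContDiff SchwartzMap FourierTransform LineDeriv ENNReal NNReal

/-! ### Weak derivatives -/

section WeakDerivatives

variable {n : ℕ}

theorem partialDeriv_contDiff (i : Fin n) {ψ : Eucl n → ℝ} (h : ContDiff ℝ ∞ ψ) :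
    ContDiff ℝ ∞ (partialDeriv i ψ) :=
  (h.fderiv_right (m := ∞) (by simp)).clm_apply contDiff_const

theorem partialDeriv_comm (i j : Fin n) {ψ : Eucl n → ℝ} (h : ContDiff ℝ ∞ ψ) :
    partialDeriv i (partialDeriv j ψ) = partialDeriv j (partialDeriv i ψ) := by
  have hd : Differentiable ℝ (fderiv ℝ ψ) :=
    (h.fderiv_right (m := ∞) (by simp)).differentiable (by simp)
  have key : ∀ (v w : Eucl n) x, fderiv ℝ (fun y => fderiv ℝ ψ y v) x w
      = fderiv ℝ (fderiv ℝ ψ) x w v := by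
    intro v w x
    rw [fderiv_clm_apply (hd x) (differentiableAt_const v)]
    simp
  have hsymm : ∀ x, IsSymmSndFDerivAt ℝ ψ x := fun x =>
    h.contDiffAt.isSymmSndFDerivAt (by
      rw [minSmoothness_of_isRCLikeNormedField]
      exact WithTop.coe_le_coe.mpr le_top)
  funext x
  change fderiv ℝ (fun y => fderiv ℝ ψ y _) x _ = fderiv ℝ (fun y => fderiv ℝ ψ y _) x _
  rw [key, key]
  exact hsymm x _ _

theorem iterate_partialDeriv_contDiff (i : Fin n) (k : ℕ) {ψ : Eucl n → ℝ}
    (h : ContDiff ℝ ∞ ψ) : ContDiff ℝ ∞ ((partialDeriv i)^[k] ψ) := by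
  induction k with
  | zero => exact h
  | succ k ih =>
    rw [Function.iterate_succ_apply']
    exact partialDeriv_contDiff i ih

theorem partialDeriv_iterate_comm (i j : Fin n) (k : ℕ) {ψ : Eucl n → ℝ}
    (h : ContDiff ℝ ∞ ψ) :
    partialDeriv i ((partialDeriv j)^[k] ψ) = (partialDeriv j)^[k] (partialDeriv i ψ) := by
  induction k with
  | zero => rfl
  | succ k ih =>
    rw [Function.iterate_succ_apply', Function.iterate_succ_apply', ← ih]
    exact partialDeriv_comm i j (iterate_partialDeriv_contDiff j k h)

theorem foldr_partialDeriv_contDiff (α : Fin n → ℕ) (l : List (Fin n)) {ψ : Eucl n → ℝ}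
    (h : ContDiff ℝ ∞ ψ) : ContDiff ℝ ∞ (l.foldr (fun i g => (partialDeriv i)^[α i] g) ψ) := by
  induction l with
  | nil => exact h
  | cons i l ih => exact iterate_partialDeriv_contDiff i (α i) ih

theorem partialDeriv_foldr_comm (α : Fin n → ℕ) (i : Fin n) (l : List (Fin n)) {ψ : Eucl n → ℝ}
    (h : ContDiff ℝ ∞ ψ) :
    partialDeriv i (l.foldr (fun j g => (partialDeriv j)^[α j] g) ψ) =
      l.foldr (fun j g => (partialDeriv j)^[α j] g) (partialDeriv i ψ) := by
  induction l with
  | nil => rfl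
  | cons j l ih =>
    rw [List.foldr_cons, List.foldr_cons, ← ih]
    exact partialDeriv_iterate_comm i j (α j) (foldr_partialDeriv_contDiff α l h)

theorem partialDeriv_multiDeriv (α : Fin n → ℕ) (i : Fin n) {ψ : Eucl n → ℝ}
    (h : ContDiff ℝ ∞ ψ) : partialDeriv i (multiDeriv α ψ) = multiDeriv α (partialDeriv i ψ) :=
  partialDeriv_foldr_comm α i _ h

/-- The extra factor `∂/∂xᵢ` occurs once, at the position of `i` in the list, and is moved to the
innermost place by the symmetry of second derivatives. -/
theorem foldr_add_single (α : Fin n → ℕ) (i : Fin n) (l : List (Fin n)) (hl : l.Nodup)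
    {ψ : Eucl n → ℝ} (h : ContDiff ℝ ∞ ψ) :
    l.foldr (fun j g => (partialDeriv j)^[(α + Pi.single i 1 : Fin n → ℕ) j] g) ψ =
      if i ∈ l then l.foldr (fun j g => (partialDeriv j)^[α j] g) (partialDeriv i ψ)
      else l.foldr (fun j g => (partialDeriv j)^[α j] g) ψ := by
  induction l with
  | nil => simp
  | cons j l ih =>
    have hl' := List.nodup_cons.mp hl
    rw [List.foldr_cons, ih hl'.2]
    by_cases hij : i = j
    · subst hij
      simp only [hl'.1, if_false, List.mem_cons, true_or, if_true, List.foldr_cons]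
      rw [← partialDeriv_foldr_comm α i l h]
      simp [Function.iterate_succ_apply]
    · have : (α + Pi.single i 1 : Fin n → ℕ) j = α j := by
        simp [Pi.single_eq_of_ne (Ne.symm hij)]
      rw [this]
      by_cases hil : i ∈ l <;> simp [hil, hij]

/-- Raising a multi-index by a unit vector amounts to one more partial derivative. -/
theorem multiDeriv_add_single (α : Fin n → ℕ) (i : Fin n) {ψ : Eucl n → ℝ}
    (h : ContDiff ℝ ∞ ψ) :
    multiDeriv (α + Pi.single i 1) ψ = multiDeriv α (partialDeriv i ψ) := by
  unfold multiDeriv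
  rw [foldr_add_single α i _ (List.nodup_finRange n) h, if_pos (List.mem_finRange i)]

theorem multiDeriv_single (i : Fin n) {ψ : Eucl n → ℝ} (h : ContDiff ℝ ∞ ψ) :
    multiDeriv (Pi.single i 1) ψ = partialDeriv i ψ := by
  have := multiDeriv_add_single 0 i h
  rwa [zero_add, Sobolev.multiDeriv_zero] at this

theorem order_add_single (α : Fin n → ℕ) (i : Fin n) :
    order (α + Pi.single i 1) = order α + 1 := by
  simp [order, Finset.sum_add_distrib]

@[simp] theorem order_zero : order (0 : Fin n → ℕ) = 0 := by simp [order]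

@[simp] theorem order_single (i : Fin n) : order (Pi.single i 1 : Fin n → ℕ) = 1 := by
  simp [order]

theorem eq_zero_of_order_le_zero {α : Fin n → ℕ} (h : order α ≤ 0) : α = 0 := by
  funext i
  have := Finset.single_le_sum (fun j _ => Nat.zero_le (α j)) (Finset.mem_univ i)
  exact Nat.le_zero.mp (this.trans h)

theorem exists_eq_add_single {β : Fin n → ℕ} (h : β ≠ 0) :
    ∃ (α : Fin n → ℕ) (i : Fin n), β = α + Pi.single i 1 := by
  obtain ⟨i, hi⟩ := Function.ne_iff.mp h
  refine ⟨β - Pi.single i 1, i, ?_⟩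
  funext j
  by_cases hj : j = i
  · subst hj
    have : β j ≠ 0 := hi
    simp; omega
  · simp [Pi.single_eq_of_ne hj]

/-- `g` is the weak partial derivative `∂f/∂xᵢ`, tested directly against `∂ψ/∂xᵢ`. -/
theorem isWeakDeriv_single_iff {i : Fin n} {f g : Eucl n → ℝ} :
    IsWeakDeriv (Pi.single i 1) f g ↔ ∀ ψ : Eucl n → ℝ, ContDiff ℝ ∞ ψ → HasCompactSupport ψ →
      ∫ x, f x * partialDeriv i ψ x = -∫ x, g x * ψ x := by
  refine forall_congr' fun ψ => forall_congr' fun h => forall_congr' fun _ => ?_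
  rw [multiDeriv_single i h, order_single]
  simp

/-- If `v = ∂u/∂xᵢ`, then the derivatives `∂^α v` are the derivatives `∂^{α + eᵢ} u`. -/
theorem IsWeakDeriv.add_single_iff {α : Fin n → ℕ} {i : Fin n} {u v g : Eucl n → ℝ}
    (h : IsWeakDeriv (Pi.single i 1) u v) :
    IsWeakDeriv (α + Pi.single i 1) u g ↔ IsWeakDeriv α v g := by
  rw [isWeakDeriv_single_iff] at h
  refine forall_congr' fun ψ => forall_congr' fun hψ => forall_congr' fun hc => ?_
  obtain ⟨h1, h2⟩ := multiDeriv_test α hψ hc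
  rw [multiDeriv_add_single α i hψ, ← partialDeriv_multiDeriv α i hψ, h _ h1 h2,
    order_add_single, pow_succ]
  constructor
  · intro e; linarith
  · intro e; rw [e]; ring

theorem IsWeakDeriv.congr {α : Fin n → ℕ} {f f' g g' : Eucl n → ℝ} (h : IsWeakDeriv α f g)
    (hf : f =ᵐ[volume] f') (hg : g =ᵐ[volume] g') : IsWeakDeriv α f' g' := by
  intro ψ hψ hc
  have e1 : ∫ x, f' x * multiDeriv α ψ x = ∫ x, f x * multiDeriv α ψ x :=
    integral_congr_ae (by filter_upwards [hf] with x hx; rw [hx])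
  have e2 : ∫ x, g' x * ψ x = ∫ x, g x * ψ x :=
    integral_congr_ae (by filter_upwards [hg] with x hx; rw [hx])
  rw [e1, e2, h ψ hψ hc]

theorem IsWeakDeriv.ae_unique {α : Fin n → ℕ} {f g₁ g₂ : Eucl n → ℝ}
    (h₁ : IsWeakDeriv α f g₁) (h₂ : IsWeakDeriv α f g₂)
    (l₁ : LocallyIntegrable g₁) (l₂ : LocallyIntegrable g₂) : g₁ =ᵐ[volume] g₂ := by
  have key := ae_eq_zero_of_integral_contDiff_smul_eq_zero (l₁.sub l₂) (by
    intro ψ hψ hc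
    have e := (h₁ ψ hψ hc).symm.trans (h₂ ψ hψ hc)
    have e' : ∫ x, g₁ x * ψ x = ∫ x, g₂ x * ψ x :=
      mul_left_cancel₀ (pow_ne_zero _ (by norm_num)) e
    have i₁ : Integrable fun x => g₁ x * ψ x := by
      simpa [mul_comm] using
        l₁.integrable_smul_left_of_hasCompactSupport hψ.continuous hc
    have i₂ : Integrable fun x => g₂ x * ψ x := by
      simpa [mul_comm] using
        l₂.integrable_smul_left_of_hasCompactSupport hψ.continuous hc
    have : ∀ x, ψ x • (g₁ - g₂) x = g₁ x * ψ x - g₂ x * ψ x := by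
      intro x; simp only [smul_eq_mul, Pi.sub_apply]; ring
    simp_rw [this]
    rw [integral_sub i₁ i₂, e', sub_self])
  filter_upwards [key] with x hx
  exact sub_eq_zero.mp hx

/-- Integration by parts: a classical derivative of a `C¹` function is a weak derivative. -/
theorem isWeakDeriv_of_contDiff (i : Fin n) {f : Eucl n → ℝ} (h : ContDiff ℝ 1 f) :
    IsWeakDeriv (Pi.single i 1) f (partialDeriv i f) := by
  rw [isWeakDeriv_single_iff]
  intro ψ hψ hc
  have c1 : Continuous (partialDeriv i f) :=
    (h.continuous_fderiv (by simp)).clm_apply continuous_const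
  obtain ⟨d1, d2⟩ := partialDeriv_test i hψ hc
  refine integral_mul_fderiv_eq_neg_fderiv_mul_of_integrable (μ := volume) ?_ ?_ ?_ ?_ ?_
  · exact (c1.mul hψ.continuous).integrable_of_hasCompactSupport hc.mul_left
  · exact (h.continuous.mul d1.continuous).integrable_of_hasCompactSupport d2.mul_left
  · exact (h.continuous.mul hψ.continuous).integrable_of_hasCompactSupport hc.mul_left
  · exact fun x _ => h.differentiable (by simp) x
  · exact fun x _ => hψ.differentiable (by simp) x

theorem continuous_integral_mul {χ : Eucl n → ℝ} (h : MemLp χ 2 volume) :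
    Continuous fun f : L2 n => ∫ x, f x * χ x := by
  have : (fun f : L2 n => ∫ x, f x * χ x) = fun f : L2 n => inner ℝ (h.toLp χ) f := by
    funext f
    rw [L2.inner_def]
    apply integral_congr_ae
    filter_upwards [h.coeFn_toLp] with x hx
    rw [hx]; simp [mul_comm]
  rw [this]
  fun_prop

/-- Being a weak derivative is a closed relation in `L² × L²`. -/
theorem isClosed_isWeakDeriv {X : Type*} [TopologicalSpace X] (α : Fin n → ℕ) {F G : X → L2 n}
    (hF : Continuous F) (hG : Continuous G) : IsClosed {x | IsWeakDeriv α (F x) (G x)} := by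
  simp only [IsWeakDeriv, Set.ofPred_forall]
  refine isClosed_iInter fun ψ => isClosed_iInter fun hψ => isClosed_iInter fun hc => ?_
  obtain ⟨h1, h2⟩ := multiDeriv_test α hψ hc
  refine isClosed_eq ?_ ?_
  · exact (continuous_integral_mul (h1.continuous.memLp_of_hasCompactSupport h2)).comp hF
  · exact continuous_const.mul
      ((continuous_integral_mul (hψ.continuous.memLp_of_hasCompactSupport hc)).comp hG)

end WeakDerivatives

/-! ### The Sobolev spaces -/

namespace Sobolev

variable {n s l : ℕ} {X : Type*} [TopologicalSpace X]

/-- The element of `H^l` given by an `L²` function whose weak derivatives up to order `l` are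
in `L²`. -/
def mk (u : L2 n) (h : ∀ α : Fin n → ℕ, order α ≤ l → ∃ g : L2 n, IsWeakDeriv α u g) :
    Sobolev n l := ⟨u, h⟩

theorem isometry_jet : Isometry (jet : Sobolev n s → _) :=
  AddMonoidHomClass.isometry_of_norm (jet : Sobolev n s →ₗ[ℝ] _) fun _ => rfl

theorem continuous_iff {F : X → Sobolev n s} :
    Continuous F ↔ ∀ α : multiIndices n s, Continuous fun x => weakDeriv α (F x) := by
  rw [isometry_jet.isUniformInducing.isInducing.continuous_iff]
  constructor
  · intro h α
    exact (PiLp.continuous_apply 2 _ α).comp h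
  · intro h
    exact (PiLp.continuous_toLp 2 _).comp (continuous_pi h)

theorem weakDeriv_eq {α : multiIndices n s} {f : Sobolev n s} {g : L2 n}
    (h : IsWeakDeriv α.1 (toL2 f) g) : weakDeriv α f = g :=
  (weakDeriv_spec α f).unique h

theorem zero_mem_multiIndices : (0 : Fin n → ℕ) ∈ multiIndices n s :=
  mem_multiIndices.mpr (by simp)

theorem weakDeriv_zero (f : Sobolev n s) : weakDeriv ⟨0, zero_mem_multiIndices⟩ f = toL2 f :=
  weakDeriv_eq (isWeakDeriv_zero _)

theorem norm_weakDeriv_le (α : multiIndices n s) (f : Sobolev n s) : ‖weakDeriv α f‖ ≤ ‖f‖ :=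
  PiLp.norm_apply_le (jet f) α

theorem norm_toL2_le (f : Sobolev n s) : ‖toL2 f‖ ≤ ‖f‖ := by
  rw [← weakDeriv_zero]; exact norm_weakDeriv_le _ f

theorem continuous_toL2 : Continuous (toL2 : Sobolev n s → L2 n) := by
  have := continuous_iff.mp (continuous_id (X := Sobolev n s)) ⟨0, zero_mem_multiIndices⟩
  simpa only [weakDeriv_zero, id] using this

theorem norm_le_sum (f : Sobolev n s) : ‖f‖ ≤ ∑ α : multiIndices n s, ‖weakDeriv α f‖ := by
  rw [norm_eq]
  refine Real.sqrt_le_iff.mpr ⟨by positivity, ?_⟩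
  exact Finset.sum_sq_le_sq_sum_of_nonneg fun _ _ => norm_nonneg _

/-- The image of the jet map is closed in the Hilbert sum, since the relations `∂^α u = v` are
closed in `L² × L²`. -/
instance : CompleteSpace (Sobolev n s) := by
  have hr : IsComplete (Set.range (jet : Sobolev n s → _)) := by
    apply IsClosed.isComplete
    have : Set.range (jet : Sobolev n s → _) =
        ⋂ α : multiIndices n s, {v : PiLp 2 (fun _ : multiIndices n s => L2 n) |
          IsWeakDeriv α.1 (v ⟨0, zero_mem_multiIndices⟩) (v α)} := by
      ext v
      simp only [Set.mem_range, Set.mem_iInter, Set.mem_ofPred_eq]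
      constructor
      · rintro ⟨f, rfl⟩ α
        change IsWeakDeriv α.1 (weakDeriv _ f) (weakDeriv α f)
        rw [weakDeriv_zero]
        exact weakDeriv_spec α f
      · intro h
        refine ⟨⟨v ⟨0, zero_mem_multiIndices⟩, fun α hα =>
          ⟨v ⟨α, mem_multiIndices.mpr hα⟩, h ⟨α, mem_multiIndices.mpr hα⟩⟩⟩, ?_⟩
        ext1 α
        exact weakDeriv_eq (h α)
    rw [this]
    exact isClosed_iInter fun α => isClosed_isWeakDeriv _
      (PiLp.continuous_apply 2 _ _) (PiLp.continuous_apply 2 _ _)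
  exact (completeSpace_iff_isComplete_range isometry_jet.isUniformInducing).mpr hr

/-- The weak partial derivative `∂/∂xᵢ : H^{l+1} → H^l`. -/
def D (i : Fin n) : Sobolev n (l + 1) →L[ℝ] Sobolev n l :=
  have hi : (Pi.single i 1 : Fin n → ℕ) ∈ multiIndices n (l + 1) :=
    mem_multiIndices.mpr (by simp)
  let T : Sobolev n (l + 1) → Sobolev n l := fun f =>
    ⟨weakDeriv ⟨Pi.single i 1, hi⟩ f, fun α hα => by
      have h := weakDeriv_spec ⟨α + Pi.single i 1,
        mem_multiIndices.mpr (by rw [order_add_single]; omega)⟩ f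
      exact ⟨_, (weakDeriv_spec ⟨Pi.single i 1, hi⟩ f).add_single_iff.mp h⟩⟩
  have hT : ∀ f, toL2 (T f) = weakDeriv ⟨Pi.single i 1, hi⟩ f := fun _ => rfl
  { toFun := T
    map_add' := fun f g => by
      apply toL2_injective
      rw [map_add, hT, hT, hT]
      exact congrArg (fun v : PiLp 2 (fun _ : multiIndices n (l + 1) => L2 n) =>
        v ⟨Pi.single i 1, hi⟩) (map_add jet f g)
    map_smul' := fun c f => by
      apply toL2_injective
      rw [RingHom.id_apply, map_smul, hT, hT]
      exact congrArg (fun v : PiLp 2 (fun _ : multiIndices n (l + 1) => L2 n) =>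
        v ⟨Pi.single i 1, hi⟩) (map_smul jet c f)
    cont := by
      rw [continuous_iff]
      intro α
      have hα : α.1 + Pi.single i 1 ∈ multiIndices n (l + 1) := by
        have := mem_multiIndices.mp α.2
        exact mem_multiIndices.mpr (by rw [order_add_single]; omega)
      have e : ∀ f : Sobolev n (l + 1), weakDeriv α (T f) = weakDeriv ⟨_, hα⟩ f := fun f =>
        weakDeriv_eq ((weakDeriv_spec ⟨Pi.single i 1, hi⟩ f).add_single_iff.mp
          (weakDeriv_spec ⟨_, hα⟩ f))
      simp_rw [e]
      exact continuous_iff.mp continuous_id _ }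

theorem D_spec (i : Fin n) (f : Sobolev n (l + 1)) :
    IsWeakDeriv (Pi.single i 1) (toL2 f) (toL2 (D i f)) :=
  weakDeriv_spec ⟨Pi.single i 1, mem_multiIndices.mpr (by simp)⟩ f

theorem toL2_D_eq {i : Fin n} {f : Sobolev n (l + 1)} {g : L2 n}
    (h : IsWeakDeriv (Pi.single i 1) (toL2 f) g) : toL2 (D i f) = g :=
  (D_spec i f).unique h

theorem weakDeriv_D {α : multiIndices n l} {β : multiIndices n (l + 1)} {i : Fin n}
    (h : β.1 = α.1 + Pi.single i 1) (f : Sobolev n (l + 1)) :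
    weakDeriv β f = weakDeriv α (D i f) := by
  apply weakDeriv_eq
  rw [h]
  exact (D_spec i f).add_single_iff.mpr (weakDeriv_spec α (D i f))

/-- The induction on the order of a multi-index: `β` is zero or `∂^β = ∂^α ∂ᵢ` with `|α| ≤ l`. -/
theorem multiIndices_succ_cases (β : multiIndices n (l + 1)) :
    β = ⟨0, zero_mem_multiIndices⟩ ∨ ∃ (α : multiIndices n l) (i : Fin n),
      β.1 = α.1 + Pi.single i 1 := by
  by_cases h : β.1 = 0
  · exact Or.inl (Subtype.ext h)
  · obtain ⟨α, i, e⟩ := exists_eq_add_single h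
    have := mem_multiIndices.mp β.2
    rw [e, order_add_single] at this
    exact Or.inr ⟨⟨α, mem_multiIndices.mpr (by omega)⟩, i, e⟩

theorem continuous_succ_iff {F : X → Sobolev n (l + 1)} :
    Continuous F ↔ Continuous (fun x => toL2 (F x)) ∧ ∀ i, Continuous fun x => D i (F x) := by
  constructor
  · exact fun h => ⟨continuous_toL2.comp h, fun i => (D i).continuous.comp h⟩
  · rintro ⟨h0, h1⟩
    rw [continuous_iff]
    intro β
    rcases multiIndices_succ_cases β with rfl | ⟨α, i, e⟩
    · simpa only [weakDeriv_zero] using h0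
    · simp_rw [weakDeriv_D e]
      exact continuous_iff.mp (h1 i) α

/-- `H^{l+1}` consists of the `L²` functions with weak partial derivatives in `H^l`. -/
theorem exists_succ {u : L2 n} {v : Fin n → Sobolev n l}
    (h : ∀ i, IsWeakDeriv (Pi.single i 1) u (toL2 (v i))) :
    ∃ f : Sobolev n (l + 1), toL2 f = u ∧ ∀ i, D i f = v i := by
  refine ⟨⟨u, fun β hβ => ?_⟩, rfl, fun i => toL2_injective (toL2_D_eq (h i))⟩
  by_cases hb : β = 0
  · subst hb; exact ⟨u, isWeakDeriv_zero _⟩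
  · obtain ⟨α, i, rfl⟩ := exists_eq_add_single hb
    rw [order_add_single] at hβ
    obtain ⟨g, hg⟩ := (v i).exists_weakDeriv α (by omega)
    exact ⟨g, (h i).add_single_iff.mpr hg⟩

theorem norm_succ_le (f : Sobolev n (l + 1)) :
    ‖f‖ ≤ Fintype.card (multiIndices n (l + 1)) * (‖toL2 f‖ + ∑ i, ‖D i f‖) := by
  refine (norm_le_sum f).trans ?_
  rw [← nsmul_eq_mul, ← Finset.card_univ, ← Finset.sum_const]
  refine Finset.sum_le_sum fun β _ => ?_
  rcases multiIndices_succ_cases β with rfl | ⟨α, i, e⟩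
  · rw [weakDeriv_zero]
    exact le_add_of_nonneg_right (by positivity)
  · rw [weakDeriv_D e]
    refine ((norm_weakDeriv_le _ _).trans ?_).trans (le_add_of_nonneg_left (norm_nonneg _))
    exact Finset.single_le_sum (f := fun i => ‖D i f‖) (fun _ _ => norm_nonneg _)
      (Finset.mem_univ i)

theorem norm_zero_le (f : Sobolev n 0) :
    ‖f‖ ≤ Fintype.card (multiIndices n 0) * ‖toL2 f‖ := by
  refine (norm_le_sum f).trans ?_
  rw [← nsmul_eq_mul, ← Finset.card_univ, ← Finset.sum_const]
  refine Finset.sum_le_sum fun β _ => ?_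
  have hb : β = ⟨0, zero_mem_multiIndices⟩ :=
    Subtype.ext (eq_zero_of_order_le_zero (mem_multiIndices.mp β.2))
  rw [hb, weakDeriv_zero]

theorem continuous_zero_iff {F : X → Sobolev n 0} :
    Continuous F ↔ Continuous (fun x => toL2 (F x)) := by
  refine ⟨fun h => continuous_toL2.comp h, fun h => ?_⟩
  rw [continuous_iff_continuousAt] at h ⊢
  intro x
  rw [ContinuousAt, tendsto_iff_norm_sub_tendsto_zero]
  have h1 := tendsto_iff_norm_sub_tendsto_zero.mp (h x)
  have h2 := h1.const_mul (Fintype.card (multiIndices n 0) : ℝ)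
  rw [mul_zero] at h2
  refine squeeze_zero (fun _ => norm_nonneg _) (fun y => ?_) h2
  rw [← map_sub]
  exact norm_zero_le _

theorem exists_zero (u : L2 n) : ∃ f : Sobolev n 0, toL2 f = u := by
  refine ⟨⟨u, fun α hα => ⟨u, ?_⟩⟩, rfl⟩
  obtain rfl := eq_zero_of_order_le_zero hα
  exact isWeakDeriv_zero _

/-- The inclusion `H^m → H^l` for `l ≤ m`. -/
def incl {m : ℕ} (h : l ≤ m) : Sobolev n m →L[ℝ] Sobolev n l where
  toFun f := mk (toL2 f) fun α hα => f.exists_weakDeriv α (hα.trans h)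
  map_add' _ _ := rfl
  map_smul' _ _ := rfl
  cont := by
    rw [continuous_iff]
    intro α
    have hα : α.1 ∈ multiIndices n m := mem_multiIndices.mpr ((mem_multiIndices.mp α.2).trans h)
    have e : ∀ f : Sobolev n m, weakDeriv α (mk (l := l) (toL2 f) fun α hα =>
        f.exists_weakDeriv α (hα.trans h)) = weakDeriv ⟨α.1, hα⟩ f := fun f =>
      weakDeriv_eq (weakDeriv_spec ⟨α.1, hα⟩ f)
    simp_rw [e]
    exact continuous_iff.mp continuous_id _

@[simp] theorem toL2_incl {m : ℕ} (h : l ≤ m) (f : Sobolev n m) : toL2 (incl h f) = toL2 f := rfl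

end Sobolev

/-! ### Schwartz functions as elements of Sobolev spaces -/

section Schwartz

variable {n l : ℕ}

/-- The partial derivative `∂/∂xᵢ` of a Schwartz function. -/
abbrev schwartzD {F : Type*} [NormedAddCommGroup F] [NormedSpace ℝ F] (i : Fin n)
    (a : 𝓢(Eucl n, F)) : 𝓢(Eucl n, F) :=
  ∂_{EuclideanSpace.single i (1 : ℝ)} a

theorem coe_schwartzD (i : Fin n) (a : 𝓢(Eucl n, ℝ)) :
    ⇑(schwartzD i a) = partialDeriv i a := by
  funext x
  rw [SchwartzMap.lineDerivOp_apply_eq_fderiv]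
  rfl

theorem isWeakDeriv_schwartz (i : Fin n) (a : 𝓢(Eucl n, ℝ)) :
    IsWeakDeriv (Pi.single i 1) a (schwartzD i a) := by
  rw [coe_schwartzD]
  exact isWeakDeriv_of_contDiff i (a.smooth 1)

theorem exists_isWeakDeriv_schwartz (k : ℕ) (a : 𝓢(Eucl n, ℝ)) (α : Fin n → ℕ)
    (hα : order α ≤ k) : ∃ b : 𝓢(Eucl n, ℝ), IsWeakDeriv α a b := by
  induction k generalizing a α with
  | zero =>
    refine ⟨a, ?_⟩
    rw [eq_zero_of_order_le_zero hα]
    exact Sobolev.isWeakDeriv_zero _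
  | succ k ih =>
    by_cases h : α = 0
    · exact ⟨a, h ▸ Sobolev.isWeakDeriv_zero _⟩
    · obtain ⟨β, i, rfl⟩ := exists_eq_add_single h
      rw [order_add_single] at hα
      obtain ⟨b, hb⟩ := ih (schwartzD i a) β (by omega)
      exact ⟨b, (isWeakDeriv_schwartz i a).add_single_iff.mpr hb⟩

/-- A real Schwartz function as an element of `H^l`. -/
def ofSchwartz (l : ℕ) : 𝓢(Eucl n, ℝ) →ₗ[ℝ] Sobolev n l where
  toFun a := Sobolev.mk (a.toLp 2) fun α hα => by
    obtain ⟨b, hb⟩ := exists_isWeakDeriv_schwartz l a α hα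
    exact ⟨b.toLp 2, hb.congr (a.coeFn_toLp 2).symm (b.coeFn_toLp 2).symm⟩
  map_add' _ _ := Sobolev.toL2_injective rfl
  map_smul' _ _ := Sobolev.toL2_injective rfl

theorem toL2_ofSchwartz (a : 𝓢(Eucl n, ℝ)) : (ofSchwartz l a).toL2 = a.toLp 2 := rfl

theorem coeFn_ofSchwartz (a : 𝓢(Eucl n, ℝ)) : (ofSchwartz l a).toL2 =ᵐ[volume] a :=
  a.coeFn_toLp 2

theorem D_ofSchwartz (i : Fin n) (a : 𝓢(Eucl n, ℝ)) :
    Sobolev.D i (ofSchwartz (l + 1) a) =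
      ofSchwartz l (schwartzD i a) := by
  apply Sobolev.toL2_injective
  apply Sobolev.toL2_D_eq
  exact (isWeakDeriv_schwartz i a).congr (coeFn_ofSchwartz a).symm (coeFn_ofSchwartz _).symm

end Schwartz

/-! ### Weak derivatives on the Fourier side -/

section Fourier

variable {n l : ℕ}

/-- Test functions may be taken to be Schwartz functions: multiply by smooth cutoff functions
`θ(x/(m+1))` and let `m → ∞`. -/
theorem IsWeakDeriv.integral_schwartz {i : Fin n} {u v : L2 n}
    (h : IsWeakDeriv (Pi.single i 1) u v) (χ : 𝓢(Eucl n, ℝ)) :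
    ∫ x, u x * partialDeriv i χ x = -∫ x, v x * χ x := by
  rw [isWeakDeriv_single_iff] at h
  let θ : ContDiffBump (0 : Eucl n) := ⟨1, 2, one_pos, one_lt_two⟩
  have θs : ContDiff ℝ ∞ θ := θ.contDiff
  let c : ℕ → ℝ := fun m => 1 / ((m : ℝ) + 1)
  have c0 : ∀ m, 0 < c m := fun m => by positivity
  have c1 : ∀ m, c m ≤ 1 := fun m => by
    refine (div_le_one (by positivity)).mpr ?_
    linarith [(Nat.cast_nonneg m : (0 : ℝ) ≤ m)]
  have clim : Tendsto c atTop (𝓝 0) := tendsto_one_div_add_atTop_nhds_zero_nat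
  let η : ℕ → Eucl n → ℝ := fun m x => θ (c m • x)
  have ηs : ∀ m, ContDiff ℝ ∞ (η m) := fun m => θs.comp (contDiff_const_smul _)
  have ηc : ∀ m, HasCompactSupport (η m) := fun m =>
    θ.hasCompactSupport.comp_homeomorph (Homeomorph.smulOfNeZero (c m) (c0 m).ne')
  have ηlim : ∀ x, Tendsto (fun m => η m x) atTop (𝓝 1) := by
    intro x
    have : Tendsto (fun m => c m • x) atTop (𝓝 0) := by
      simpa using clim.smul_const x
    have h1 := (θ.continuous.tendsto 0).comp this
    rwa [θ.one_of_mem_closedBall (by simp [θ])] at h1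
  have ηle : ∀ m x, |η m x| ≤ 1 := fun m x => by
    rw [abs_of_nonneg θ.nonneg]; exact θ.le_one
  obtain ⟨M, hM⟩ : ∃ M, ∀ x, ‖partialDeriv i θ x‖ ≤ M :=
    (partialDeriv_test i θs θ.hasCompactSupport).1.continuous.bounded_above_of_compact_support
      (partialDeriv_test i θs θ.hasCompactSupport).2
  -- the term with the derivative of the cutoff function carries the factor `c m → 0`
  have hd : ∀ m x, partialDeriv i (fun x => η m x * χ x) x =
      η m x * partialDeriv i χ x + c m * partialDeriv i θ (c m • x) * χ x := by
    intro m x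
    have e1 : HasFDerivAt (η m) ((fderiv ℝ θ (c m • x)).comp
        (c m • ContinuousLinearMap.id ℝ (Eucl n))) x :=
      (θs.differentiable (by simp) _).hasFDerivAt.comp x ((hasFDerivAt_id x).const_smul (c m))
    have e2 : HasFDerivAt (fun x => η m x * χ x) _ x := e1.mul (χ.hasFDerivAt x)
    unfold partialDeriv
    rw [e2.fderiv]
    simp
    ring
  have hψ : ∀ m, ContDiff ℝ ∞ (fun x => η m x * χ x) := fun m => (ηs m).mul (χ.smooth ⊤)
  have hψc : ∀ m, HasCompactSupport (fun x => η m x * χ x) := fun m => (ηc m).mul_right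
  have hint : ∀ (w : L2 n) (ρ : 𝓢(Eucl n, ℝ)), Integrable fun x => w x * ρ x := fun w ρ =>
    (Lp.memLp w).integrable_mul (ρ.memLp 2)
  have hχ' : ⇑(schwartzD i χ) = partialDeriv i χ :=
    coe_schwartzD i χ
  have lim1 : Tendsto (fun m => ∫ x, u x * partialDeriv i (fun x => η m x * χ x) x) atTop
      (𝓝 (∫ x, u x * partialDeriv i χ x)) := by
    refine tendsto_integral_of_dominated_convergence
      (fun x => |u x * partialDeriv i χ x| + M * |u x * χ x|) ?_ ?_ ?_ ?_
    · intro m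
      exact (Lp.aestronglyMeasurable u).mul
        (partialDeriv_contDiff i (hψ m)).continuous.aestronglyMeasurable
    · rw [← hχ']
      exact (hint u _).abs.add ((hint u χ).abs.const_mul M)
    · intro m
      refine Eventually.of_forall fun x => ?_
      rw [hd, mul_add, Real.norm_eq_abs]
      refine (abs_add_le _ _).trans (add_le_add ?_ ?_)
      · rw [abs_mul, abs_mul, abs_mul]
        have := mul_le_mul_of_nonneg_left (mul_le_mul_of_nonneg_right (ηle m x)
          (abs_nonneg (partialDeriv i χ x))) (abs_nonneg (u x))
        simpa using this
      · rw [abs_mul, abs_mul, abs_mul, abs_mul, abs_of_pos (c0 m)]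
        have h1 : c m * |partialDeriv i θ (c m • x)| ≤ 1 * M :=
          mul_le_mul (c1 m) (hM _) (abs_nonneg _) zero_le_one
        calc |u x| * (c m * |partialDeriv i θ (c m • x)| * |χ x|)
            ≤ |u x| * (1 * M * |χ x|) := by gcongr
          _ = M * (|u x| * |χ x|) := by ring
    · refine Eventually.of_forall fun x => ?_
      simp_rw [hd]
      refine Tendsto.const_mul _ ?_
      have t1 : Tendsto (fun m => η m x * partialDeriv i χ x) atTop
          (𝓝 (1 * partialDeriv i χ x)) := (ηlim x).mul_const _
      have t2 : Tendsto (fun m => c m * partialDeriv i θ (c m • x) * χ x) atTop (𝓝 0) := by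
        have : Tendsto (fun m => c m * M * |χ x|) atTop (𝓝 (0 * M * |χ x|)) :=
          (clim.mul_const _).mul_const _
        rw [zero_mul, zero_mul] at this
        refine squeeze_zero_norm (fun m => ?_) this
        rw [norm_mul, norm_mul, Real.norm_eq_abs, Real.norm_eq_abs (χ x), abs_of_pos (c0 m)]
        have := mul_le_mul_of_nonneg_left (hM (c m • x)) (c0 m).le
        exact mul_le_mul_of_nonneg_right this (abs_nonneg _)
      simpa using t1.add t2
  have lim2 : Tendsto (fun m => ∫ x, v x * (η m x * χ x)) atTop (𝓝 (∫ x, v x * χ x)) := by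
    refine tendsto_integral_of_dominated_convergence (fun x => |v x * χ x|) ?_ ?_ ?_ ?_
    · intro m
      exact (Lp.aestronglyMeasurable v).mul (hψ m).continuous.aestronglyMeasurable
    · exact (hint v χ).abs
    · intro m
      refine Eventually.of_forall fun x => ?_
      rw [Real.norm_eq_abs, abs_mul, abs_mul, abs_mul]
      have := mul_le_mul_of_nonneg_left (mul_le_mul_of_nonneg_right (ηle m x)
          (abs_nonneg (χ x))) (abs_nonneg (v x))
      simpa using this
    · refine Eventually.of_forall fun x => ?_
      simpa using ((ηlim x).mul_const (χ x)).const_mul (v x)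
  refine tendsto_nhds_unique lim1 ?_
  simp_rw [fun m => h _ (hψ m) (hψc m)]
  exact lim2.neg

/-- Real `L²` functions as complex `L²` functions. -/
def cplx : L2 n →L[ℝ] Lp ℂ 2 (volume : Measure (Eucl n)) :=
  Complex.ofRealCLM.compLpL 2 volume

theorem coeFn_cplx (u : L2 n) : cplx u =ᵐ[volume] fun x => (u x : ℂ) :=
  ContinuousLinearMap.coeFn_compLpL _ _

theorem norm_cplx (u : L2 n) : ‖cplx u‖ = ‖u‖ := by
  rw [Lp.norm_def, Lp.norm_def, eLpNorm_congr_ae (coeFn_cplx u)]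
  congr 1
  exact eLpNorm_congr_norm_ae (Eventually.of_forall fun x => by simp)

/-- The Fourier transform of a real `L²` function, as the chosen representative of its `L²`
class. -/
def hat (u : L2 n) : Eucl n → ℂ := ⇑(𝓕 (cplx u) : Lp ℂ 2 (volume : Measure (Eucl n)))

theorem memLp_hat (u : L2 n) : MemLp (hat u) 2 volume := Lp.memLp _

theorem inner_cplx (u : L2 n) (χ : 𝓢(Eucl n, ℂ)) :
    inner ℂ (cplx u) (χ.toLp 2) = ∫ x, (u x : ℂ) * χ x := by
  rw [L2.inner_def]
  apply integral_congr_ae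
  filter_upwards [coeFn_cplx u, χ.coeFn_toLp 2] with x h1 h2
  rw [h1, h2]
  simp [mul_comm]

theorem integrable_mul_schwartz (u : L2 n) (χ : 𝓢(Eucl n, ℂ)) :
    Integrable fun x => (u x : ℂ) * χ x :=
  ((Lp.memLp u).ofReal (K := ℂ)).integrable_mul (χ.memLp 2)

theorem IsWeakDeriv.integral_schwartz_complex {i : Fin n} {u v : L2 n}
    (h : IsWeakDeriv (Pi.single i 1) u v) (χ : 𝓢(Eucl n, ℂ)) :
    ∫ x, (u x : ℂ) * (schwartzD i χ) x = -∫ x, (v x : ℂ) * χ x := by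
  have hre : ∀ (L : ℂ →L[ℝ] ℝ) x, (partialDeriv i (SchwartzMap.postcompCLM L χ)) x =
      L ((schwartzD i χ) x) := by
    intro L x
    have e : ⇑(SchwartzMap.postcompCLM L χ) = fun x => L (χ x) := by
      funext x; simp
    rw [SchwartzMap.lineDerivOp_apply_eq_fderiv, e]
    unfold partialDeriv
    have e2 : HasFDerivAt (fun x => L (χ x)) _ x := L.hasFDerivAt.comp x (χ.hasFDerivAt x)
    rw [e2.fderiv]
    rfl
  have i1 := integrable_mul_schwartz u (schwartzD i χ)
  have i2 := integrable_mul_schwartz v χ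
  apply Complex.ext
  · have e := h.integral_schwartz (SchwartzMap.postcompCLM Complex.reCLM χ)
    simp_rw [hre] at e
    rw [Complex.neg_re]
    have a1 := integral_re (𝕜 := ℂ) i1
    have a2 := integral_re (𝕜 := ℂ) i2
    simp at a1 a2 e
    rw [← a1, ← a2, e]
  · have e := h.integral_schwartz (SchwartzMap.postcompCLM Complex.imCLM χ)
    simp_rw [hre] at e
    rw [Complex.neg_im]
    have a1 := integral_im (𝕜 := ℂ) i1
    have a2 := integral_im (𝕜 := ℂ) i2
    simp at a1 a2 e
    rw [← a1, ← a2, e]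

theorem fourier_lineDeriv_apply (i : Fin n) (χ : 𝓢(Eucl n, ℂ)) (ξ : Eucl n) :
    𝓕 (schwartzD i χ) ξ = (2 * Real.pi * Complex.I * (ξ i : ℂ)) * 𝓕 χ ξ := by
  rw [SchwartzMap.fourier_lineDerivOp_eq, smul_apply,
    SchwartzMap.smulLeftCLM_apply_apply (by fun_prop)]
  simp [EuclideanSpace.inner_single_right]
  ring

/-- On the Fourier side, `∂/∂xᵢ` is multiplication by `2πiξᵢ`. -/
theorem hat_of_isWeakDeriv {i : Fin n} {u v : L2 n} (h : IsWeakDeriv (Pi.single i 1) u v) :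
    hat v =ᵐ[volume] fun ξ => (2 * Real.pi * Complex.I * (ξ i : ℂ)) * hat u ξ := by
  -- Plancherel turns the identity tested on the inverse Fourier transform of `η` into one for `η`
  have key : ∀ η : 𝓢(Eucl n, ℂ),
      ∫ ξ, (starRingEnd ℂ (hat u ξ)) * (2 * Real.pi * Complex.I * (ξ i : ℂ) * η ξ) =
        -∫ ξ, starRingEnd ℂ (hat v ξ) * η ξ := by
    intro η
    have e := h.integral_schwartz_complex (𝓕⁻ η)
    rw [← inner_cplx, ← inner_cplx, ← Lp.inner_fourier_eq (cplx u),
      ← Lp.inner_fourier_eq (cplx v), SchwartzMap.toLp_fourier_eq, SchwartzMap.toLp_fourier_eq,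
      L2.inner_def, L2.inner_def] at e
    convert e using 1
    · apply integral_congr_ae
      filter_upwards [SchwartzMap.coeFn_toLp (𝓕 (schwartzD i (𝓕⁻ η))) 2]
        with ξ hξ
      rw [hξ, fourier_lineDeriv_apply]
      simp [hat, mul_comm]
    · congr 1
      apply integral_congr_ae
      filter_upwards [SchwartzMap.coeFn_toLp (𝓕 (𝓕⁻ η)) 2] with ξ hξ
      rw [hξ]
      simp [hat, mul_comm]
  have hu : LocallyIntegrable (hat u) := (memLp_hat u).locallyIntegrable (by norm_num)
  have hv : LocallyIntegrable (hat v) := (memLp_hat v).locallyIntegrable (by norm_num)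
  have hsym : Continuous fun ξ : Eucl n => (2 * Real.pi * Complex.I * (ξ i : ℂ)) := by fun_prop
  have hu' : LocallyIntegrable fun ξ => (2 * Real.pi * Complex.I * (ξ i : ℂ)) * hat u ξ := by
    have := hu.locallyIntegrableOn Set.univ
    rw [← locallyIntegrableOn_univ]
    exact this.continuousOn_mul hsym.continuousOn isOpen_univ.isLocallyClosed
  have z := ae_eq_zero_of_integral_contDiff_smul_eq_zero (hv.sub hu') (by
    intro g hg hgc
    let η : 𝓢(Eucl n, ℂ) := SchwartzMap.postcompCLM (Complex.ofRealCLM) (hgc.toSchwartzMap hg)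
    have hη : ∀ ξ, η ξ = (g ξ : ℂ) := fun ξ => by simp [η]
    have k := congrArg (starRingEnd ℂ) (key η)
    rw [map_neg, ← integral_conj, ← integral_conj] at k
    simp only [hη, map_mul, Complex.conj_ofReal, Complex.conj_I, Complex.conj_conj] at k
    have i1 : Integrable fun ξ => g ξ • hat v ξ :=
      hv.integrable_smul_left_of_hasCompactSupport hg.continuous hgc
    have i2 : Integrable fun ξ => g ξ • ((2 * Real.pi * Complex.I * (ξ i : ℂ)) * hat u ξ) :=
      hu'.integrable_smul_left_of_hasCompactSupport hg.continuous hgc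
    simp only [Pi.sub_apply, smul_sub]
    rw [integral_sub i1 i2, sub_eq_zero]
    have e1 : ∫ ξ, g ξ • hat v ξ = ∫ ξ, hat v ξ * (g ξ : ℂ) := by
      congr 1; funext ξ; simp [mul_comm]
    have e2 : ∫ ξ, g ξ • ((2 * Real.pi * Complex.I * (ξ i : ℂ)) * hat u ξ) =
        -∫ ξ, hat u ξ * ((starRingEnd ℂ 2) * Real.pi * -Complex.I * (ξ i : ℂ) * (g ξ : ℂ)) := by
      rw [← integral_neg]
      congr 1; funext ξ
      rw [Complex.real_smul, map_ofNat]
      ring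
    rw [e1, e2, k, neg_neg])
  filter_upwards [z] with ξ hξ
  exact sub_eq_zero.mp hξ

end Fourier

/-! ### The Sobolev norm on the Fourier side, and density of Schwartz functions -/

section WeightedNorm

variable {n l : ℕ}

/-- The Japanese bracket `⟨ξ⟩ = (1 + |ξ|²)^{1/2}`. -/
def jap (ξ : Eucl n) : ℝ := √(1 + ‖ξ‖ ^ 2)

theorem one_le_jap (ξ : Eucl n) : 1 ≤ jap ξ :=
  Real.one_le_sqrt.mpr (by nlinarith [sq_nonneg ‖ξ‖])

theorem jap_pos (ξ : Eucl n) : 0 < jap ξ := zero_lt_one.trans_le (one_le_jap ξ)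

theorem jap_sq (ξ : Eucl n) : jap ξ ^ 2 = 1 + ‖ξ‖ ^ 2 := Real.sq_sqrt (by positivity)

theorem norm_le_jap (ξ : Eucl n) : ‖ξ‖ ≤ jap ξ :=
  Real.le_sqrt_of_sq_le (by linarith)

theorem jap_le (ξ : Eucl n) : jap ξ ≤ 1 + ‖ξ‖ :=
  Real.sqrt_le_iff.mpr ⟨by positivity, by nlinarith [norm_nonneg ξ]⟩

theorem abs_coord_le_jap (ξ : Eucl n) (i : Fin n) : |ξ i| ≤ jap ξ :=
  (PiLp.norm_apply_le ξ i).trans (norm_le_jap ξ)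

theorem jap_le_one_add_sum (ξ : Eucl n) : jap ξ ≤ 1 + ∑ i, |ξ i| := by
  refine (jap_le ξ).trans (add_le_add le_rfl ?_)
  rw [EuclideanSpace.norm_eq]
  refine Real.sqrt_le_iff.mpr ⟨by positivity, ?_⟩
  exact Finset.sum_sq_le_sq_sum_of_nonneg fun _ _ => abs_nonneg _

theorem jap_add_le (ξ η : Eucl n) : jap (ξ + η) ≤ jap ξ + jap η := by
  refine Real.sqrt_le_iff.mpr ⟨(add_pos (jap_pos _) (jap_pos _)).le, ?_⟩
  have h1 := mul_le_mul (norm_le_jap ξ) (norm_le_jap η) (norm_nonneg _) (jap_pos ξ).le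
  have h2 := norm_add_le ξ η
  have h3 := pow_le_pow_left₀ (norm_nonneg _) h2 2
  nlinarith [jap_sq ξ, jap_sq η]

@[fun_prop] theorem continuous_jap : Continuous (jap : Eucl n → ℝ) := by
  unfold jap; fun_prop

/-- The norm of `⟨ξ⟩^l F` in `L²`, with value `∞` if this function is not in `L²`. For `F = û` it is
equivalent to the norm of `u` in `H^l`. -/
def wNorm (l : ℕ) (F : Eucl n → ℂ) : ℝ≥0∞ := eLpNorm (fun ξ => jap ξ ^ l * ‖F ξ‖) 2 volume

theorem wNorm_congr {F G : Eucl n → ℂ} (h : F =ᵐ[volume] G) : wNorm l F = wNorm l G :=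
  eLpNorm_congr_ae (by filter_upwards [h] with x hx; rw [hx])

theorem wNorm_zero (F : Eucl n → ℂ) : wNorm 0 F = eLpNorm F 2 volume :=
  eLpNorm_congr_norm_ae (Eventually.of_forall fun x => by simp)

theorem wNorm_le_succ (F : Eucl n → ℂ) : wNorm l F ≤ wNorm (l + 1) F := by
  refine eLpNorm_mono_real fun ξ => ?_
  rw [Real.norm_of_nonneg (mul_nonneg (pow_nonneg (jap_pos ξ).le _) (norm_nonneg _))]
  exact mul_le_mul_of_nonneg_right (pow_le_pow_right₀ (one_le_jap ξ) (Nat.le_succ l))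
    (norm_nonneg _)

theorem wNorm_mono_exponent {k : ℕ} (h : l ≤ k) (F : Eucl n → ℂ) : wNorm l F ≤ wNorm k F := by
  induction k, h using Nat.le_induction with
  | base => exact le_rfl
  | succ k _ ih => exact ih.trans (wNorm_le_succ F)

theorem enorm_eq_of_norm_eq {E F : Type*} [NormedAddCommGroup E] [NormedAddCommGroup F] {x : E}
    {y : F} (h : ‖x‖ = ‖y‖) : ‖x‖ₑ = ‖y‖ₑ := by
  rw [← ofReal_norm, ← ofReal_norm, h]

theorem enorm_le_of_norm_le {E F : Type*} [NormedAddCommGroup E] [NormedAddCommGroup F] {x : E}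
    {y : F} (h : ‖x‖ ≤ ‖y‖) : ‖x‖ₑ ≤ ‖y‖ₑ := by
  rw [← ofReal_norm, ← ofReal_norm]; exact ENNReal.ofReal_le_ofReal h

theorem eLpNorm_hat (u : L2 n) : eLpNorm (hat u) 2 volume = ‖u‖ₑ := by
  rw [hat, ← Lp.enorm_def]
  exact enorm_eq_of_norm_eq ((Lp.norm_fourier_eq _).trans (norm_cplx u))

theorem aestronglyMeasurable_weight {F : Eucl n → ℂ} (h : AEStronglyMeasurable F volume) :
    AEStronglyMeasurable (fun ξ => jap ξ ^ l * ‖F ξ‖) volume :=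
  (continuous_jap.pow l).aestronglyMeasurable.mul h.norm

/-- The weighted norm of the Fourier transform is bounded by the Sobolev norm. -/
theorem exists_wNorm_hat_le (n l : ℕ) : ∃ C : ℝ≥0, ∀ u : Sobolev n l,
    wNorm l (hat u.toL2) ≤ C * ‖u‖ₑ := by
  induction l with
  | zero =>
    refine ⟨1, fun u => ?_⟩
    rw [wNorm_zero, eLpNorm_hat, ENNReal.coe_one, one_mul]
    exact enorm_le_of_norm_le (Sobolev.norm_toL2_le u)
  | succ l ih =>
    obtain ⟨C, hC⟩ := ih
    have hm : ∀ v : L2 n, AEStronglyMeasurable (fun ξ => jap ξ ^ l * ‖hat v ξ‖) volume := fun v =>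
      aestronglyMeasurable_weight (memLp_hat v).1
    refine ⟨C * ‖Sobolev.incl (n := n) l.le_succ‖₊ +
      ∑ i, C * ‖(Sobolev.D i : Sobolev n (l + 1) →L[ℝ] Sobolev n l)‖₊, fun u => ?_⟩
    have h1 : wNorm (l + 1) (hat u.toL2) ≤ eLpNorm ((fun ξ => jap ξ ^ l * ‖hat u.toL2 ξ‖) +
        ∑ i, fun ξ => jap ξ ^ l * ‖hat (Sobolev.D i u).toL2 ξ‖) 2 volume := by
      refine eLpNorm_mono_ae_real ?_
      filter_upwards [ae_all_iff.mpr fun i => hat_of_isWeakDeriv (Sobolev.D_spec i u)] with ξ hξ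
      rw [Real.norm_of_nonneg (mul_nonneg (pow_nonneg (jap_pos ξ).le _) (norm_nonneg _)),
        Pi.add_apply, Finset.sum_apply]
      simp_rw [hξ]
      have hpi : (1 : ℝ) ≤ 2 * Real.pi := by linarith [Real.two_le_pi]
      calc jap ξ ^ (l + 1) * ‖hat u.toL2 ξ‖
          ≤ jap ξ ^ l * (1 + ∑ i, |ξ i|) * ‖hat u.toL2 ξ‖ := by
            rw [pow_succ]
            have := pow_pos (jap_pos ξ) l
            gcongr
            exact jap_le_one_add_sum ξ
        _ = jap ξ ^ l * ‖hat u.toL2 ξ‖ + ∑ i, jap ξ ^ l * (|ξ i| * ‖hat u.toL2 ξ‖) := by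
            rw [mul_add, add_mul, mul_one, Finset.mul_sum, Finset.sum_mul]
            simp_rw [mul_assoc]
        _ ≤ _ := by
            gcongr with i
            · exact (pow_pos (jap_pos ξ) l).le
            · rw [norm_mul]
              gcongr
              simp only [norm_mul, Complex.norm_real, Complex.norm_I, Complex.norm_ofNat,
                Real.norm_eq_abs, abs_of_pos Real.pi_pos, mul_one]
              nlinarith [abs_nonneg (ξ i)]
    refine h1.trans ((eLpNorm_add_le (hm _) (Finset.aestronglyMeasurable_sum _ fun i _ => hm _)
      (by norm_num)).trans ?_)
    push_cast
    rw [add_mul, Finset.sum_mul]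
    refine add_le_add ?_ ((eLpNorm_sum_le (fun i _ => hm _) (by norm_num)).trans
      (Finset.sum_le_sum fun i _ => ?_))
    · have := hC (Sobolev.incl l.le_succ u)
      rw [Sobolev.toL2_incl] at this
      refine this.trans ?_
      rw [mul_assoc]
      gcongr
      exact ContinuousLinearMap.le_opENorm _ _
    · refine (hC (Sobolev.D i u)).trans ?_
      rw [mul_assoc]
      gcongr
      exact ContinuousLinearMap.le_opENorm _ _

/-- The real part of a Schwartz function. -/
abbrev schwartzRe (h : 𝓢(Eucl n, ℂ)) : 𝓢(Eucl n, ℝ) := SchwartzMap.postcompCLM Complex.reCLM h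

/-- A real Schwartz function as a complex one. -/
abbrev schwartzOfReal (a : 𝓢(Eucl n, ℝ)) : 𝓢(Eucl n, ℂ) :=
  SchwartzMap.postcompCLM Complex.ofRealCLM a

/-- The Fourier transform of a Schwartz function. -/
abbrev schwartzF (h : 𝓢(Eucl n, ℂ)) : 𝓢(Eucl n, ℂ) := 𝓕 h

theorem schwartzD_re (i : Fin n) (h : 𝓢(Eucl n, ℂ)) :
    schwartzD i (schwartzRe h) = schwartzRe (schwartzD i h) := by
  ext x
  rw [SchwartzMap.lineDerivOp_apply_eq_fderiv, SchwartzMap.postcompCLM_apply,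
    SchwartzMap.lineDerivOp_apply_eq_fderiv]
  have e : ⇑(schwartzRe h) = fun x => Complex.reCLM (h x) := by
    funext x; simp
  have e2 : HasFDerivAt (fun x => Complex.reCLM (h x)) _ x :=
    Complex.reCLM.hasFDerivAt.comp x (h.hasFDerivAt x)
  rw [e, e2.fderiv]
  rfl

theorem hat_toLp (a : 𝓢(Eucl n, ℝ)) :
    hat (a.toLp 2 volume) =ᵐ[volume] schwartzF (schwartzOfReal a) := by
  have : cplx (a.toLp 2 volume) = (schwartzOfReal a).toLp 2 volume := by
    apply Lp.ext
    filter_upwards [coeFn_cplx (a.toLp 2 volume), a.coeFn_toLp 2 volume,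
      (schwartzOfReal a).coeFn_toLp 2 volume] with x h1 h2 h3
    rw [h1, h2, h3]; simp
  rw [hat, this, SchwartzMap.toLp_fourier_eq]
  exact SchwartzMap.coeFn_toLp (schwartzF (schwartzOfReal a)) 2

/-- The Sobolev norm of a difference with (the real part of) a Schwartz function is bounded by
the weighted norm on the Fourier side. -/
theorem exists_enorm_sub_le_wNorm (n l : ℕ) : ∃ C : ℝ≥0, ∀ (u : Sobolev n l) (h : 𝓢(Eucl n, ℂ)),
    ‖u - ofSchwartz l (schwartzRe h)‖ₑ ≤ C * wNorm l (fun ξ => hat u.toL2 ξ - 𝓕 h ξ) := by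
  have base : ∀ (v : L2 n) (h : 𝓢(Eucl n, ℂ)),
      ‖v - (schwartzRe h).toLp 2 volume‖ₑ ≤ wNorm 0 (fun ξ => hat v ξ - 𝓕 h ξ) := by
    intro v h
    have e1 : wNorm 0 (fun ξ => hat v ξ - 𝓕 h ξ) = ‖cplx v - h.toLp 2 volume‖ₑ := by
      rw [wNorm_zero]
      have : ‖cplx v - h.toLp 2 volume‖ₑ = ‖𝓕 (cplx v) - (schwartzF h).toLp 2 volume‖ₑ := by
        apply enorm_eq_of_norm_eq
        rw [← SchwartzMap.toLp_fourier_eq, sub_eq_add_neg (𝓕 (cplx v)),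
          ← FourierTransform.fourier_neg,
          ← FourierTransform.fourier_add, ← sub_eq_add_neg, Lp.norm_fourier_eq]
      rw [this, Lp.enorm_def]
      apply eLpNorm_congr_ae
      filter_upwards [Lp.coeFn_sub (𝓕 (cplx v)) ((schwartzF h).toLp 2 volume),
        (schwartzF h).coeFn_toLp 2 volume] with x h1 h2
      rw [h1, Pi.sub_apply, h2]; rfl
    rw [e1, Lp.enorm_def, Lp.enorm_def]
    refine eLpNorm_mono_ae ?_
    filter_upwards [Lp.coeFn_sub v ((schwartzRe h).toLp 2 volume),
      Lp.coeFn_sub (cplx v) (h.toLp 2 volume),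
      coeFn_cplx v, h.coeFn_toLp 2 volume, (schwartzRe h).coeFn_toLp 2 volume] with x h1 h2 h3 h4 h5
    rw [h1, h2, Pi.sub_apply, Pi.sub_apply, h3, h4, h5]
    have : v x - schwartzRe h x = ((v x : ℂ) - h x).re := by simp
    rw [this]
    exact Complex.abs_re_le_norm _
  induction l with
  | zero =>
    refine ⟨Fintype.card (multiIndices n 0), fun u h => ?_⟩
    have h1 := enorm_le_of_norm_le (y := (Fintype.card (multiIndices n 0) : ℝ) *
      ‖(u - ofSchwartz 0 (schwartzRe h)).toL2‖)
      ((Sobolev.norm_zero_le (u - ofSchwartz 0 (schwartzRe h))).trans (Real.le_norm_self _))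
    refine h1.trans ?_
    rw [enorm_mul, enorm_norm, map_sub, toL2_ofSchwartz]
    gcongr
    · simp
    · exact base _ h
  | succ l ih =>
    obtain ⟨C, hC⟩ := ih
    refine ⟨Fintype.card (multiIndices n (l + 1)) * (1 + ∑ _i : Fin n, C * ‖(2 * Real.pi : ℝ)‖₊),
      fun u h => ?_⟩
    have h1 := enorm_le_of_norm_le ((Sobolev.norm_succ_le
      (u - ofSchwartz (l + 1) (schwartzRe h))).trans (Real.le_norm_self _))
    refine h1.trans ?_
    rw [enorm_mul, map_sub, toL2_ofSchwartz]
    push_cast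
    rw [mul_assoc]
    gcongr
    · simp
    refine (enorm_add_le _ _).trans ?_
    rw [add_mul, one_mul, enorm_norm]
    gcongr
    · exact (base _ h).trans (wNorm_mono_exponent (Nat.zero_le _) _)
    refine (enorm_sum_le _ _).trans ?_
    rw [Finset.sum_mul]
    refine Finset.sum_le_sum fun i _ => ?_
    rw [enorm_norm, map_sub, D_ofSchwartz, schwartzD_re]
    refine (hC _ _).trans ?_
    rw [mul_assoc]
    gcongr
    rw [wNorm, wNorm, ← enorm_eq_nnnorm, ← eLpNorm_const_smul]
    refine eLpNorm_mono_ae_real ?_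
    filter_upwards [hat_of_isWeakDeriv (Sobolev.D_spec i u)] with ξ hξ
    rw [hξ, fourier_lineDeriv_apply, ← mul_sub,
      Real.norm_of_nonneg (mul_nonneg (pow_nonneg (jap_pos ξ).le _) (norm_nonneg _))]
    simp only [norm_mul, Complex.norm_real, Complex.norm_I, Complex.norm_ofNat,
      Real.norm_eq_abs, abs_of_pos Real.pi_pos, mul_one, Pi.smul_apply, smul_eq_mul]
    have h2 := abs_coord_le_jap ξ i
    have h3 := pow_pos (jap_pos ξ) l
    calc jap ξ ^ l * (2 * Real.pi * |ξ i| * ‖hat u.toL2 ξ - 𝓕 h ξ‖)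
        ≤ jap ξ ^ l * (2 * Real.pi * jap ξ * ‖hat u.toL2 ξ - 𝓕 h ξ‖) := by
          have := Real.pi_pos
          gcongr
      _ = _ := by ring

theorem exists_wNorm_schwartz_le (n l : ℕ) : ∃ C : ℝ≥0, ∀ a : 𝓢(Eucl n, ℝ),
    wNorm l (schwartzF (schwartzOfReal a)) ≤ C * ‖ofSchwartz l a‖ₑ := by
  obtain ⟨C, hC⟩ := exists_wNorm_hat_le n l
  refine ⟨C, fun a => ?_⟩
  rw [← wNorm_congr (hat_toLp a)]
  exact hC (ofSchwartz l a)

theorem exists_enorm_schwartz_le (n l : ℕ) : ∃ C : ℝ≥0, ∀ a : 𝓢(Eucl n, ℝ),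
    ‖ofSchwartz l a‖ₑ ≤ C * wNorm l (schwartzF (schwartzOfReal a)) := by
  obtain ⟨C, hC⟩ := exists_enorm_sub_le_wNorm n l
  refine ⟨C, fun a => ?_⟩
  have h := hC 0 (schwartzOfReal a)
  have e : schwartzRe (schwartzOfReal a) = a := by ext x; simp
  rw [e, zero_sub, enorm_neg] at h
  refine h.trans (le_of_eq ?_)
  congr 1
  have h0 : hat (0 : L2 n) =ᵐ[volume] 0 := by
    have := eLpNorm_hat (0 : L2 n)
    rw [enorm_zero, eLpNorm_eq_zero_iff (memLp_hat 0).1 (by norm_num)] at this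
    exact this
  rw [map_zero]
  refine eLpNorm_congr_ae ?_
  filter_upwards [h0] with ξ hξ
  rw [hξ]; simp

theorem hasTemperateGrowth_jap_inv_pow (l : ℕ) :
    Function.HasTemperateGrowth fun ξ : Eucl n => (((jap ξ)⁻¹ ^ l : ℝ) : ℂ) := by
  have h := Function.hasTemperateGrowth_one_add_norm_sq_rpow (H := Eucl n) (-(l : ℝ) / 2)
  have e : (fun ξ : Eucl n => (jap ξ)⁻¹ ^ l) = fun ξ => (1 + ‖ξ‖ ^ 2) ^ (-(l : ℝ) / 2) := by
    funext ξ
    have h0 : (0 : ℝ) < 1 + ‖ξ‖ ^ 2 := by positivity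
    rw [neg_div, Real.rpow_neg h0.le, inv_pow, jap, Real.sqrt_eq_rpow, ← Real.rpow_natCast,
      ← Real.rpow_mul h0.le]
    congr 2
    ring
  rw [← e] at h
  exact Function.Complex.hasTemperateGrowth_ofReal.comp h

/-- Schwartz functions are dense in `H^l`. -/
theorem denseRange_ofSchwartz (n l : ℕ) :
    DenseRange (ofSchwartz l : 𝓢(Eucl n, ℝ) → Sobolev n l) := by
  obtain ⟨C, hC⟩ := exists_enorm_sub_le_wNorm n l
  obtain ⟨C', hC'⟩ := exists_wNorm_hat_le n l
  rw [Metric.denseRange_iff]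
  intro u ε hε
  have hw : MemLp (fun ξ => ((jap ξ ^ l : ℝ) : ℂ) * hat u.toL2 ξ) 2 volume := by
    refine ⟨(Complex.continuous_ofReal.comp (continuous_jap.pow l)).aestronglyMeasurable.mul
      (memLp_hat _).1, ?_⟩
    refine lt_of_le_of_lt ?_ ((hC' u).trans_lt (ENNReal.mul_lt_top ENNReal.coe_lt_top enorm_lt_top))
    refine eLpNorm_mono_real fun ξ => le_of_eq ?_
    rw [norm_mul, Complex.norm_real, Real.norm_of_nonneg (pow_nonneg (jap_pos ξ).le _)]
  -- approximate `⟨ξ⟩^l û` in `L²` and divide by `⟨ξ⟩^l`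
  obtain ⟨g, hg⟩ := (Metric.denseRange_iff.mp (SchwartzMap.denseRange_toLpCLM (E := Eucl n)
    (F := ℂ) (p := 2) (μ := volume) (by norm_num))) (hw.toLp _) (ε / (C + 1)) (by positivity)
  refine ⟨schwartzRe (𝓕⁻ (SchwartzMap.smulLeftCLM ℂ (fun ξ => (((jap ξ)⁻¹ ^ l : ℝ) : ℂ)) g)), ?_⟩
  have h1 := hC u (𝓕⁻ (SchwartzMap.smulLeftCLM ℂ (fun ξ => (((jap ξ)⁻¹ ^ l : ℝ) : ℂ)) g))
  rw [FourierTransform.fourier_fourierInv_eq] at h1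
  have h2 : wNorm l (fun ξ => hat u.toL2 ξ -
      (SchwartzMap.smulLeftCLM ℂ (fun ξ => (((jap ξ)⁻¹ ^ l : ℝ) : ℂ)) g) ξ) =
      ‖hw.toLp _ - g.toLp 2 volume‖ₑ := by
    rw [Lp.enorm_def]
    apply eLpNorm_congr_norm_ae
    filter_upwards [Lp.coeFn_sub (hw.toLp _) (g.toLp 2 volume), hw.coeFn_toLp,
        g.coeFn_toLp 2 volume]
      with ξ e1 e2 e3
    rw [e1, Pi.sub_apply, e2, e3,
      SchwartzMap.smulLeftCLM_apply_apply (hasTemperateGrowth_jap_inv_pow l)]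
    have hp := pow_pos (jap_pos ξ) l
    rw [norm_mul, norm_norm, Real.norm_of_nonneg hp.le]
    have : ((jap ξ ^ l : ℝ) : ℂ) * hat u.toL2 ξ - g ξ = ((jap ξ ^ l : ℝ) : ℂ) *
        (hat u.toL2 ξ - (((jap ξ)⁻¹ ^ l : ℝ) : ℂ) • g ξ) := by
      rw [mul_sub, smul_eq_mul, ← mul_assoc, ← Complex.ofReal_mul, inv_pow, mul_inv_cancel₀ hp.ne']
      simp
    rw [this, norm_mul, Complex.norm_real, Real.norm_of_nonneg hp.le]
  rw [h2] at h1
  rw [dist_eq_norm] at hg ⊢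
  have h3 : ‖u - ofSchwartz l (schwartzRe (𝓕⁻ (SchwartzMap.smulLeftCLM ℂ
      (fun ξ => (((jap ξ)⁻¹ ^ l : ℝ) : ℂ)) g)))‖ ≤ C * ‖hw.toLp _ - g.toLp 2 volume‖ := by
    have := ENNReal.toReal_mono (ENNReal.mul_ne_top ENNReal.coe_ne_top enorm_ne_top) h1
    simpa using this
  refine h3.trans_lt ?_
  have h4 : (C : ℝ) * ‖hw.toLp _ - g.toLp 2 volume‖ ≤ C * (ε / (C + 1)) :=
    mul_le_mul_of_nonneg_left hg.le C.coe_nonneg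
  refine h4.trans_lt ?_
  rw [mul_div_assoc', div_lt_iff₀ (by positivity)]
  nlinarith [C.coe_nonneg]

end WeightedNorm

/-! ### Sobolev embedding and product estimate for Schwartz functions -/

section Estimates

variable {n k l : ℕ}

/-- The Cauchy–Schwarz inequality for nonnegative functions. -/
theorem lintegral_mul_sq_le {X : Type*} [MeasurableSpace X] {μ : Measure X} {f g : X → ℝ≥0∞}
    (hf : AEMeasurable f μ) (hg : AEMeasurable g μ) :
    (∫⁻ x, f x * g x ∂μ) ^ 2 ≤ (∫⁻ x, f x ^ 2 ∂μ) * ∫⁻ x, g x ^ 2 ∂μ := by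
  have h := ENNReal.lintegral_mul_le_Lp_mul_Lq μ Real.HolderConjugate.two_two hf hg
  refine (pow_le_pow_left₀ (zero_le) h 2).trans (le_of_eq ?_)
  have e : ∀ y : ℝ≥0∞, (y ^ (1 / (2 : ℝ))) ^ 2 = y := fun y => by
    rw [← ENNReal.rpow_natCast, ← ENNReal.rpow_mul]; norm_num
  rw [mul_pow, e, e]
  simp only [ENNReal.rpow_ofNat]

/-- Young's inequality `‖a * b‖₂ ≤ ‖a‖₁ ‖b‖₂` for nonnegative functions. -/
theorem lintegral_convolution_sq_le {a b : Eucl n → ℝ≥0∞} (ha : Measurable a)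
    (hb : Measurable b) :
    ∫⁻ x, (∫⁻ t, a t * b (x - t)) ^ 2 ≤ (∫⁻ t, a t) ^ 2 * ∫⁻ x, b x ^ 2 := by
  have e : ∀ y : ℝ≥0∞, (y ^ (1 / (2 : ℝ))) ^ 2 = y := fun y => by
    rw [← ENNReal.rpow_natCast, ← ENNReal.rpow_mul]; norm_num
  -- Cauchy–Schwarz for the factorization `a b = √a (√a b)`
  have h1 : ∀ x, (∫⁻ t, a t * b (x - t)) ^ 2 ≤
      (∫⁻ t, a t) * ∫⁻ t, a t * b (x - t) ^ 2 := by
    intro x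
    have h := lintegral_mul_sq_le (μ := volume) (f := fun t => a t ^ (1 / (2 : ℝ)))
      (g := fun t => a t ^ (1 / (2 : ℝ)) * b (x - t)) (by fun_prop) (by fun_prop)
    simp only [← mul_assoc, mul_pow, ← pow_two, e] at h
    exact h
  calc ∫⁻ x, (∫⁻ t, a t * b (x - t)) ^ 2
      ≤ ∫⁻ x, (∫⁻ t, a t) * ∫⁻ t, a t * b (x - t) ^ 2 := lintegral_mono h1
    _ = (∫⁻ t, a t) * ∫⁻ x, ∫⁻ t, a t * b (x - t) ^ 2 := by
        rw [lintegral_const_mul]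
        exact Measurable.lintegral_prod_right' (f := fun p : Eucl n × Eucl n =>
          a p.2 * b (p.1 - p.2) ^ 2) (by fun_prop)
    _ = (∫⁻ t, a t) * ∫⁻ t, ∫⁻ x, a t * b (x - t) ^ 2 := by
        rw [lintegral_lintegral_swap]
        fun_prop
    _ = (∫⁻ t, a t) * ∫⁻ t, a t * ∫⁻ x, b x ^ 2 := by
        congr 2; funext t
        rw [lintegral_const_mul _ (by fun_prop),
          lintegral_sub_right_eq_self (fun x => b x ^ 2) t]
    _ = _ := by
        rw [lintegral_mul_const _ ha, ← mul_assoc, pow_two]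

/-- The Japanese bracket as an extended nonnegative number. -/
def ejap (ξ : Eucl n) : ℝ≥0∞ := ENNReal.ofReal (jap ξ)

@[fun_prop] theorem measurable_ejap : Measurable (ejap : Eucl n → ℝ≥0∞) :=
  continuous_jap.measurable.ennreal_ofReal

theorem ejap_ne_zero (ξ : Eucl n) : ejap ξ ≠ 0 := (ENNReal.ofReal_pos.mpr (jap_pos ξ)).ne'

theorem ejap_ne_top (ξ : Eucl n) : ejap ξ ≠ ⊤ := ENNReal.ofReal_ne_top

theorem wNorm_sq (F : Eucl n → ℂ) : wNorm l F ^ 2 = ∫⁻ ξ, (ejap ξ ^ l * ‖F ξ‖ₑ) ^ 2 := by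
  have h := eLpNorm_nnreal_pow_eq_lintegral (p := 2) (μ := (volume : Measure (Eucl n)))
    (f := fun ξ => jap ξ ^ l * ‖F ξ‖) (by norm_num)
  simp only [NNReal.coe_ofNat, ENNReal.rpow_ofNat, ENNReal.coe_ofNat] at h
  rw [wNorm, h]
  congr 1; funext ξ
  rw [enorm_mul, enorm_norm, enorm_pow, ejap, Real.enorm_of_nonneg (jap_pos ξ).le]

theorem lintegral_ejap_inv_lt_top (hk : n < 2 * k) :
    ∫⁻ ξ : Eucl n, ((ejap ξ)⁻¹ ^ k) ^ 2 < ⊤ := by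
  have h : Integrable (fun ξ : Eucl n => ((1 : ℝ) + ‖ξ‖ ^ 2) ^ (-((2 * k : ℕ) : ℝ) / 2)) volume :=
    integrable_rpow_neg_one_add_norm_sq (by
      rw [finrank_euclideanSpace, Fintype.card_fin]; exact_mod_cast hk)
  refine lt_of_le_of_lt (lintegral_mono fun ξ => le_of_eq ?_) h.lintegral_lt_top
  have h0 : (0 : ℝ) < 1 + ‖ξ‖ ^ 2 := by positivity
  rw [← pow_mul, ejap, ← ENNReal.ofReal_inv_of_pos (jap_pos ξ), ← ENNReal.ofReal_pow
    (inv_pos.mpr (jap_pos ξ)).le]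
  congr 1
  rw [neg_div, Real.rpow_neg h0.le, inv_pow, mul_comm k 2, pow_mul, jap_sq, ← Real.rpow_natCast]
  congr 2
  push_cast
  ring

/-- By Cauchy–Schwarz, `⟨·⟩^{-m} G ∈ L¹` if `⟨·⟩^l G ∈ L²` and `l + m > n/2`. -/
theorem lintegral_ejap_inv_mul_sq_le {m : ℕ} {G : Eucl n → ℝ≥0∞} (hG : Measurable G) :
    (∫⁻ ξ, (ejap ξ)⁻¹ ^ m * G ξ) ^ 2 ≤
      (∫⁻ ξ : Eucl n, ((ejap ξ)⁻¹ ^ (l + m)) ^ 2) * ∫⁻ ξ, (ejap ξ ^ l * G ξ) ^ 2 := by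
  have h := lintegral_mul_sq_le (μ := volume) (f := fun ξ : Eucl n => (ejap ξ)⁻¹ ^ (l + m))
    (g := fun ξ => ejap ξ ^ l * G ξ) (by fun_prop) (by fun_prop)
  refine le_of_eq_of_le ?_ h
  congr 2; funext ξ
  rw [pow_add, mul_comm ((ejap ξ)⁻¹ ^ l), mul_assoc, ← mul_assoc _ _ (G ξ), ← mul_pow,
    ENNReal.inv_mul_cancel (ejap_ne_zero ξ) (ejap_ne_top ξ), one_pow, one_mul]

/-- Peetre's inequality in the form that splits the frequencies of a product: the larger of the
two frequencies carries the weight. -/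
theorem ejap_pow_le (l m : ℕ) (ξ t : Eucl n) :
    ejap ξ ^ l ≤ 2 ^ l * (ejap (ξ - t) ^ l + ejap t ^ (l + m) * (ejap (ξ - t))⁻¹ ^ m) := by
  have h : jap ξ ≤ jap t + jap (ξ - t) := by
    simpa using jap_add_le t (ξ - t)
  rw [mul_add]
  rcases le_total (jap t) (jap (ξ - t)) with h1 | h1
  · refine le_trans ?_ le_self_add
    rw [← mul_pow]
    gcongr
    rw [two_mul, ejap, ejap, ← ENNReal.ofReal_add (jap_pos _).le (jap_pos _).le]
    exact ENNReal.ofReal_le_ofReal (by linarith)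
  · refine le_trans ?_ le_add_self
    have h2 : ejap ξ ≤ 2 * ejap t := by
      rw [two_mul, ejap, ejap, ← ENNReal.ofReal_add (jap_pos _).le (jap_pos _).le]
      exact ENNReal.ofReal_le_ofReal (by linarith)
    have h3 : ejap (ξ - t) ≤ ejap t := ENNReal.ofReal_le_ofReal h1
    have h4 : 1 ≤ ejap t * (ejap (ξ - t))⁻¹ := by
      rw [← div_eq_mul_inv, ENNReal.le_div_iff_mul_le (Or.inl (ejap_ne_zero _))
        (Or.inl (ejap_ne_top _)), one_mul]
      exact h3
    calc ejap ξ ^ l ≤ (2 * ejap t) ^ l * 1 := by rw [mul_one]; gcongr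
      _ ≤ (2 * ejap t) ^ l * (ejap t * (ejap (ξ - t))⁻¹) ^ m := by
          gcongr; exact one_le_pow₀ h4
      _ = _ := by rw [mul_pow, mul_pow, pow_add]; ring

theorem add_sq_le_four_mul (x y : ℝ≥0∞) : (x + y) ^ 2 ≤ 4 * (x ^ 2 + y ^ 2) := by
  have h : x + y ≤ 2 * max x y := by
    rw [two_mul]; exact add_le_add (le_max_left _ _) (le_max_right _ _)
  calc (x + y) ^ 2 ≤ (2 * max x y) ^ 2 := by gcongr
    _ = 4 * max x y ^ 2 := by rw [mul_pow]; norm_num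
    _ ≤ 4 * (x ^ 2 + y ^ 2) := by
        gcongr
        rcases le_total x y with h | h
        · rw [max_eq_right h]; exact le_add_self
        · rw [max_eq_left h]; exact le_self_add

/-- The product of two Schwartz functions. -/
abbrev schwartzMul {𝕜 : Type*} [RCLike 𝕜] (a b : 𝓢(Eucl n, 𝕜)) : 𝓢(Eucl n, 𝕜) :=
  SchwartzMap.pairing (ContinuousLinearMap.mul 𝕜 𝕜) a b

theorem schwartzMul_apply {𝕜 : Type*} [RCLike 𝕜] (a b : 𝓢(Eucl n, 𝕜)) (x : Eucl n) :
    schwartzMul a b x = a x * b x := by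
  simp [SchwartzMap.pairing_apply_apply]

/-- The Fourier transform of a product is the convolution of the Fourier transforms. -/
theorem enorm_fourier_schwartzMul_le (a b : 𝓢(Eucl n, ℂ)) (ξ : Eucl n) :
    ‖schwartzF (schwartzMul a b) ξ‖ₑ ≤ ∫⁻ t, ‖schwartzF a t‖ₑ * ‖schwartzF b (ξ - t)‖ₑ := by
  have hinv : ∀ (c : 𝓢(Eucl n, ℂ)) x, (𝓕⁻ c : 𝓢(Eucl n, ℂ)) x = schwartzF c (-x) := fun c x => by
    rw [SchwartzMap.fourierInv_apply_eq]; simp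
  have e1 : SchwartzMap.convolution (ContinuousLinearMap.mul ℂ ℂ) (𝓕⁻ a) (𝓕⁻ b) =
      𝓕⁻ (schwartzMul a b) := by
    rw [← FourierTransform.fourierInv_fourier_eq (F := 𝓢(Eucl n, ℂ))
        (SchwartzMap.convolution _ (𝓕⁻ a) (𝓕⁻ b)),
      SchwartzMap.fourier_convolution, FourierTransform.fourier_fourierInv_eq,
      FourierTransform.fourier_fourierInv_eq]
  have e2 : schwartzF (schwartzMul a b) ξ =
      ∫ t, schwartzF a (-t) * schwartzF b (ξ + t) := by
    have h := SchwartzMap.convolution_apply (ContinuousLinearMap.mul ℂ ℂ) (𝓕⁻ a) (𝓕⁻ b) (-ξ)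
    rw [e1, hinv, neg_neg] at h
    rw [h, convolution]
    congr 1; funext t
    rw [hinv, hinv, ContinuousLinearMap.mul_apply']
    congr 2
    abel
  rw [e2]
  refine (enorm_integral_le_lintegral_enorm _).trans (le_of_eq ?_)
  rw [← lintegral_neg_eq_self]
  congr 1; funext t
  rw [enorm_mul, neg_neg, sub_eq_add_neg]

/-- The product estimate `‖ab‖_l ≤ C ‖a‖_k ‖b‖_l`, `k = l + m`, on the Fourier side. After the
splitting of the weight by Peetre's inequality, Young's inequality applies to both convolutions,
with the `L¹` factors `â` and `⟨·⟩^{-m} b̂`. -/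
theorem wNorm_fourier_mul_sq_le (m : ℕ) (a b : 𝓢(Eucl n, ℂ)) :
    wNorm l (schwartzF (schwartzMul a b)) ^ 2 ≤ (2 ^ l) ^ 2 * 4 * 2 *
      (∫⁻ ξ : Eucl n, ((ejap ξ)⁻¹ ^ (l + m)) ^ 2) *
        (wNorm (l + m) (schwartzF a) ^ 2 * wNorm l (schwartzF b) ^ 2) := by
  set A : Eucl n → ℝ≥0∞ := fun t => ‖schwartzF a t‖ₑ with hA
  set B : Eucl n → ℝ≥0∞ := fun t => ‖schwartzF b t‖ₑ with hB
  have mA : Measurable A := (schwartzF a).continuous.measurable.enorm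
  have mB : Measurable B := (schwartzF b).continuous.measurable.enorm
  set K := ∫⁻ ξ : Eucl n, ((ejap ξ)⁻¹ ^ (l + m)) ^ 2 with hK
  have m1 : Measurable fun t => ejap t ^ l * B t := by fun_prop
  have m2 : Measurable fun t => (ejap t)⁻¹ ^ m * B t := by fun_prop
  have m3 : Measurable fun t => ejap t ^ (l + m) * A t := by fun_prop
  have mconv : ∀ {f g : Eucl n → ℝ≥0∞}, Measurable f → Measurable g →
      Measurable fun ξ => ∫⁻ t, f t * g (ξ - t) := fun {f g} hf hg =>
    Measurable.lintegral_prod_right' (f := fun p : Eucl n × Eucl n => f p.2 * g (p.1 - p.2))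
      (by fun_prop)
  have pt : ∀ ξ, ejap ξ ^ l * ‖schwartzF (schwartzMul a b) ξ‖ₑ ≤
      2 ^ l * ((∫⁻ t, A t * (ejap (ξ - t) ^ l * B (ξ - t))) +
        ∫⁻ t, (ejap t ^ (l + m) * A t) * ((ejap (ξ - t))⁻¹ ^ m * B (ξ - t))) := by
    intro ξ
    rw [← lintegral_add_left (by fun_prop), ← lintegral_const_mul _ (by fun_prop)]
    refine (mul_le_mul_right (enorm_fourier_schwartzMul_le a b ξ) _).trans ?_
    rw [← lintegral_const_mul _ (by fun_prop)]
    refine lintegral_mono fun t => ?_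
    refine (mul_le_mul_left (ejap_pow_le l m ξ t) _).trans (le_of_eq ?_)
    ring
  have y1 := lintegral_convolution_sq_le mA m1
  have y2 : ∫⁻ ξ, (∫⁻ t, (ejap t ^ (l + m) * A t) * ((ejap (ξ - t))⁻¹ ^ m * B (ξ - t))) ^ 2 ≤
      (∫⁻ t, (ejap t)⁻¹ ^ m * B t) ^ 2 * ∫⁻ t, (ejap t ^ (l + m) * A t) ^ 2 := by
    refine le_of_eq_of_le ?_ (lintegral_convolution_sq_le m2 m3)
    congr 1; funext ξ
    congr 1
    rw [← lintegral_sub_left_eq_self _ ξ]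
    congr 1; funext t
    rw [sub_sub_cancel, mul_comm]
  have z1 : (∫⁻ t, A t) ^ 2 ≤ K * wNorm (l + m) (schwartzF a) ^ 2 := by
    have := lintegral_ejap_inv_mul_sq_le (l := l + m) (m := 0) mA
    simpa [wNorm_sq] using this
  have z2 : (∫⁻ t, (ejap t)⁻¹ ^ m * B t) ^ 2 ≤ K * wNorm l (schwartzF b) ^ 2 := by
    rw [wNorm_sq]
    exact lintegral_ejap_inv_mul_sq_le mB
  calc wNorm l (schwartzF (schwartzMul a b)) ^ 2
      = ∫⁻ ξ, (ejap ξ ^ l * ‖schwartzF (schwartzMul a b) ξ‖ₑ) ^ 2 := wNorm_sq _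
    _ ≤ ∫⁻ ξ, (2 ^ l) ^ 2 * 4 * ((∫⁻ t, A t * (ejap (ξ - t) ^ l * B (ξ - t))) ^ 2 +
        (∫⁻ t, (ejap t ^ (l + m) * A t) * ((ejap (ξ - t))⁻¹ ^ m * B (ξ - t))) ^ 2) := by
        refine lintegral_mono fun ξ => ?_
        refine (pow_le_pow_left₀ zero_le (pt ξ) 2).trans ?_
        rw [mul_pow, mul_assoc]
        gcongr
        exact add_sq_le_four_mul _ _
    _ = (2 ^ l) ^ 2 * 4 * ((∫⁻ ξ, (∫⁻ t, A t * (ejap (ξ - t) ^ l * B (ξ - t))) ^ 2) +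
        ∫⁻ ξ, (∫⁻ t, (ejap t ^ (l + m) * A t) * ((ejap (ξ - t))⁻¹ ^ m * B (ξ - t))) ^ 2) := by
        have q1 : Measurable fun ξ => (∫⁻ t, A t * (ejap (ξ - t) ^ l * B (ξ - t))) ^ 2 :=
          (mconv mA m1).pow_const 2
        have q2 : Measurable fun ξ => (∫⁻ t, (ejap t ^ (l + m) * A t) *
          ((ejap (ξ - t))⁻¹ ^ m * B (ξ - t))) ^ 2 := (mconv m3 m2).pow_const 2
        rw [← lintegral_add_left q1]
        exact lintegral_const_mul _ (q1.add q2)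
    _ ≤ (2 ^ l) ^ 2 * 4 * (K * wNorm (l + m) (schwartzF a) ^ 2 * wNorm l (schwartzF b) ^ 2 +
        K * wNorm l (schwartzF b) ^ 2 * wNorm (l + m) (schwartzF a) ^ 2) := by
        gcongr
        · refine y1.trans ?_
          rw [wNorm_sq (l := l)]
          gcongr
        · refine y2.trans ?_
          rw [wNorm_sq (l := l + m)]
          gcongr
    _ = _ := by ring

/-- `|a| ≤ ∫ |â|`, and `â` is integrable by Cauchy–Schwarz if `k > n/2`. -/
theorem enorm_apply_sq_le (a : 𝓢(Eucl n, ℂ)) (x : Eucl n) :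
    ‖a x‖ₑ ^ 2 ≤ (∫⁻ ξ : Eucl n, ((ejap ξ)⁻¹ ^ k) ^ 2) * wNorm k (schwartzF a) ^ 2 := by
  have h1 : ‖a x‖ₑ ≤ ∫⁻ ξ, ‖schwartzF a ξ‖ₑ := by
    have e : a x = schwartzF (schwartzF a) (-x) := by
      conv_lhs => rw [← FourierTransform.fourierInv_fourier_eq (F := 𝓢(Eucl n, ℂ)) a,
        SchwartzMap.fourierInv_apply_eq]
      simp
    have h := SchwartzMap.norm_fourier_apply_le_toLp_one (schwartzF a) (-x)
    rw [SchwartzMap.norm_toLp_one] at h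
    rw [e, ← ofReal_norm, ← ofReal_integral_norm_eq_lintegral_enorm (schwartzF a).integrable]
    exact ENNReal.ofReal_le_ofReal h
  refine (pow_le_pow_left₀ zero_le h1 2).trans ?_
  have := lintegral_ejap_inv_mul_sq_le (l := k) (m := 0)
    (schwartzF a).continuous.measurable.enorm
  simpa [wNorm_sq] using this

/-- Sobolev embedding for Schwartz functions: `sup |a| ≤ C ‖a‖_k` for `k > n/2`. -/
theorem exists_abs_schwartz_le (hk : n < 2 * k) : ∃ C : ℝ, 0 ≤ C ∧ ∀ (a : 𝓢(Eucl n, ℝ)) x,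
    |a x| ≤ C * ‖ofSchwartz k a‖ := by
  obtain ⟨C, hC⟩ := exists_wNorm_schwartz_le n k
  have hK := lintegral_ejap_inv_lt_top hk
  set K := ∫⁻ ξ : Eucl n, ((ejap ξ)⁻¹ ^ k) ^ 2
  refine ⟨√(K * C ^ 2).toReal, Real.sqrt_nonneg _, fun a x => ?_⟩
  have h := (enorm_apply_sq_le (k := k) (schwartzOfReal a) x).trans
    (mul_le_mul_right (pow_le_pow_left₀ zero_le (hC a) 2) K)
  have e : ‖schwartzOfReal a x‖ₑ = ‖a x‖ₑ := enorm_eq_of_norm_eq (by simp)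
  rw [e] at h
  rw [mul_pow, ← mul_assoc] at h
  have h2 := ENNReal.toReal_mono (ENNReal.mul_ne_top (ENNReal.mul_ne_top hK.ne (by simp))
    (by simp)) h
  rw [ENNReal.toReal_mul (a := K * C ^ 2), ENNReal.toReal_pow, ENNReal.toReal_pow] at h2
  simp only [toReal_enorm] at h2
  rw [← Real.norm_eq_abs, ← Real.sqrt_sq (norm_nonneg (ofSchwartz k a)),
    ← Real.sqrt_mul ENNReal.toReal_nonneg]
  exact Real.le_sqrt_of_sq_le h2

/-- The product estimate for Schwartz functions. -/
theorem exists_norm_schwartzMul_le (hk : n < 2 * k) (hl : l ≤ k) : ∃ C : ℝ, 0 ≤ C ∧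
    ∀ a b : 𝓢(Eucl n, ℝ),
      ‖ofSchwartz l (schwartzMul a b)‖ ≤ C * ‖ofSchwartz k a‖ * ‖ofSchwartz l b‖ := by
  obtain ⟨m, rfl⟩ := Nat.exists_eq_add_of_le hl
  obtain ⟨C₀, hC₀⟩ := exists_enorm_schwartz_le n l
  obtain ⟨C₁, hC₁⟩ := exists_wNorm_schwartz_le n (l + m)
  obtain ⟨C₂, hC₂⟩ := exists_wNorm_schwartz_le n l
  have hK := lintegral_ejap_inv_lt_top hk
  set K := ∫⁻ ξ : Eucl n, ((ejap ξ)⁻¹ ^ (l + m)) ^ 2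
  set M : ℝ≥0∞ := C₀ ^ 2 * ((2 ^ l) ^ 2 * 4 * 2 * K) * C₁ ^ 2 * C₂ ^ 2 with hM
  have hMt : M ≠ ⊤ := by
    have := hK.ne
    finiteness
  refine ⟨√M.toReal, Real.sqrt_nonneg _, fun a b => ?_⟩
  have hc : schwartzOfReal (schwartzMul a b) =
      schwartzMul (schwartzOfReal a) (schwartzOfReal b) := by
    ext x; simp
  have h1 : ‖ofSchwartz l (schwartzMul a b)‖ₑ ^ 2 ≤
      M * (‖ofSchwartz (l + m) a‖ₑ ^ 2 * ‖ofSchwartz l b‖ₑ ^ 2) := by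
    calc ‖ofSchwartz l (schwartzMul a b)‖ₑ ^ 2
        ≤ (C₀ * wNorm l (schwartzF (schwartzMul (schwartzOfReal a) (schwartzOfReal b)))) ^ 2 := by
          rw [← hc]; gcongr; exact hC₀ _
      _ ≤ C₀ ^ 2 * ((2 ^ l) ^ 2 * 4 * 2 * K * ((C₁ * ‖ofSchwartz (l + m) a‖ₑ) ^ 2 *
          (C₂ * ‖ofSchwartz l b‖ₑ) ^ 2)) := by
          rw [mul_pow]
          gcongr
          refine (wNorm_fourier_mul_sq_le m _ _).trans ?_
          gcongr
          · exact hC₁ a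
          · exact hC₂ b
      _ = _ := by rw [hM]; ring
  clear_value M
  have h2 := ENNReal.toReal_mono (by finiteness) h1
  rw [ENNReal.toReal_mul (a := M), ENNReal.toReal_mul, ENNReal.toReal_pow, ENNReal.toReal_pow,
    ENNReal.toReal_pow] at h2
  simp only [toReal_enorm] at h2
  rw [mul_assoc, ← Real.sqrt_sq (mul_nonneg (norm_nonneg (ofSchwartz (l + m) a)) (norm_nonneg _)),
    ← Real.sqrt_mul ENNReal.toReal_nonneg, mul_pow]
  exact Real.le_sqrt_of_sq_le h2

end Estimates

/-! ### Continuous families of Sobolev functions -/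

section Families

variable {n k l m : ℕ} {X Y : Type*} [TopologicalSpace X] [TopologicalSpace Y]

/-- `F x`, `x ∈ X`, is a family of functions that represent elements of `H^l` depending
continuously on the parameter `x`. Each continuity statement is phrased as the statement that some
family has this property, with `X` the domain of the map in question. -/
def HFam (l : ℕ) (F : X → Eucl n → ℝ) : Prop :=
  ∃ u : X → Sobolev n l, Continuous u ∧ ∀ x, Represents (F x) (u x)

theorem hFam_of_continuous {u : X → Sobolev n l} (h : Continuous u) :
    HFam l fun x => (u x).toL2 := ⟨u, h, fun _ => ae_eq_rfl⟩

theorem HFam.congr {F G : X → Eucl n → ℝ} (h : HFam l F) (e : ∀ x, G x =ᵐ[volume] F x) :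
    HFam l G := by
  obtain ⟨u, hu, r⟩ := h
  exact ⟨u, hu, fun x => (e x).trans (r x)⟩

theorem HFam.comp {F : X → Eucl n → ℝ} (h : HFam l F) {g : Y → X} (hg : Continuous g) :
    HFam l fun y => F (g y) := by
  obtain ⟨u, hu, r⟩ := h
  exact ⟨u ∘ g, hu.comp hg, fun y => r (g y)⟩

theorem HFam.add {F G : X → Eucl n → ℝ} (hF : HFam l F) (hG : HFam l G) :
    HFam l fun x y => F x y + G x y := by
  obtain ⟨u, hu, r⟩ := hF
  obtain ⟨v, hv, t⟩ := hG
  refine ⟨fun x => u x + v x, hu.add hv, fun x => ?_⟩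
  unfold Represents
  rw [map_add]
  filter_upwards [r x, t x, Lp.coeFn_add (u x).toL2 (v x).toL2] with y h1 h2 h3
  rw [h1, h2, h3, Pi.add_apply]

theorem HFam.const_mul {F : X → Eucl n → ℝ} (hF : HFam l F) (c : ℝ) :
    HFam l fun x y => c * F x y := by
  obtain ⟨u, hu, r⟩ := hF
  refine ⟨fun x => c • u x, hu.const_smul c, fun x => ?_⟩
  unfold Represents
  rw [map_smul]
  filter_upwards [r x, Lp.coeFn_smul c (u x).toL2] with y h1 h2
  rw [h1, h2, Pi.smul_apply, smul_eq_mul]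

theorem HFam.neg {F : X → Eucl n → ℝ} (hF : HFam l F) : HFam l fun x y => -F x y :=
  (hF.const_mul (-1)).congr fun x => Eventually.of_forall fun y => by simp

theorem HFam.sub {F G : X → Eucl n → ℝ} (hF : HFam l F) (hG : HFam l G) :
    HFam l fun x y => F x y - G x y :=
  (hF.add hG.neg).congr fun x => Eventually.of_forall fun y => by simp [sub_eq_add_neg]

theorem hFam_zero : HFam l fun (_ : X) (_ : Eucl n) => (0 : ℝ) := by
  refine ⟨fun _ => 0, continuous_const, fun x => ?_⟩
  unfold Represents
  rw [map_zero]
  exact (Lp.coeFn_zero _ _ _).symm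

theorem HFam.sum {ι : Type*} (s : Finset ι) {F : ι → X → Eucl n → ℝ}
    (h : ∀ i ∈ s, HFam l (F i)) : HFam l fun x y => ∑ i ∈ s, F i x y := by
  classical
  induction s using Finset.induction_on with
  | empty => simpa using hFam_zero
  | insert i s hi ih =>
    simp only [Finset.sum_insert hi]
    exact (h i (Finset.mem_insert_self i s)).add
      (ih fun j hj => h j (Finset.mem_insert_of_mem hj))

theorem HFam.mono {F : X → Eucl n → ℝ} (hF : HFam m F) (h : l ≤ m) : HFam l F := by
  obtain ⟨u, hu, r⟩ := hF
  exact ⟨fun x => Sobolev.incl h (u x), (Sobolev.incl h).continuous.comp hu, r⟩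

theorem hFam_zero_iff {F : X → Eucl n → ℝ} :
    HFam 0 F ↔ ∃ u : X → L2 n, Continuous u ∧ ∀ x, F x =ᵐ[volume] u x := by
  constructor
  · rintro ⟨u, hu, r⟩
    exact ⟨fun x => (u x).toL2, Sobolev.continuous_toL2.comp hu, r⟩
  · rintro ⟨u, hu, r⟩
    choose v hv using fun x => Sobolev.exists_zero (u x)
    refine ⟨v, Sobolev.continuous_zero_iff.mpr (by simpa only [hv] using hu), fun x => ?_⟩
    unfold Represents
    rw [hv]; exact r x

theorem HFam.aestronglyMeasurable {F : X → Eucl n → ℝ} (hF : HFam l F) (x : X) :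
    AEStronglyMeasurable (F x) volume := by
  obtain ⟨u, _, r⟩ := hF
  exact (Lp.aestronglyMeasurable (u x).toL2).congr (r x).symm

theorem HFam.locallyIntegrable {F : X → Eucl n → ℝ} (hF : HFam l F) (x : X) :
    LocallyIntegrable (F x) := by
  obtain ⟨u, _, r⟩ := hF
  exact ((memLp_congr_ae (r x)).mpr (Lp.memLp (u x).toL2)).locallyIntegrable (by norm_num)

/-- A family in `L²` with weak partial derivatives in `H^l` is a family in `H^{l+1}`. This is the
induction step of all regularity proofs below. -/
theorem HFam.succ {F : X → Eucl n → ℝ} {G : Fin n → X → Eucl n → ℝ} (hF : HFam 0 F)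
    (hG : ∀ i, HFam l (G i)) (h : ∀ i x, IsWeakDeriv (Pi.single i 1) (F x) (G i x)) :
    HFam (l + 1) F := by
  obtain ⟨u, hu, r⟩ := hF
  choose v hv t using hG
  choose w hw0 hw1 using fun x => Sobolev.exists_succ (u := (u x).toL2) (v := fun i => v i x)
    fun i => (h i x).congr (r x) (t i x)
  refine ⟨w, Sobolev.continuous_succ_iff.mpr ⟨?_, fun i => ?_⟩, fun x => ?_⟩
  · simp_rw [hw0]; exact Sobolev.continuous_toL2.comp hu
  · simp_rw [hw1]; exact hv i
  · unfold Represents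
    rw [hw0]; exact r x

theorem HFam.exists_deriv {F : X → Eucl n → ℝ} (hF : HFam (l + 1) F) (i : Fin n) :
    ∃ G : X → Eucl n → ℝ, HFam l G ∧ ∀ x, IsWeakDeriv (Pi.single i 1) (F x) (G x) := by
  obtain ⟨u, hu, r⟩ := hF
  exact ⟨_, hFam_of_continuous ((Sobolev.D i).continuous.comp hu), fun x =>
    (Sobolev.D_spec i (u x)).congr (r x).symm ae_eq_rfl⟩

/-- A weak derivative of a family may be tested on a dense set of parameters. -/
theorem HFam.isWeakDeriv_of_dense {F G : X → Eucl n → ℝ} (hF : HFam 0 F) (hG : HFam 0 G)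
    {α : Fin n → ℕ} {S : Set X} (hS : Dense S) (h : ∀ x ∈ S, IsWeakDeriv α (F x) (G x)) (x : X) :
    IsWeakDeriv α (F x) (G x) := by
  obtain ⟨u, hu, r⟩ := hFam_zero_iff.mp hF
  obtain ⟨v, hv, t⟩ := hFam_zero_iff.mp hG
  have hc := isClosed_isWeakDeriv α hu hv
  have hsub : S ⊆ {x | IsWeakDeriv α (u x) (v x)} := fun x hx => (h x hx).congr (r x) (t x)
  have hx : x ∈ {x | IsWeakDeriv α (u x) (v x)} := hc.closure_subset_iff.mpr hsub (hS x)
  exact IsWeakDeriv.congr hx (r x).symm (t x).symm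

/-- A family of essentially bounded functions, continuous for the essential supremum. -/
structure EssBddFam (G : X → Eucl n → ℝ) : Prop where
  meas : ∀ x, AEStronglyMeasurable (G x) volume
  bdd : ∀ x, ∃ C, ∀ᵐ y, |G x y| ≤ C
  cont : ∀ x₀, ∀ ε > 0, ∀ᶠ x in 𝓝 x₀, ∀ᵐ y, |G x y - G x₀ y| ≤ ε

theorem EssBddFam.const_add {G : X → Eucl n → ℝ} (h : EssBddFam G) (c : ℝ) :
    EssBddFam fun x y => c + G x y := by
  refine ⟨fun x => aestronglyMeasurable_const.add (h.meas x), fun x => ?_, fun x₀ ε hε => ?_⟩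
  · obtain ⟨C, hC⟩ := h.bdd x
    refine ⟨|c| + C, ?_⟩
    filter_upwards [hC] with y hy
    exact (abs_add_le _ _).trans (add_le_add le_rfl hy)
  · simpa only [add_sub_add_left_eq_sub] using h.cont x₀ ε hε

theorem EssBddFam.inv {G : X → Eucl n → ℝ} (h : EssBddFam G)
    (hG : ∀ x, ∃ c > 0, ∀ᵐ y, c ≤ G x y) : EssBddFam fun x y => (G x y)⁻¹ := by
  refine ⟨fun x => (h.meas x).aemeasurable.inv.aestronglyMeasurable, fun x => ?_,
    fun x₀ ε hε => ?_⟩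
  · obtain ⟨c, hc, hcx⟩ := hG x
    refine ⟨c⁻¹, ?_⟩
    filter_upwards [hcx] with y hy
    rw [abs_of_pos (inv_pos.mpr (hc.trans_le hy))]
    exact inv_anti₀ hc hy
  · obtain ⟨c, hc, hcx⟩ := hG x₀
    have hδ : 0 < min (c / 2) (ε * c ^ 2 / 2) := by positivity
    filter_upwards [h.cont x₀ _ hδ] with x hx
    filter_upwards [hx, hcx] with y hy hcy
    have h1 : |G x y - G x₀ y| ≤ c / 2 := hy.trans (min_le_left _ _)
    have h2 : |G x y - G x₀ y| ≤ ε * c ^ 2 / 2 := hy.trans (min_le_right _ _)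
    have h3 : c / 2 ≤ G x y := by linarith [neg_le_of_abs_le h1]
    have p1 : 0 < G x y := by linarith
    have p2 : 0 < G x₀ y := by linarith
    rw [inv_sub_inv p1.ne' p2.ne', abs_div, abs_of_pos (mul_pos p1 p2), abs_sub_comm,
      div_le_iff₀ (mul_pos p1 p2)]
    refine h2.trans ?_
    have : c / 2 * c ≤ G x y * G x₀ y := mul_le_mul h3 hcy hc.le p1.le
    nlinarith

/-- Multiplication `L^∞ × L² → L²` is continuous. -/
theorem EssBddFam.mul {F G : X → Eucl n → ℝ} (hG : EssBddFam G) (hF : HFam 0 F) :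
    HFam 0 fun x y => G x y * F x y := by
  obtain ⟨u, hu, r⟩ := hFam_zero_iff.mp hF
  have hm : ∀ x, MemLp (fun y => G x y * F x y) 2 volume := by
    intro x
    obtain ⟨C, hC⟩ := hG.bdd x
    refine MemLp.of_le_mul (c := C) (Lp.memLp (u x))
      ((hG.meas x).mul (hF.aestronglyMeasurable x)) ?_
    filter_upwards [hC, r x] with y h1 h2
    rw [norm_mul, h2]
    exact mul_le_mul_of_nonneg_right h1 (norm_nonneg _)
  refine hFam_zero_iff.mpr ⟨fun x => (hm x).toLp _, ?_, fun x => (hm x).coeFn_toLp.symm⟩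
  rw [continuous_iff_continuousAt]
  intro x₀
  obtain ⟨C, hC⟩ := hG.bdd x₀
  rw [ContinuousAt, tendsto_iff_norm_sub_tendsto_zero, Metric.tendsto_nhds]
  intro ε hε
  have hlim : Tendsto (fun x => ε / (2 * (‖u x₀‖ + 1)) * ‖u x‖ + (max C 0) * ‖u x - u x₀‖) (𝓝 x₀)
      (𝓝 (ε / (2 * (‖u x₀‖ + 1)) * ‖u x₀‖ + (max C 0) * ‖u x₀ - u x₀‖)) := by
    have := hu.tendsto x₀
    exact (this.norm.const_mul _).add ((this.sub_const _).norm.const_mul _)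
  have hlt : ε / (2 * (‖u x₀‖ + 1)) * ‖u x₀‖ + (max C 0) * ‖u x₀ - u x₀‖ < ε := by
    rw [sub_self, norm_zero, mul_zero, add_zero, div_mul_eq_mul_div, div_lt_iff₀ (by positivity)]
    nlinarith [norm_nonneg (u x₀)]
  have hδ : 0 < ε / (2 * (‖u x₀‖ + 1)) := by positivity
  filter_upwards [hG.cont x₀ _ hδ, hlim.eventually (gt_mem_nhds hlt)] with x hx hxε
  rw [Real.dist_eq, sub_zero, abs_of_nonneg (norm_nonneg _)]
  refine lt_of_le_of_lt ?_ hxε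
  have hm1 : MemLp (fun y => (G x y - G x₀ y) * u x y) 2 volume := by
    refine MemLp.of_le_mul (c := ε / (2 * (‖u x₀‖ + 1))) (Lp.memLp (u x))
      (((hG.meas x).sub (hG.meas x₀)).mul (Lp.aestronglyMeasurable _)) ?_
    filter_upwards [hx] with y h1
    rw [norm_mul]
    exact mul_le_mul_of_nonneg_right h1 (norm_nonneg _)
  have hm2 : MemLp (fun y => G x₀ y * (u x - u x₀ : L2 n) y) 2 volume := by
    refine MemLp.of_le_mul (c := C) (Lp.memLp (u x - u x₀))
      ((hG.meas x₀).mul (Lp.aestronglyMeasurable _)) ?_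
    filter_upwards [hC] with y h1
    rw [norm_mul]
    exact mul_le_mul_of_nonneg_right h1 (norm_nonneg _)
  -- `g u - g₀ u₀ = (g - g₀) u + g₀ (u - u₀)`
  have e : (hm x).toLp _ - (hm x₀).toLp _ = hm1.toLp _ + hm2.toLp _ := by
    apply Lp.ext
    filter_upwards [Lp.coeFn_sub ((hm x).toLp _) ((hm x₀).toLp _), (hm x).coeFn_toLp,
      (hm x₀).coeFn_toLp, Lp.coeFn_add (hm1.toLp _) (hm2.toLp _), hm1.coeFn_toLp,
      hm2.coeFn_toLp, r x, r x₀, Lp.coeFn_sub (u x) (u x₀)] with y e1 e2 e3 e4 e5 e6 e7 e8 e9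
    rw [e1, e4, Pi.sub_apply, Pi.add_apply, e2, e3, e5, e6, e7, e8, e9, Pi.sub_apply]
    ring
  rw [e]
  refine (norm_add_le _ _).trans (add_le_add ?_ ?_)
  · refine Lp.norm_le_mul_norm_of_ae_le_mul ?_
    filter_upwards [hm1.coeFn_toLp, hx] with y h1 h2
    rw [h1, norm_mul]
    exact mul_le_mul_of_nonneg_right h2 (norm_nonneg _)
  · refine Lp.norm_le_mul_norm_of_ae_le_mul ?_
    filter_upwards [hm2.coeFn_toLp, hC] with y h1 h2
    rw [h1, norm_mul]
    exact mul_le_mul_of_nonneg_right (h2.trans (le_max_left _ _)) (norm_nonneg _)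

/-! ### The Sobolev embedding and the multiplication map -/

/-- The Sobolev embedding `H^k ⊂ L^∞` for `k > n/2`. -/
theorem exists_ae_abs_le (hk : n < 2 * k) : ∃ C : ℝ, 0 ≤ C ∧ ∀ u : Sobolev n k,
    ∀ᵐ x, |u.toL2 x| ≤ C * ‖u‖ := by
  obtain ⟨C, hC0, hC⟩ := exists_abs_schwartz_le hk
  refine ⟨C, hC0, fun u => ?_⟩
  obtain ⟨v, hv, hlim⟩ := mem_closure_iff_seq_limit.mp (denseRange_ofSchwartz n k u)
  choose a ha using hv
  have h1 : Tendsto (fun m => (v m).toL2) atTop (𝓝 u.toL2) :=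
    (Sobolev.continuous_toL2.tendsto u).comp hlim
  obtain ⟨ns, hns, hae⟩ := (tendstoInMeasure_of_tendsto_Lp h1).exists_seq_tendsto_ae
  have h2 : ∀ᵐ x, ∀ m, (v m).toL2 x = a m x := ae_all_iff.mpr fun m => by
    rw [← ha m]; exact coeFn_ofSchwartz (a m)
  filter_upwards [hae, h2] with x hx h2x
  refine le_of_tendsto_of_tendsto hx.abs ((hlim.comp hns.tendsto_atTop).norm.const_mul C)
    (Eventually.of_forall fun m => ?_)
  change |(v (ns m)).toL2 x| ≤ C * ‖v (ns m)‖
  rw [h2x, ← ha]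
  exact hC _ x

theorem HFam.essBddFam (hk : n < 2 * k) {F : X → Eucl n → ℝ} (hF : HFam k F) :
    EssBddFam F := by
  obtain ⟨C, hC0, hC⟩ := exists_ae_abs_le hk
  obtain ⟨u, hu, r⟩ := id hF
  refine ⟨hF.aestronglyMeasurable, fun x => ⟨C * ‖u x‖, ?_⟩, fun x₀ ε hε => ?_⟩
  · filter_upwards [r x, hC (u x)] with y h1 h2
    rwa [h1]
  · have hlim : Tendsto (fun x => C * ‖u x - u x₀‖) (𝓝 x₀) (𝓝 (C * ‖u x₀ - u x₀‖)) :=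
      ((hu.tendsto x₀).sub_const _).norm.const_mul C
    rw [sub_self, norm_zero, mul_zero] at hlim
    filter_upwards [hlim.eventually (gt_mem_nhds hε)] with x hx
    filter_upwards [r x, r x₀, hC (u x - u x₀), Lp.coeFn_sub (u x).toL2 (u x₀).toL2]
      with y h1 h2 h3 h4
    rw [map_sub, h4, Pi.sub_apply] at h3
    rw [h1, h2]
    exact h3.trans hx.le

/-- The product estimate `‖fg‖_l ≤ C ‖f‖_k ‖g‖_l` for `l ≤ k`, `k > n/2`, extended from Schwartz
functions by density. -/
theorem exists_mul (hk : n < 2 * k) (hl : l ≤ k) : ∃ C : ℝ, ∀ (f : Sobolev n k)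
    (g : Sobolev n l), ∃ p : Sobolev n l,
      Represents (fun x => f.toL2 x * g.toL2 x) p ∧ ‖p‖ ≤ C * ‖f‖ * ‖g‖ := by
  obtain ⟨C, hC0, hC⟩ := exists_norm_schwartzMul_le hk hl
  refine ⟨C, fun f g => ?_⟩
  obtain ⟨M, hM, hMr⟩ := hFam_zero_iff.mp
    (((hFam_of_continuous (continuous_fst (X := Sobolev n k) (Y := Sobolev n l))).essBddFam
      hk).mul ((hFam_of_continuous (continuous_snd (X := Sobolev n k) (Y := Sobolev n l))).mono
        (Nat.zero_le l)))
  -- along pairs of Schwartz functions that tend to `(f, g)`, the products converge in `H^l`, and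
  -- by the `L^∞` bound their limit in `L²` is `f g`
  let ι : 𝓢(Eucl n, ℝ) × 𝓢(Eucl n, ℝ) → Sobolev n k × Sobolev n l :=
    Prod.map (ofSchwartz k) (ofSchwartz l)
  let P : 𝓢(Eucl n, ℝ) × 𝓢(Eucl n, ℝ) → Sobolev n l :=
    fun p => ofSchwartz l (schwartzMul p.1 p.2)
  have hd : DenseRange ι := (denseRange_ofSchwartz n k).prodMap (denseRange_ofSchwartz n l)
  let L := comap ι (𝓝 (f, g))
  have : NeBot L := comap_neBot fun t ht => by
    obtain ⟨_, hy, p, rfl⟩ := mem_closure_iff_nhds.mp (hd (f, g)) t ht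
    exact ⟨p, hy⟩
  have t0 : Tendsto ι L (𝓝 (f, g)) := tendsto_comap
  have t1 : Tendsto (fun p => ofSchwartz k p.1) L (𝓝 f) := (continuous_fst.tendsto _).comp t0
  have t2 : Tendsto (fun p => ofSchwartz l p.2) L (𝓝 g) := (continuous_snd.tendsto _).comp t0
  have hsub : ∀ p q : 𝓢(Eucl n, ℝ) × 𝓢(Eucl n, ℝ), dist (P p) (P q) ≤
      C * ‖ofSchwartz k p.1 - ofSchwartz k q.1‖ * ‖ofSchwartz l p.2‖ +
      C * ‖ofSchwartz k q.1‖ * ‖ofSchwartz l p.2 - ofSchwartz l q.2‖ := by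
    intro p q
    have e : schwartzMul p.1 p.2 - schwartzMul q.1 q.2 =
        schwartzMul (p.1 - q.1) p.2 + schwartzMul q.1 (p.2 - q.2) := by
      ext x
      simp [SchwartzMap.pairing_apply_apply]
    rw [dist_eq_norm, ← map_sub, ← map_sub, ← map_sub, e, map_add]
    exact (norm_add_le _ _).trans (add_le_add (hC _ _) (hC _ _))
  have hcau : Cauchy (map P L) := by
    rw [cauchy_map_iff', Metric.uniformity_eq_comap_nhds_zero, tendsto_comap_iff]
    have s1 : Tendsto (fun pq : (𝓢(Eucl n, ℝ) × 𝓢(Eucl n, ℝ)) × (𝓢(Eucl n, ℝ) × 𝓢(Eucl n, ℝ)) =>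
        C * ‖ofSchwartz k pq.1.1 - ofSchwartz k pq.2.1‖ * ‖ofSchwartz l pq.1.2‖ +
        C * ‖ofSchwartz k pq.2.1‖ * ‖ofSchwartz l pq.1.2 - ofSchwartz l pq.2.2‖) (L ×ˢ L)
        (𝓝 (C * ‖f - f‖ * ‖g‖ + C * ‖f‖ * ‖g - g‖)) := by
      have a1 := t1.comp (tendsto_fst (f := L) (g := L))
      have a2 := t1.comp (tendsto_snd (f := L) (g := L))
      have b1 := t2.comp (tendsto_fst (f := L) (g := L))
      have b2 := t2.comp (tendsto_snd (f := L) (g := L))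
      exact (((a1.sub a2).norm.const_mul C).mul b1.norm).add
        ((a2.norm.const_mul C).mul (b1.sub b2).norm)
    simp only [sub_self, norm_zero, mul_zero, zero_mul, add_zero] at s1
    exact squeeze_zero (fun _ => dist_nonneg) (fun pq => hsub pq.1 pq.2) s1
  obtain ⟨p, hp⟩ := CompleteSpace.complete hcau
  have hp' : Tendsto P L (𝓝 p) := hp
  refine ⟨p, ?_, ?_⟩
  · have u1 : Tendsto (fun q => (P q).toL2) L (𝓝 p.toL2) :=
      (Sobolev.continuous_toL2.tendsto p).comp hp'
    have u2 : Tendsto (fun q => M (ι q)) L (𝓝 (M (f, g))) := (hM.tendsto _).comp t0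
    have e : ∀ q, (P q).toL2 = M (ι q) := by
      intro q
      apply Lp.ext
      filter_upwards [hMr (ι q), coeFn_ofSchwartz (l := k) q.1, coeFn_ofSchwartz (l := l) q.2,
        coeFn_ofSchwartz (l := l) (schwartzMul q.1 q.2)] with x h1 h2 h3 h4
      rw [← h1]
      change (ofSchwartz l (schwartzMul q.1 q.2)).toL2 x =
        (ofSchwartz k q.1).toL2 x * (ofSchwartz l q.2).toL2 x
      rw [h2, h3, h4, schwartzMul_apply]
    simp_rw [e] at u1
    unfold Represents
    rw [tendsto_nhds_unique u1 u2]
    exact hMr (f, g)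
  · exact le_of_tendsto_of_tendsto hp'.norm ((t1.norm.const_mul C).mul t2.norm)
      (Eventually.of_forall fun q => hC q.1 q.2)

/-- Multiplication `H^k × H^l → H^l` is continuous for `l ≤ k`, `k > n/2`. -/
theorem HFam.mul (hk : n < 2 * k) (hl : l ≤ k) {F G : X → Eucl n → ℝ} (hF : HFam k F)
    (hG : HFam l G) : HFam l fun x y => F x y * G x y := by
  obtain ⟨C, hC⟩ := exists_mul hk hl
  choose P hP hPC using hC
  have hP' : ∀ f g, (P f g).toL2 =ᵐ[volume] fun x => f.toL2 x * g.toL2 x := fun f g =>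
    (hP f g).symm
  have hb : IsBoundedBilinearMap ℝ (fun p : Sobolev n k × Sobolev n l => P p.1 p.2) := by
    refine ⟨fun f₁ f₂ g => ?_, fun c f g => ?_, fun f g₁ g₂ => ?_, fun c f g => ?_,
      max C 1, lt_max_of_lt_right one_pos, fun f g => ?_⟩
    · apply Sobolev.toL2_injective
      rw [map_add]
      apply Lp.ext
      filter_upwards [hP' (f₁ + f₂) g, hP' f₁ g, hP' f₂ g,
        Lp.coeFn_add (P f₁ g).toL2 (P f₂ g).toL2, Lp.coeFn_add f₁.toL2 f₂.toL2]
        with x h1 h2 h3 h4 h5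
      rw [h1, h4, Pi.add_apply, h2, h3, map_add, h5, Pi.add_apply, add_mul]
    · apply Sobolev.toL2_injective
      rw [map_smul]
      apply Lp.ext
      filter_upwards [hP' (c • f) g, hP' f g, Lp.coeFn_smul c (P f g).toL2,
        Lp.coeFn_smul c f.toL2] with x h1 h2 h3 h4
      rw [h1, h3, Pi.smul_apply, h2, map_smul, h4, Pi.smul_apply, smul_eq_mul, smul_eq_mul,
        mul_assoc]
    · apply Sobolev.toL2_injective
      rw [map_add]
      apply Lp.ext
      filter_upwards [hP' f (g₁ + g₂), hP' f g₁, hP' f g₂,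
        Lp.coeFn_add (P f g₁).toL2 (P f g₂).toL2, Lp.coeFn_add g₁.toL2 g₂.toL2]
        with x h1 h2 h3 h4 h5
      rw [h1, h4, Pi.add_apply, h2, h3, map_add, h5, Pi.add_apply, mul_add]
    · apply Sobolev.toL2_injective
      rw [map_smul]
      apply Lp.ext
      filter_upwards [hP' f (c • g), hP' f g, Lp.coeFn_smul c (P f g).toL2,
        Lp.coeFn_smul c g.toL2] with x h1 h2 h3 h4
      rw [h1, h3, Pi.smul_apply, h2, map_smul, h4, Pi.smul_apply, smul_eq_mul, smul_eq_mul]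
      ring
    · refine (hPC f g).trans ?_
      gcongr
      exact le_max_left _ _
  obtain ⟨u, hu, r⟩ := hF
  obtain ⟨v, hv, t⟩ := hG
  refine ⟨fun x => P (u x) (v x), hb.continuous.comp (hu.prodMk hv), fun x => ?_⟩
  unfold Represents
  filter_upwards [r x, t x, hP' (u x) (v x)] with y h1 h2 h3
  rw [h1, h2, h3]

end Families

/-! ### The algebra of constants plus `H^k`, and division -/

section Division

variable {n k l : ℕ} {X Y : Type*} [TopologicalSpace X] [TopologicalSpace Y]

/-- Families in `ℝ + H^k`, with a constant that does not depend on the parameter. -/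
def AFam (k : ℕ) (F : X → Eucl n → ℝ) : Prop := ∃ c : ℝ, HFam k fun x y => F x y - c

theorem AFam.exists_eq {F : X → Eucl n → ℝ} (h : AFam k F) :
    ∃ (c : ℝ) (H : X → Eucl n → ℝ), HFam k H ∧ F = fun x y => c + H x y := by
  obtain ⟨c, hc⟩ := h
  exact ⟨c, _, hc, by simp⟩

theorem aFam_const (c : ℝ) : AFam k fun (_ : X) (_ : Eucl n) => c :=
  ⟨c, by simpa using hFam_zero⟩

theorem AFam.comp {F : X → Eucl n → ℝ} (h : AFam k F) {g : Y → X} (hg : Continuous g) :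
    AFam k fun y => F (g y) := by
  obtain ⟨c, hc⟩ := h
  exact ⟨c, hc.comp hg⟩

theorem AFam.add {F G : X → Eucl n → ℝ} (hF : AFam k F) (hG : AFam k G) :
    AFam k fun x y => F x y + G x y := by
  obtain ⟨c, H, hH, rfl⟩ := hF.exists_eq
  obtain ⟨d, K, hK, rfl⟩ := hG.exists_eq
  refine ⟨c + d, (hH.add hK).congr fun x => Eventually.of_forall fun y => ?_⟩
  simp only; ring

theorem AFam.mul (hk : n < 2 * k) {F G : X → Eucl n → ℝ} (hF : AFam k F) (hG : AFam k G) :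
    AFam k fun x y => F x y * G x y := by
  obtain ⟨c, H, hH, rfl⟩ := hF.exists_eq
  obtain ⟨d, K, hK, rfl⟩ := hG.exists_eq
  refine ⟨c * d, (((hK.const_mul c).add (hH.const_mul d)).add (hH.mul hk le_rfl hK)).congr
    fun x => Eventually.of_forall fun y => ?_⟩
  simp only; ring

theorem AFam.sum {ι : Type*} (s : Finset ι) {F : ι → X → Eucl n → ℝ}
    (h : ∀ i ∈ s, AFam k (F i)) : AFam k fun x y => ∑ i ∈ s, F i x y := by
  classical
  induction s using Finset.induction_on with
  | empty => simpa using aFam_const 0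
  | insert i s hi ih =>
    simp only [Finset.sum_insert hi]
    exact (h i (Finset.mem_insert_self i s)).add
      (ih fun j hj => h j (Finset.mem_insert_of_mem hj))

theorem AFam.prod (hk : n < 2 * k) {ι : Type*} (s : Finset ι) {F : ι → X → Eucl n → ℝ}
    (h : ∀ i ∈ s, AFam k (F i)) : AFam k fun x y => ∏ i ∈ s, F i x y := by
  classical
  induction s using Finset.induction_on with
  | empty => simpa using aFam_const 1
  | insert i s hi ih =>
    simp only [Finset.prod_insert hi]
    exact (h i (Finset.mem_insert_self i s)).mul hk
      (ih fun j hj => h j (Finset.mem_insert_of_mem hj))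

theorem AFam.det (hk : n < 2 * k) {d : ℕ} {M : X → Eucl n → Matrix (Fin d) (Fin d) ℝ}
    (h : ∀ i j, AFam k fun x y => M x y i j) : AFam k fun x y => (M x y).det := by
  simp only [Matrix.det_apply']
  exact AFam.sum _ fun σ _ => (aFam_const _).mul hk (AFam.prod hk _ fun i _ => h _ _)

theorem AFam.adjugate (hk : n < 2 * k) {d : ℕ} {M : X → Eucl n → Matrix (Fin d) (Fin d) ℝ}
    (h : ∀ i j, AFam k fun x y => M x y i j) (i j : Fin d) :
    AFam k fun x y => (M x y).adjugate i j := by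
  simp only [Matrix.adjugate_apply]
  refine AFam.det hk fun a b => ?_
  by_cases ha : a = j
  · subst ha
    simpa using aFam_const _
  · simpa [Matrix.updateRow_ne ha] using h a b

theorem AFam.essBddFam (hk : n < 2 * k) {F : X → Eucl n → ℝ} (hF : AFam k F) :
    EssBddFam F := by
  obtain ⟨c, H, hH, rfl⟩ := hF.exists_eq
  exact (hH.essBddFam hk).const_add c

theorem AFam.mul_hFam (hk : n < 2 * k) (hl : l ≤ k) {F G : X → Eucl n → ℝ} (hF : AFam k F)
    (hG : HFam l G) : HFam l fun x y => F x y * G x y := by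
  obtain ⟨c, H, hH, rfl⟩ := hF.exists_eq
  refine ((hG.const_mul c).add (hH.mul hk hl hG)).congr
    fun x => Eventually.of_forall fun y => ?_
  simp only; ring

/-- Bounds almost everywhere between continuous functions hold everywhere. -/
theorem le_of_ae_le {f g : Eucl n → ℝ} (hf : Continuous f) (hg : Continuous g)
    (h : ∀ᵐ y, f y ≤ g y) (y : Eucl n) : f y ≤ g y := by
  have hd := Measure.dense_of_ae h
  have hc : IsClosed {y | f y ≤ g y} := isClosed_le hf hg
  have : y ∈ closure {y | f y ≤ g y} := hd y
  rwa [hc.closure_eq] at this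

/-- The quotient rule for weak derivatives. The product `u ∂ᵢh` is written as `∂ᵢ(hu) - h ∂ᵢu`,
which needs no product rule for weak derivatives. Both sides are continuous in
`(u, h) ∈ H¹ × H^k`, where `c + h` is bounded below, so that `u` and `h` may be taken to be
Schwartz functions. -/
theorem isWeakDeriv_div (hk : n < 2 * k) (hk1 : 1 ≤ k) (c : ℝ) (i : Fin n) {u h f e : Eucl n → ℝ}
    {u' : Sobolev n 1} {h' : Sobolev n k} (hu : Represents u u') (hh : Represents h h')
    (hpos : ∃ c₀ > 0, ∀ᵐ y, c₀ ≤ c + h y)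
    (hf : IsWeakDeriv (Pi.single i 1) u f) (lf : LocallyIntegrable f)
    (he : IsWeakDeriv (Pi.single i 1) (fun y => h y * u y) e) (le : LocallyIntegrable e) :
    IsWeakDeriv (Pi.single i 1) (fun y => u y / (c + h y))
      (fun y => (f y - (e y - h y * f y) / (c + h y)) / (c + h y)) := by
  let O : Set (Sobolev n 1 × Sobolev n k) := {p | ∃ c₀ > 0, ∀ᵐ y, c₀ ≤ c + p.2.toL2 y}
  have hO : IsOpen O := by
    rw [isOpen_iff_mem_nhds]
    rintro p ⟨c₀, hc₀, hp⟩
    have hE := ((hFam_of_continuous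
      (continuous_snd (X := Sobolev n 1) (Y := Sobolev n k))).essBddFam hk).cont p (c₀ / 2) (by positivity)
    filter_upwards [hE] with q hq
    refine ⟨c₀ / 2, by positivity, ?_⟩
    filter_upwards [hp, hq] with y h1 h2
    linarith [neg_le_of_abs_le h2]
  let U : O → Eucl n → ℝ := fun z => z.1.1.toL2
  let H : O → Eucl n → ℝ := fun z => z.1.2.toL2
  have hU : HFam 1 U := hFam_of_continuous (continuous_fst.comp continuous_subtype_val)
  have hH : HFam k H := hFam_of_continuous (continuous_snd.comp continuous_subtype_val)
  obtain ⟨F, hF, hFd⟩ := hU.exists_deriv i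
  obtain ⟨E, hE, hEd⟩ := (hH.mul hk hk1 hU).exists_deriv i
  have hinv : EssBddFam fun z y => (c + H z y)⁻¹ :=
    ((hH.essBddFam hk).const_add c).inv fun z => z.2
  have hL : HFam 0 fun z y => U z y / (c + H z y) :=
    (hinv.mul (hU.mono zero_le_one)).congr fun z => Eventually.of_forall fun y => by
      simp only; ring
  have hR : HFam 0 fun z y => (F z y - (E z y - H z y * F z y) / (c + H z y)) / (c + H z y) :=
    (hinv.mul (hF.sub (hinv.mul (hE.sub ((hH.essBddFam hk).mul hF))))).congr
      fun z => Eventually.of_forall fun y => by simp only; ring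
  let ι : 𝓢(Eucl n, ℝ) × 𝓢(Eucl n, ℝ) → Sobolev n 1 × Sobolev n k :=
    Prod.map (ofSchwartz 1) (ofSchwartz k)
  have hd : Dense (Set.range ι) := (denseRange_ofSchwartz n 1).prodMap (denseRange_ofSchwartz n k)
  have hd' : Dense ((Subtype.val : O → _) ⁻¹' Set.range ι) := hd.preimage hO.isOpenMap_subtype_val
  have key := hL.isWeakDeriv_of_dense hR hd' (α := Pi.single i 1) (by
    rintro ⟨_, c₀, hc₀, hp⟩ ⟨⟨a, b⟩, rfl⟩
    have ea : (ofSchwartz 1 a).toL2 =ᵐ[volume] a := coeFn_ofSchwartz a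
    have eb : (ofSchwartz k b).toL2 =ᵐ[volume] b := coeFn_ofSchwartz b
    have hp' : ∀ y, c₀ ≤ c + b y := by
      refine le_of_ae_le continuous_const (continuous_const.add b.continuous) ?_
      filter_upwards [hp, eb] with y h1 h2
      rw [← h2]; exact h1
    have hne : ∀ y, c + b y ≠ 0 := fun y => (hc₀.trans_le (hp' y)).ne'
    have eF : F ⟨ι (a, b), c₀, hc₀, hp⟩ =ᵐ[volume] partialDeriv i a := by
      refine (hFd _).ae_unique
        ((isWeakDeriv_of_contDiff i (a.smooth 1)).congr ea.symm ae_eq_rfl)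
        (hF.locallyIntegrable _) ?_
      exact (partialDeriv_contDiff i (a.smooth ⊤)).continuous.locallyIntegrable
    have eE : E ⟨ι (a, b), c₀, hc₀, hp⟩ =ᵐ[volume] partialDeriv i fun y => b y * a y := by
      refine (hEd _).ae_unique ((isWeakDeriv_of_contDiff i
        ((b.smooth 1).mul (a.smooth 1))).congr ?_ ae_eq_rfl) (hE.locallyIntegrable _) ?_
      · filter_upwards [ea, eb] with y h1 h2
        change b y * a y = (ofSchwartz k b).toL2 y * (ofSchwartz 1 a).toL2 y
        rw [h1, h2]
      · exact (partialDeriv_contDiff i ((b.smooth ⊤).mul (a.smooth ⊤))).continuous.locallyIntegrable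
    have hcd : ContDiff ℝ 1 fun y => a y / (c + b y) :=
      (a.smooth 1).div (contDiff_const.add (b.smooth 1)) hne
    refine (isWeakDeriv_of_contDiff i hcd).congr ?_ ?_
    · filter_upwards [ea, eb] with y h1 h2
      change a y / (c + b y) = (ofSchwartz 1 a).toL2 y / (c + (ofSchwartz k b).toL2 y)
      rw [h1, h2]
    · filter_upwards [eb, eF, eE] with y h2 h3 h4
      rw [h3, h4]
      change _ = (partialDeriv i a y - (partialDeriv i (fun y => b y * a y) y -
        (ofSchwartz k b).toL2 y * partialDeriv i a y) / (c + (ofSchwartz k b).toL2 y)) /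
          (c + (ofSchwartz k b).toL2 y)
      rw [h2]
      have da := a.hasFDerivAt y
      have db := b.hasFDerivAt y
      have dba : HasFDerivAt (fun y => b y * a y) _ y := db.mul da
      have dg : HasFDerivAt (fun y => c + b y) (fderiv ℝ b y) y := db.const_add c
      have dinv : HasFDerivAt (fun y => (c + b y)⁻¹) (-((c + b y) ^ 2)⁻¹ • fderiv ℝ b y) y :=
        (hasDerivAt_inv (hne y)).comp_hasFDerivAt y dg
      have dq : HasFDerivAt (fun y => a y * (c + b y)⁻¹) _ y := da.mul dinv
      have edq : (fun y => a y / (c + b y)) = fun y => a y * (c + b y)⁻¹ := by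
        simp only [div_eq_mul_inv]
      unfold partialDeriv
      rw [edq, dq.fderiv, dba.fderiv]
      simp only [add_apply, smul_apply, smul_eq_mul]
      have := hne y
      field_simp
      ring)
  obtain ⟨c₀, hc₀, hp⟩ := hpos
  have hz : (u', h') ∈ O := by
    refine ⟨c₀, hc₀, ?_⟩
    filter_upwards [hp, hh] with y h1 h2
    rw [← h2]; exact h1
  have eF : F ⟨(u', h'), hz⟩ =ᵐ[volume] f :=
    (hFd _).ae_unique (hf.congr hu ae_eq_rfl) (hF.locallyIntegrable _) lf
  have eE : E ⟨(u', h'), hz⟩ =ᵐ[volume] e := by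
    refine (hEd _).ae_unique (he.congr ?_ ae_eq_rfl) (hE.locallyIntegrable _) le
    filter_upwards [hu, hh] with y h1 h2
    rw [h1, h2]
  refine (key ⟨(u', h'), hz⟩).congr ?_ ?_
  · filter_upwards [hu, hh] with y h1 h2
    rw [h1, h2]
  · filter_upwards [hh, eF, eE] with y h2 h3 h4
    rw [h2, h3, h4]

/-- Division by a function in `ℝ + H^k` that is bounded below preserves `H^l`, `l ≤ k`. -/
theorem HFam.div (hk : n < 2 * k) (hl : l ≤ k) {F G : X → Eucl n → ℝ} (hF : HFam l F)
    (hG : AFam k G) (hpos : ∀ x, ∃ c > 0, ∀ᵐ y, c ≤ G x y) :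
    HFam l fun x y => F x y / G x y := by
  have base : ∀ {F : X → Eucl n → ℝ}, HFam 0 F → HFam 0 fun x y => F x y / G x y := fun hF =>
    (((hG.essBddFam hk).inv hpos).mul hF).congr
      fun x => Eventually.of_forall fun y => by simp only; ring
  induction l generalizing F with
  | zero => exact base hF
  | succ l ih =>
    obtain ⟨c, H, hH, rfl⟩ := hG.exists_eq
    choose F' hF' hFd using fun i => hF.exists_deriv i
    choose E hE hEd using fun i => (hH.mul hk hl hF).exists_deriv i
    have hl' : l ≤ k := Nat.le_of_succ_le hl
    refine HFam.succ (base (hF.mono (Nat.zero_le _)))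
      (G := fun i x y => (F' i x y - (E i x y - H x y * F' i x y) / (c + H x y)) / (c + H x y))
      (fun i => ?_) (fun i x => ?_)
    · exact ih hl' ((hF' i).sub (ih hl' ((hE i).sub (hH.mul hk hl' (hF' i)))))
    · obtain ⟨u, -, hu⟩ := hF.mono (Nat.le_add_left 1 l)
      obtain ⟨h, -, hh⟩ := id hH
      exact isWeakDeriv_div hk (Nat.one_le_of_lt hl) c i (hu x) (hh x) (hpos x) (hFd i x)
        ((hF' i).locallyIntegrable x) (hEd i x) ((hE i).locallyIntegrable x)

/-- A continuous function in `H^k`, `k > n/2`, vanishes at infinity. -/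
theorem Represents.tendsto_cocompact (hk : n < 2 * k) {f : Eucl n → ℝ} {u : Sobolev n k}
    (h : Represents f u) (hf : Continuous f) : Tendsto f (cocompact (Eucl n)) (𝓝 0) := by
  obtain ⟨C, hC0, hC⟩ := exists_ae_abs_le hk
  rw [Metric.tendsto_nhds]
  intro ε hε
  have hδ : 0 < ε / (2 * (C + 1)) := by positivity
  obtain ⟨a, ha⟩ := Metric.denseRange_iff.mp (denseRange_ofSchwartz n k) u _ hδ
  have h1 : ∀ y, |f y - a y| ≤ ε / 2 := by
    refine le_of_ae_le (hf.sub a.continuous).abs continuous_const ?_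
    filter_upwards [h, hC (u - ofSchwartz k a), coeFn_ofSchwartz (l := k) a,
      Lp.coeFn_sub u.toL2 (ofSchwartz k a).toL2] with y e1 e2 e3 e4
    rw [map_sub, e4, Pi.sub_apply, e3, ← e1] at e2
    refine e2.trans ?_
    rw [dist_eq_norm] at ha
    have := mul_le_mul_of_nonneg_left ha.le hC0
    refine this.trans ?_
    rw [mul_div_assoc', div_le_div_iff₀ (by positivity) (by positivity)]
    nlinarith
  have h2 := (Metric.tendsto_nhds.mp a.tendsto_cocompact) (ε / 2) (by positivity)
  filter_upwards [h2] with y hy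
  rw [dist_zero_right, Real.norm_eq_abs] at hy ⊢
  have := abs_add_le (f y - a y) (a y)
  rw [sub_add_cancel] at this
  linarith [h1 y]

end Division

/-! ### Composition in `L²` and the chain rule -/

section Composition

variable {n k l : ℕ} {X Y : Type*} [TopologicalSpace X] [TopologicalSpace Y]

theorem quasiMeasurePreserving_of_map_le {T : Eucl n → Eucl n} (hT : Measurable T) {C : ℝ≥0}
    (h : volume.map T ≤ C • (volume : Measure (Eucl n))) :
    Measure.QuasiMeasurePreserving T volume volume :=
  ⟨hT, (Measure.absolutelyContinuous_of_le h).trans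
    (Measure.smul_absolutelyContinuous (c := C))⟩

theorem eLpNorm_comp_le {T : Eucl n → Eucl n} (hT : Measurable T) {C : ℝ≥0}
    (h : volume.map T ≤ C • (volume : Measure (Eucl n))) {f : Eucl n → ℝ}
    (hf : AEStronglyMeasurable f volume) :
    eLpNorm (f ∘ T) 2 volume ≤ (C : ℝ≥0∞) ^ (1 / 2 : ℝ) * eLpNorm f 2 volume := by
  have hac : volume.map T ≪ (volume : Measure (Eucl n)) :=
    (quasiMeasurePreserving_of_map_le hT h).absolutelyContinuous
  rw [← eLpNorm_map_measure (hf.mono_ac hac) hT.aemeasurable]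
  refine (eLpNorm_mono_measure f h).trans (le_of_eq ?_)
  have := eLpNorm_smul_measure_of_ne_top (μ := (volume : Measure (Eucl n))) (p := 2) (by norm_num)
    f (C : ℝ≥0∞)
  simpa using this

theorem memLp_comp {T : Eucl n → Eucl n} (hT : Measurable T) {C : ℝ≥0}
    (h : volume.map T ≤ C • (volume : Measure (Eucl n))) {f : Eucl n → ℝ}
    (hf : MemLp f 2 volume) : MemLp (f ∘ T) 2 volume :=
  ⟨hf.1.comp_quasiMeasurePreserving (quasiMeasurePreserving_of_map_le hT h),
    (eLpNorm_comp_le hT h hf.1).trans_lt (ENNReal.mul_lt_top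
      (ENNReal.rpow_lt_top_of_nonneg (by norm_num) ENNReal.coe_ne_top) hf.2)⟩

/-- For continuous compactly supported `g`, `g ∘ T x → g ∘ T x₀` in `L²` if `T x → T x₀`
uniformly. -/
theorem eventually_eLpNorm_comp_sub_le {T : X → Eucl n → Eucl n} (hT : ∀ x, Continuous (T x))
    {x₀ : X} (hunif : ∀ ε > 0, ∀ᶠ x in 𝓝 x₀, ∀ y, dist (T x y) (T x₀ y) ≤ ε)
    {C : ℝ≥0} (hvol : volume.map (T x₀) ≤ C • (volume : Measure (Eucl n))) {g : Eucl n → ℝ}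
    (hg : Continuous g) (hgc : HasCompactSupport g) {δ : ℝ≥0} (hδ : 0 < δ) :
    ∀ᶠ x in 𝓝 x₀, eLpNorm (g ∘ T x - g ∘ T x₀) 2 volume ≤ δ := by
  obtain ⟨K, hK, hgK⟩ : ∃ K, IsCompact K ∧ ∀ y z, dist y z ≤ 1 → y ∉ K → g z = 0 :=
    ⟨_, hgc.isCompact.cthickening (r := 1), fun y z h hy => image_eq_zero_of_notMem_tsupport
      fun hz => hy (Metric.mem_cthickening_of_dist_le y z 1 _ hz h)⟩
  have hKm : MeasurableSet (T x₀ ⁻¹' K) := (hT x₀).measurable hK.measurableSet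
  have hV : volume (T x₀ ⁻¹' K) < ⊤ := by
    have h1 := hvol K
    rw [Measure.map_apply (hT x₀).measurable hK.measurableSet] at h1
    refine h1.trans_lt ?_
    rw [Measure.smul_apply]
    exact ENNReal.mul_lt_top ENNReal.coe_lt_top hK.measure_lt_top
  have hV' : volume (T x₀ ⁻¹' K) ^ (1 / (2 : ℝ≥0∞).toReal) ≠ ⊤ :=
    (ENNReal.rpow_lt_top_of_nonneg (by norm_num) hV.ne).ne
  obtain ⟨θ, hθ, hθδ⟩ := ENNReal.exists_nnreal_pos_mul_lt hV'
    (ENNReal.coe_ne_zero.mpr hδ.ne')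
  have huc : UniformContinuous g := hgc.uniformContinuous_of_continuous hg
  obtain ⟨η, hη, hηg⟩ := Metric.uniformContinuous_iff.mp huc θ hθ
  filter_upwards [hunif (min 1 (η / 2)) (by positivity)] with x hx
  have hb : ∀ y, ‖(g ∘ T x - g ∘ T x₀) y‖ ≤ (T x₀ ⁻¹' K).indicator (fun _ => (θ : ℝ)) y := by
    intro y
    by_cases hy : y ∈ T x₀ ⁻¹' K
    · rw [Set.indicator_of_mem hy]
      have := hηg (lt_of_le_of_lt ((hx y).trans (min_le_right _ _)) (half_lt_self hη))
      rw [Real.dist_eq] at this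
      exact this.le
    · rw [Set.indicator_of_notMem hy]
      have h1 : g (T x₀ y) = 0 := hgK _ _ (by simp) hy
      have h2 : g (T x y) = 0 :=
        hgK _ _ (by rw [dist_comm]; exact (hx y).trans (min_le_left _ _)) hy
      simp [h1, h2]
  refine (eLpNorm_mono_real hb).trans ?_
  rw [eLpNorm_indicator_const hKm (by norm_num) (by norm_num)]
  refine le_trans (le_of_eq ?_) hθδ.le
  congr 1
  simp

/-- Continuity of `(f, T) ↦ f ∘ T` in `L²`, for transformations `T` that depend on the parameter
continuously with respect to uniform convergence and that distort the volume in a locally uniformly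
bounded way. The function `f` at the base point is approximated by continuous functions with compact
support. -/
theorem HFam.comp_zero {T : X → Eucl n → Eucl n} (hT : ∀ x, Continuous (T x))
    (hvol : ∀ x₀, ∃ C : ℝ≥0, ∀ᶠ x in 𝓝 x₀, volume.map (T x) ≤ C • (volume : Measure (Eucl n)))
    (hunif : ∀ x₀, ∀ ε > 0, ∀ᶠ x in 𝓝 x₀, ∀ y, dist (T x y) (T x₀ y) ≤ ε)
    {F : X → Eucl n → ℝ} (hF : HFam 0 F) : HFam 0 fun x y => F x (T x y) := by
  obtain ⟨u, hu, r⟩ := hFam_zero_iff.mp hF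
  have hvol' : ∀ x, ∃ C : ℝ≥0, volume.map (T x) ≤ C • (volume : Measure (Eucl n)) := fun x => by
    obtain ⟨C, hC⟩ := hvol x
    exact ⟨C, hC.self_of_nhds⟩
  have hm : ∀ x, MemLp (u x ∘ T x) 2 volume := fun x => by
    obtain ⟨C, hC⟩ := hvol' x
    exact memLp_comp (hT x).measurable hC (Lp.memLp _)
  refine hFam_zero_iff.mpr ⟨fun x => (hm x).toLp _, ?_, fun x => ?_⟩
  swap
  · obtain ⟨C, hC⟩ := hvol' x
    refine EventuallyEq.trans ?_ (hm x).coeFn_toLp.symm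
    exact (quasiMeasurePreserving_of_map_le (hT x).measurable hC).ae_eq_comp (r x)
  rw [continuous_iff_continuousAt]
  intro x₀
  rw [ContinuousAt, Lp.tendsto_Lp_iff_tendsto_eLpNorm'', ENNReal.tendsto_nhds_zero]
  intro ε hε
  obtain ⟨C, hC⟩ := hvol x₀
  set c : ℝ≥0∞ := (C : ℝ≥0∞) ^ (1 / 2 : ℝ) with hc
  have hct : c ≠ ⊤ := (ENNReal.rpow_lt_top_of_nonneg (by norm_num) ENNReal.coe_ne_top).ne
  obtain ⟨δ, hδ, hδε⟩ := ENNReal.exists_nnreal_pos_mul_lt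
    (a := 3 * c + 1) (by finiteness) hε.ne'
  obtain ⟨g, hgc, hgδ, hg, hgm⟩ := (Lp.memLp (u x₀)).exists_hasCompactSupport_eLpNorm_sub_le
    (by norm_num) (ENNReal.coe_ne_zero.mpr hδ.ne')
  have hux : ∀ᶠ x in 𝓝 x₀, eLpNorm (⇑(u x) - ⇑(u x₀)) 2 volume ≤ δ := by
    have h1 : Tendsto u (𝓝 x₀) (𝓝 (u x₀)) := hu.tendsto x₀
    rw [Lp.tendsto_Lp_iff_tendsto_eLpNorm', ENNReal.tendsto_nhds_zero] at h1
    exact h1 δ (ENNReal.coe_pos.mpr hδ)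
  filter_upwards [hC, hux, eventually_eLpNorm_comp_sub_le hT (hunif x₀) hC.self_of_nhds hg hgc hδ]
    with x h1 h2 h3
  have hsx := (Lp.aestronglyMeasurable (u x))
  have hs0 := (Lp.aestronglyMeasurable (u x₀))
  have e1 : eLpNorm ((u x - u x₀ : Eucl n → ℝ) ∘ T x) 2 volume ≤ c * δ :=
    (eLpNorm_comp_le (hT x).measurable h1 (hsx.sub hs0)).trans (by gcongr)
  have e2 : eLpNorm ((u x₀ - g : Eucl n → ℝ) ∘ T x) 2 volume ≤ c * δ :=
    (eLpNorm_comp_le (hT x).measurable h1 (hs0.sub hgm.1)).trans (by gcongr)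
  have e3 : eLpNorm ((u x₀ - g : Eucl n → ℝ) ∘ T x₀) 2 volume ≤ c * δ :=
    (eLpNorm_comp_le (hT x₀).measurable hC.self_of_nhds (hs0.sub hgm.1)).trans (by gcongr)
  have q := quasiMeasurePreserving_of_map_le (hT x).measurable h1
  have q0 := quasiMeasurePreserving_of_map_le (hT x₀).measurable hC.self_of_nhds
  have m1 := (hsx.sub hs0).comp_quasiMeasurePreserving q
  have m2 := (hs0.sub hgm.1).comp_quasiMeasurePreserving q
  have m3 := (hs0.sub hgm.1).comp_quasiMeasurePreserving q0
  have m4 : AEStronglyMeasurable (g ∘ T x - g ∘ T x₀) volume :=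
    ((hg.comp (hT x)).sub (hg.comp (hT x₀))).aestronglyMeasurable
  have e : (⇑(u x) ∘ T x - ⇑(u x₀) ∘ T x₀) =
      (((u x - u x₀ : Eucl n → ℝ) ∘ T x + (u x₀ - g : Eucl n → ℝ) ∘ T x) +
        (g ∘ T x - g ∘ T x₀)) - (u x₀ - g : Eucl n → ℝ) ∘ T x₀ := by
    funext y; simp
  rw [e]
  refine (eLpNorm_sub_le ((m1.add m2).add m4) m3 (by norm_num)).trans ?_
  refine le_trans (add_le_add ((eLpNorm_add_le (m1.add m2) m4 (by norm_num)).trans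
    (add_le_add ((eLpNorm_add_le m1 m2 (by norm_num)).trans (add_le_add e1 e2)) h3)) e3) ?_
  refine le_trans (le_of_eq ?_) hδε.le
  ring

theorem sum_smul_single (v : Eucl n) : v = ∑ j, v j • EuclideanSpace.single j (1 : ℝ) := by
  ext i
  simp [Finset.sum_apply, Pi.single_apply]

theorem partialDeriv_coord {T : Eucl n → Eucl n} {y : Eucl n} (hT : DifferentiableAt ℝ T y)
    (i j : Fin n) :
    partialDeriv i (fun z => T z j) y = (fderiv ℝ T y (EuclideanSpace.single i 1)) j := by
  have h : HasFDerivAt (fun z => T z j) _ y :=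
    (EuclideanSpace.proj (𝕜 := ℝ) j).hasFDerivAt.comp y hT.hasFDerivAt
  unfold partialDeriv
  rw [h.fderiv]
  rfl

theorem partialDeriv_comp {a : Eucl n → ℝ} {T : Eucl n → Eucl n} {y : Eucl n}
    (ha : DifferentiableAt ℝ a (T y)) (hT : DifferentiableAt ℝ T y) (i : Fin n) :
    partialDeriv i (fun z => a (T z)) y =
      ∑ j, partialDeriv j a (T y) * partialDeriv i (fun z => T z j) y := by
  have h : HasFDerivAt (fun z => a (T z)) _ y := ha.hasFDerivAt.comp y hT.hasFDerivAt
  simp_rw [partialDeriv_coord hT]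
  unfold partialDeriv
  rw [h.fderiv, ContinuousLinearMap.comp_apply]
  conv_lhs => rw [sum_smul_single (fderiv ℝ T y (EuclideanSpace.single i 1)), map_sum]
  exact Finset.sum_congr rfl fun j _ => by rw [map_smul, smul_eq_mul, mul_comm]

theorem contDiff_coord {T : Eucl n → Eucl n} {m : WithTop ℕ∞} (hT : ContDiff ℝ m T) (j : Fin n) :
    ContDiff ℝ m fun z => T z j :=
  (EuclideanSpace.proj (𝕜 := ℝ) j).contDiff.comp hT

theorem continuous_partialDeriv {f : Eucl n → ℝ} (hf : ContDiff ℝ 1 f) (i : Fin n) :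
    Continuous (partialDeriv i f) :=
  (hf.continuous_fderiv (by simp)).clm_apply continuous_const

/-- The chain rule for `f ∘ T` with `f ∈ H¹` and a `C¹` map `T` with bounded derivatives and
bounded distortion of the volume. -/
theorem isWeakDeriv_comp {T : Eucl n → Eucl n} (hT : ContDiff ℝ 1 T) {C : ℝ≥0}
    (hvol : volume.map T ≤ C • (volume : Measure (Eucl n))) (i : Fin n)
    (hb : ∀ j, ∃ M, ∀ y, |partialDeriv i (fun z => T z j) y| ≤ M)
    {f : Eucl n → ℝ} {g : Fin n → Eucl n → ℝ} {u : Sobolev n 1} (hu : Represents f u)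
    (hg : ∀ j, IsWeakDeriv (Pi.single j 1) f (g j)) (lg : ∀ j, LocallyIntegrable (g j)) :
    IsWeakDeriv (Pi.single i 1) (fun y => f (T y))
      (fun y => ∑ j, partialDeriv i (fun z => T z j) y * g j (T y)) := by
  -- both sides are continuous in `f ∈ H¹`, and for Schwartz functions this is the classical chain
  -- rule
  have comp0 : ∀ {F : Sobolev n 1 → Eucl n → ℝ}, HFam 0 F → HFam 0 fun v y => F v (T y) :=
    fun hF => hF.comp_zero (T := fun _ => T) (fun _ => hT.continuous)
      (fun _ => ⟨C, Eventually.of_forall fun _ => hvol⟩)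
      (fun _ ε hε => Eventually.of_forall fun _ y => by rw [dist_self]; exact hε.le)
  have hL : HFam 0 fun (v : Sobolev n 1) y => v.toL2 (T y) :=
    comp0 (hFam_of_continuous continuous_id |>.mono zero_le_one)
  have hR : HFam 0 fun (v : Sobolev n 1) y =>
      ∑ j, partialDeriv i (fun z => T z j) y * (Sobolev.D j v).toL2 (T y) := by
    refine HFam.sum _ fun j _ => ?_
    refine EssBddFam.mul (G := fun _ => partialDeriv i (fun z => T z j)) ?_
      (comp0 (hFam_of_continuous (Sobolev.D j).continuous))
    obtain ⟨M, hM⟩ := hb j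
    exact ⟨fun _ => (continuous_partialDeriv (contDiff_coord hT j) i).aestronglyMeasurable,
      fun _ => ⟨M, Eventually.of_forall hM⟩, fun _ ε hε => Eventually.of_forall fun _ =>
        Eventually.of_forall fun y => by rw [sub_self, abs_zero]; exact hε.le⟩
  have q := quasiMeasurePreserving_of_map_le hT.continuous.measurable hvol
  have key := hL.isWeakDeriv_of_dense hR (denseRange_ofSchwartz n 1) (α := Pi.single i 1) (by
    rintro _ ⟨a, rfl⟩
    have ha : ContDiff ℝ 1 fun y => a (T y) := (a.smooth 1).comp hT
    refine (isWeakDeriv_of_contDiff i ha).congr (q.ae_eq_comp (coeFn_ofSchwartz a)).symm ?_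
    have e : ∀ j, ∀ᵐ y, (Sobolev.D j (ofSchwartz 1 a)).toL2 (T y) = partialDeriv j a (T y) := by
      intro j
      rw [D_ofSchwartz, ← coe_schwartzD]
      exact q.ae_eq_comp (coeFn_ofSchwartz _)
    filter_upwards [ae_all_iff.mpr e] with y hy
    rw [partialDeriv_comp (a.smooth 1 |>.differentiable (by simp) _)
      (hT.differentiable (by simp) y)]
    exact Finset.sum_congr rfl fun j _ => by rw [hy, mul_comm])
  refine (key u).congr (q.ae_eq_comp hu).symm ?_
  have e : ∀ j, ∀ᵐ y, (Sobolev.D j u).toL2 (T y) = g j (T y) := fun j =>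
    q.ae_eq_comp (((Sobolev.D_spec j u).congr hu.symm ae_eq_rfl).ae_unique (hg j)
      ((Lp.memLp _).locallyIntegrable (by norm_num)) (lg j))
  filter_upwards [ae_all_iff.mpr e] with y hy
  exact Finset.sum_congr rfl fun j _ => by rw [hy]

end Composition

/-! ### The Jacobian matrix -/

section Jacobian

variable {n : ℕ}

/-- The Jacobian matrix of `T`, with entries `∂Tⱼ/∂xᵢ` in row `j` and column `i`. -/
def jacobian (T : Eucl n → Eucl n) (y : Eucl n) : Matrix (Fin n) (Fin n) ℝ :=
  Matrix.of fun j i => partialDeriv i (fun z => T z j) y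

theorem jacobian_eq_toMatrix {T : Eucl n → Eucl n} {y : Eucl n} (hT : DifferentiableAt ℝ T y) :
    jacobian T y = LinearMap.toMatrix (EuclideanSpace.basisFun (Fin n) ℝ).toBasis
      (EuclideanSpace.basisFun (Fin n) ℝ).toBasis (fderiv ℝ T y : Eucl n →ₗ[ℝ] Eucl n) := by
  ext j i
  rw [LinearMap.toMatrix_apply]
  simp [jacobian, partialDeriv_coord hT]

theorem det_jacobian {T : Eucl n → Eucl n} {y : Eucl n} (hT : DifferentiableAt ℝ T y) :
    (jacobian T y).det = (fderiv ℝ T y).det := by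
  rw [jacobian_eq_toMatrix hT, LinearMap.det_toMatrix]

theorem continuous_jacobian {T : Eucl n → Eucl n} (hT : ContDiff ℝ 1 T) :
    Continuous (jacobian T) :=
  continuous_matrix fun j i => continuous_partialDeriv (contDiff_coord hT j) i

theorem jacobian_comp {S T : Eucl n → Eucl n} {y : Eucl n} (hS : DifferentiableAt ℝ S (T y))
    (hT : DifferentiableAt ℝ T y) :
    jacobian (fun z => S (T z)) y = jacobian S (T y) * jacobian T y := by
  have h : HasFDerivAt (fun z => S (T z)) _ y := hS.hasFDerivAt.comp y hT.hasFDerivAt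
  rw [jacobian_eq_toMatrix h.differentiableAt, jacobian_eq_toMatrix hS, jacobian_eq_toMatrix hT,
    ← LinearMap.toMatrix_comp, h.fderiv]
  rfl

theorem jacobian_id (y : Eucl n) : jacobian (fun z => z) y = 1 := by
  rw [jacobian_eq_toMatrix differentiableAt_fun_id, fderiv_fun_id]
  exact LinearMap.toMatrix_id _

end Jacobian

namespace IsDiffPlus

variable {n : ℕ} {φ ψ : Eucl n ≃ Eucl n}

theorem differentiable (h : IsDiffPlus φ) : Differentiable ℝ φ :=
  h.contDiff.differentiable (by simp)

theorem differentiable_symm (h : IsDiffPlus φ) : Differentiable ℝ φ.symm :=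
  h.contDiff_symm.differentiable (by simp)

theorem det_jacobian_pos (h : IsDiffPlus φ) (y : Eucl n) : 0 < (jacobian φ y).det := by
  rw [det_jacobian (h.differentiable y)]
  exact h.det_pos y

theorem jacobian_symm (h : IsDiffPlus φ) (x : Eucl n) :
    jacobian φ.symm x = (jacobian φ (φ.symm x))⁻¹ := by
  refine (Matrix.inv_eq_right_inv ?_).symm
  rw [← jacobian_comp (h.differentiable _) (h.differentiable_symm x)]
  simpa using jacobian_id x

/-- Cramer's rule for the derivative of the inverse map. -/
theorem partialDeriv_symm (h : IsDiffPlus φ) (i j : Fin n) (x : Eucl n) :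
    partialDeriv i (fun z => φ.symm z j) x =
      (jacobian φ (φ.symm x)).adjugate j i / (jacobian φ (φ.symm x)).det := by
  have e : partialDeriv i (fun z => φ.symm z j) x = jacobian φ.symm x j i := rfl
  rw [e, h.jacobian_symm, Matrix.inv_def, Ring.inverse_eq_inv', Matrix.smul_apply, smul_eq_mul,
    div_eq_inv_mul]

theorem trans (hψ : IsDiffPlus ψ) (hφ : IsDiffPlus φ) : IsDiffPlus (ψ.trans φ) where
  contDiff := hφ.contDiff.comp hψ.contDiff
  contDiff_symm := hψ.contDiff_symm.comp hφ.contDiff_symm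
  det_pos x := by
    have hd : Differentiable ℝ (ψ.trans φ) := hφ.differentiable.comp hψ.differentiable
    have e : jacobian (ψ.trans φ) x = jacobian φ (ψ x) * jacobian ψ x :=
      jacobian_comp (hφ.differentiable _) (hψ.differentiable x)
    rw [← det_jacobian (hd x), e, Matrix.det_mul]
    exact mul_pos (hφ.det_jacobian_pos _) (hψ.det_jacobian_pos _)

theorem symm (h : IsDiffPlus φ) : IsDiffPlus φ.symm where
  contDiff := h.contDiff_symm
  contDiff_symm := h.contDiff
  det_pos x := by
    rw [← det_jacobian (h.differentiable_symm x), h.jacobian_symm, Matrix.det_nonsing_inv,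
      Ring.inverse_eq_inv']
    exact inv_pos.mpr (h.det_jacobian_pos _)

theorem refl : IsDiffPlus (Equiv.refl (Eucl n)) where
  contDiff := contDiff_id
  contDiff_symm := contDiff_id
  det_pos x := by
    have e : jacobian (Equiv.refl (Eucl n)) x = 1 := jacobian_id x
    have hd : Differentiable ℝ (Equiv.refl (Eucl n)) := differentiable_id
    rw [← det_jacobian (hd x), e, Matrix.det_one]
    exact one_pos

theorem volume_image (h : IsDiffPlus φ) {A : Set (Eucl n)} (hA : MeasurableSet A) :
    volume (φ '' A) = ∫⁻ y in A, ENNReal.ofReal (jacobian φ y).det := by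
  rw [← lintegral_abs_det_fderiv_eq_addHaar_image volume hA
    (fun x _ => (h.differentiable x).hasFDerivAt.hasFDerivWithinAt) φ.injective.injOn]
  refine lintegral_congr fun y => ?_
  rw [abs_of_pos (h.det_pos y), det_jacobian (h.differentiable y)]

theorem map_volume_le (h : IsDiffPlus φ) {c : ℝ} (hc : 0 < c)
    (hd : ∀ y, c ≤ (jacobian φ y).det) :
    volume.map φ ≤ (c⁻¹).toNNReal • (volume : Measure (Eucl n)) := by
  refine Measure.le_iff.mpr fun A hA => ?_
  have hm : Measurable φ := h.contDiff.continuous.measurable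
  have h1 : ENNReal.ofReal c * volume (φ ⁻¹' A) ≤ volume A := by
    conv_rhs => rw [← φ.image_preimage A, h.volume_image (hm hA)]
    rw [← setLIntegral_const]
    exact lintegral_mono fun y => ENNReal.ofReal_le_ofReal (hd y)
  rw [Measure.map_apply hm hA, Measure.smul_apply]
  change _ ≤ ENNReal.ofReal c⁻¹ * volume A
  refine le_trans (le_of_eq ?_) (mul_le_mul_right h1 _)
  rw [← mul_assoc, ← ENNReal.ofReal_mul (inv_pos.mpr hc).le, inv_mul_cancel₀ hc.ne',
    ENNReal.ofReal_one, one_mul]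

theorem map_symm_volume_le (h : IsDiffPlus φ) {C : ℝ}
    (hd : ∀ y, (jacobian φ y).det ≤ C) :
    volume.map φ.symm ≤ C.toNNReal • (volume : Measure (Eucl n)) := by
  refine Measure.le_iff.mpr fun A hA => ?_
  rw [Measure.map_apply h.contDiff_symm.continuous.measurable hA, Measure.smul_apply,
    ← φ.image_eq_preimage_symm, h.volume_image hA]
  change _ ≤ ENNReal.ofReal C * volume A
  rw [← setLIntegral_const]
  exact lintegral_mono fun y => ENNReal.ofReal_le_ofReal (hd y)

end IsDiffPlus

/-! ### Uniform estimates on `D^s` -/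

theorem norm_le_sum_abs {n : ℕ} (v : Eucl n) : ‖v‖ ≤ ∑ j, |v j| := by
  conv_lhs => rw [sum_smul_single v]
  refine (norm_sum_le _ _).trans (Finset.sum_le_sum fun j _ => ?_)
  simp [norm_smul]

namespace SobolevDiffeo

variable {n k s : ℕ}

theorem hFam_sub_id (j : Fin n) :
    HFam s fun (φ : SobolevDiffeo n s) y => φ.toEquiv y j - y j :=
  ⟨fun φ => φ.subId j, (PiLp.continuous_apply 2 _ j).comp continuous_induced_dom,
    fun φ => φ.subId_spec j⟩

theorem continuous_toEquiv (φ : SobolevDiffeo n s) : Continuous φ.toEquiv :=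
  φ.isDiffPlus.contDiff.continuous

theorem continuous_symm (φ : SobolevDiffeo n s) : Continuous φ.toEquiv.symm :=
  φ.isDiffPlus.contDiff_symm.continuous

/-- The entries of the Jacobian matrix lie in `δᵢⱼ + H^k`. -/
theorem hFam_jacobian_sub_one (j i : Fin n) : HFam k fun (φ : SobolevDiffeo n (k + 1)) y =>
    jacobian φ.toEquiv y j i - (1 : Matrix (Fin n) (Fin n) ℝ) j i := by
  obtain ⟨G, hG, hGd⟩ := (hFam_sub_id (n := n) (s := k + 1) j).exists_deriv i
  refine hG.congr fun φ => ?_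
  have h1 : ContDiff ℝ 1 fun z => φ.toEquiv z j := contDiff_coord φ.isDiffPlus.contDiff j
  have h2 : ContDiff ℝ 1 fun z : Eucl n => z j := contDiff_coord contDiff_id j
  have h12 : ContDiff ℝ 1 fun z => φ.toEquiv z j - z j := h1.sub h2
  have e : (fun y => jacobian φ.toEquiv y j i - (1 : Matrix (Fin n) (Fin n) ℝ) j i) =
      partialDeriv i fun z => φ.toEquiv z j - z j := by
    funext y
    rw [← jacobian_id y]
    change partialDeriv i (fun z => φ.toEquiv z j) y - partialDeriv i (fun z : Eucl n => z j) y = _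
    unfold partialDeriv
    rw [fderiv_fun_sub (h1.differentiable (by simp) y) (h2.differentiable (by simp) y)]
    rfl
  rw [e]
  exact (isWeakDeriv_of_contDiff i h12).ae_unique (hGd φ)
    (continuous_partialDeriv h12 i).locallyIntegrable (hG.locallyIntegrable φ)

theorem aFam_jacobian (j i : Fin n) :
    AFam k fun (φ : SobolevDiffeo n (k + 1)) y => jacobian φ.toEquiv y j i :=
  ⟨_, hFam_jacobian_sub_one j i⟩

theorem continuous_det_jacobian (φ : SobolevDiffeo n s) :
    Continuous fun y => (jacobian φ.toEquiv y).det :=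
  (continuous_jacobian φ.isDiffPlus.contDiff).matrix_det

/-- The Jacobian determinant is positive, continuous and tends to `1` at infinity, hence it is
bounded below by a positive constant. -/
theorem exists_pos_le_det (hk : n < 2 * k) (φ : SobolevDiffeo n (k + 1)) :
    ∃ c > 0, ∀ y, c ≤ (jacobian φ.toEquiv y).det := by
  have hJ : Tendsto (jacobian φ.toEquiv) (cocompact _) (𝓝 1) := by
    refine tendsto_pi_nhds.mpr fun j => tendsto_pi_nhds.mpr fun i => ?_
    obtain ⟨u, -, hu⟩ := hFam_jacobian_sub_one (n := n) (k := k) j i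
    have := (hu φ).tendsto_cocompact hk ((continuous_partialDeriv
      (contDiff_coord φ.isDiffPlus.contDiff j) i).sub continuous_const)
    simpa using this.add_const ((1 : Matrix (Fin n) (Fin n) ℝ) j i)
  have hdet : Tendsto (fun y => (jacobian φ.toEquiv y).det) (cocompact _) (𝓝 1) := by
    have := ((continuous_id (X := Matrix (Fin n) (Fin n) ℝ)).matrix_det.tendsto 1).comp hJ
    simpa [Function.comp_def] using this
  obtain ⟨K, hK, hKc⟩ := mem_cocompact.mp
    (hdet.eventually (lt_mem_nhds (show (1 / 2 : ℝ) < 1 by norm_num)))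
  obtain ⟨c, hc, hcK⟩ := hK.exists_forall_le' φ.continuous_det_jacobian.continuousOn
    (fun y _ => φ.isDiffPlus.det_jacobian_pos y)
  refine ⟨min c (1 / 2), by positivity, fun y => ?_⟩
  by_cases hy : y ∈ K
  · exact (min_le_left _ _).trans (hcK y hy)
  · exact (min_le_right _ _).trans (hKc hy).le

theorem eventually_abs_det_sub_le (hk : n < 2 * k) (φ₀ : SobolevDiffeo n (k + 1)) {ε : ℝ}
    (hε : 0 < ε) : ∀ᶠ φ : SobolevDiffeo n (k + 1) in 𝓝 φ₀, ∀ y,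
      |(jacobian φ.toEquiv y).det - (jacobian φ₀.toEquiv y).det| ≤ ε := by
  filter_upwards [((AFam.det hk aFam_jacobian).essBddFam hk).cont φ₀ ε hε] with φ hφ
  exact le_of_ae_le (φ.continuous_det_jacobian.sub φ₀.continuous_det_jacobian).abs
    continuous_const hφ

theorem eventually_map_volume_le (hk : n < 2 * k) (φ₀ : SobolevDiffeo n (k + 1)) :
    ∃ C : ℝ≥0, ∀ᶠ φ : SobolevDiffeo n (k + 1) in 𝓝 φ₀,
      volume.map φ.toEquiv ≤ C • (volume : Measure (Eucl n)) := by
  obtain ⟨c, hc, hle⟩ := φ₀.exists_pos_le_det hk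
  refine ⟨((c / 2)⁻¹).toNNReal, ?_⟩
  filter_upwards [eventually_abs_det_sub_le hk φ₀ (half_pos hc)] with φ hφ
  refine φ.isDiffPlus.map_volume_le (half_pos hc) fun y => ?_
  linarith [neg_le_of_abs_le (hφ y), hle y]

theorem eventually_map_symm_volume_le (hk : n < 2 * k) (φ₀ : SobolevDiffeo n (k + 1)) :
    ∃ C : ℝ≥0, ∀ᶠ φ : SobolevDiffeo n (k + 1) in 𝓝 φ₀,
      volume.map φ.toEquiv.symm ≤ C • (volume : Measure (Eucl n)) := by
  obtain ⟨C, hC⟩ := ((AFam.det hk (aFam_jacobian (n := n))).essBddFam hk).bdd φ₀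
  have hC' := le_of_ae_le φ₀.continuous_det_jacobian.abs continuous_const hC
  refine ⟨(C + 1).toNNReal, ?_⟩
  filter_upwards [eventually_abs_det_sub_le hk φ₀ one_pos] with φ hφ
  refine φ.isDiffPlus.map_symm_volume_le fun y => ?_
  linarith [le_of_abs_le (hφ y), le_of_abs_le (hC' y)]

theorem eventually_dist_le (hs : n < 2 * s) (φ₀ : SobolevDiffeo n s) {ε : ℝ} (hε : 0 < ε) :
    ∀ᶠ φ : SobolevDiffeo n s in 𝓝 φ₀, ∀ y, dist (φ.toEquiv y) (φ₀.toEquiv y) ≤ ε := by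
  have h : ∀ j : Fin n, ∀ᶠ φ : SobolevDiffeo n s in 𝓝 φ₀, ∀ y,
      |φ.toEquiv y j - φ₀.toEquiv y j| ≤ ε / (n + 1) := by
    intro j
    filter_upwards [((hFam_sub_id j).essBddFam hs).cont φ₀ (ε / (n + 1)) (by positivity)]
      with φ hφ
    simp only [sub_sub_sub_cancel_right] at hφ
    exact le_of_ae_le (((contDiff_coord φ.isDiffPlus.contDiff j).continuous.sub
      (contDiff_coord φ₀.isDiffPlus.contDiff j).continuous).abs) continuous_const hφ
  filter_upwards [eventually_all.mpr h] with φ hφ y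
  rw [dist_eq_norm]
  refine (norm_le_sum_abs _).trans ((Finset.sum_le_sum fun j _ => hφ j y).trans ?_)
  rw [Finset.sum_const, Finset.card_univ, Fintype.card_fin, nsmul_eq_mul, mul_div_assoc',
    div_le_iff₀ (by positivity)]
  nlinarith

/-- `φ⁻¹ - id = -(φ - id) ∘ φ⁻¹` is continuous and vanishes at infinity. -/
theorem uniformContinuous_symm (hs : n < 2 * s) (φ : SobolevDiffeo n s) :
    UniformContinuous φ.toEquiv.symm := by
  have h0 : Tendsto (fun y => φ.toEquiv y - y) (cocompact _) (𝓝 0) := by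
    refine squeeze_zero_norm (fun y => norm_le_sum_abs _) ?_
    rw [show (0 : ℝ) = ∑ _j : Fin n, |(0 : ℝ)| by simp]
    refine tendsto_finsetSum _ fun j _ => Tendsto.abs ?_
    exact Represents.tendsto_cocompact hs (φ.subId_spec j)
      (contDiff_coord (φ.isDiffPlus.contDiff.sub contDiff_id) j).continuous
  let e : Eucl n ≃ₜ Eucl n := ⟨φ.toEquiv, φ.continuous_toEquiv, φ.continuous_symm⟩
  have h1 : Tendsto φ.toEquiv.symm (cocompact _) (cocompact _) :=
    e.symm.isClosedEmbedding.tendsto_cocompact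
  have h2 : Tendsto (fun x => φ.toEquiv.symm x - x) (cocompact _) (𝓝 0) := by
    have := (h0.comp h1).neg
    simpa [Function.comp_def] using this
  have h3 := (φ.continuous_symm.sub continuous_id).uniformContinuous_of_tendsto_cocompact h2
  simpa using h3.add uniformContinuous_id

theorem eventually_dist_symm_le (hs : n < 2 * s) (φ₀ : SobolevDiffeo n s) {ε : ℝ} (hε : 0 < ε) :
    ∀ᶠ φ : SobolevDiffeo n s in 𝓝 φ₀, ∀ x, dist (φ.toEquiv.symm x) (φ₀.toEquiv.symm x) ≤ ε := by
  obtain ⟨δ, hδ, h⟩ := Metric.uniformContinuous_iff.mp (φ₀.uniformContinuous_symm hs) ε hε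
  filter_upwards [φ₀.eventually_dist_le hs (half_pos hδ)] with φ hφ x
  have h1 := h ((hφ (φ.toEquiv.symm x)).trans_lt (half_lt_self hδ))
  rw [Equiv.apply_symm_apply, Equiv.symm_apply_apply, dist_comm] at h1
  exact h1.le

/-- The partial derivatives of `φ⁻¹` are bounded. -/
theorem exists_abs_partialDeriv_symm_le (hk : n < 2 * k) (φ : SobolevDiffeo n (k + 1))
    (i j : Fin n) : ∃ M, ∀ x, |partialDeriv i (fun z => φ.toEquiv.symm z j) x| ≤ M := by
  obtain ⟨c, hc, hle⟩ := φ.exists_pos_le_det hk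
  obtain ⟨C, hC⟩ := ((AFam.adjugate hk (aFam_jacobian (n := n)) j i).essBddFam hk).bdd φ
  have hadj : Continuous fun y => (jacobian φ.toEquiv y).adjugate j i :=
    (continuous_jacobian φ.isDiffPlus.contDiff).matrix_adjugate.matrix_elem j i
  have hC' := le_of_ae_le hadj.abs continuous_const hC
  refine ⟨C / c, fun x => ?_⟩
  rw [φ.isDiffPlus.partialDeriv_symm, abs_div, abs_of_pos (φ.isDiffPlus.det_jacobian_pos _)]
  exact div_le_div₀ ((abs_nonneg _).trans (hC' x)) (hC' _) hc (hle _)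

theorem exists_abs_partialDeriv_le (hk : n < 2 * k) (φ : SobolevDiffeo n (k + 1))
    (i j : Fin n) : ∃ M, ∀ x, |partialDeriv i (fun z => φ.toEquiv z j) x| ≤ M := by
  obtain ⟨C, hC⟩ := ((aFam_jacobian (n := n) (k := k) j i).essBddFam hk).bdd φ
  exact ⟨C, le_of_ae_le (continuous_partialDeriv
    (contDiff_coord φ.isDiffPlus.contDiff j) i).abs continuous_const hC⟩

end SobolevDiffeo

/-! ### Composition in `H^l` -/

section CompositionSobolev

variable {n k l : ℕ} {X : Type*} [TopologicalSpace X]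

/-- Composition with diffeomorphisms in `D^{k+1}` is continuous on `H^l`, `l ≤ k + 1`: the
derivatives of `f ∘ φ` are sums of products of entries of the Jacobian matrix, which lie in
`ℝ + H^k`, and of functions `∂ⱼf ∘ φ`, which lie in `H^{l-1}` by induction. -/
theorem HFam.comp_diffeo (hk : n < 2 * k) {Φ : X → SobolevDiffeo n (k + 1)} (hΦ : Continuous Φ)
    (hl : l ≤ k + 1) {F : X → Eucl n → ℝ} (hF : HFam l F) :
    HFam l fun x y => F x ((Φ x).toEquiv y) := by
  have base : ∀ {F : X → Eucl n → ℝ}, HFam 0 F → HFam 0 fun x y => F x ((Φ x).toEquiv y) := by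
    intro F hF
    refine hF.comp_zero (T := fun x => (Φ x).toEquiv) (fun x => (Φ x).continuous_toEquiv)
      (fun x₀ => ?_) fun x₀ ε hε => ?_
    · obtain ⟨C, hC⟩ := (Φ x₀).eventually_map_volume_le hk
      exact ⟨C, (hΦ.tendsto x₀).eventually hC⟩
    · exact (hΦ.tendsto x₀).eventually ((Φ x₀).eventually_dist_le (by omega) hε)
  induction l generalizing F with
  | zero => exact base hF
  | succ l ih =>
    choose F' hF' hFd using fun i => hF.exists_deriv i
    refine HFam.succ (base (hF.mono (Nat.zero_le _)))
      (G := fun i x y => ∑ j, partialDeriv i (fun z => (Φ x).toEquiv z j) y *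
        F' j x ((Φ x).toEquiv y)) (fun i => HFam.sum _ fun j _ => ?_) fun i x => ?_
    · exact ((SobolevDiffeo.aFam_jacobian j i).comp hΦ).mul_hFam hk (by omega)
        (ih (by omega) (hF' j))
    · obtain ⟨u, -, hu⟩ := hF.mono (Nat.le_add_left 1 l)
      obtain ⟨C, hC⟩ := (Φ x).eventually_map_volume_le hk
      exact isWeakDeriv_comp (Φ x).isDiffPlus.contDiff hC.self_of_nhds i
        ((Φ x).exists_abs_partialDeriv_le hk i) (hu x) (fun j => hFd j x)
        fun j => (hF' j).locallyIntegrable x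

/-- Composition with inverses of diffeomorphisms in `D^{k+1}`. By Cramer's rule the derivatives of
`f ∘ φ⁻¹` are of the form `g ∘ φ⁻¹` where `g ∈ H^{l-1}` is a sum of quotients with denominator
`det dφ`. -/
theorem HFam.comp_diffeo_symm (hk : n < 2 * k) {Φ : X → SobolevDiffeo n (k + 1)}
    (hΦ : Continuous Φ) (hl : l ≤ k + 1) {F : X → Eucl n → ℝ} (hF : HFam l F) :
    HFam l fun x y => F x ((Φ x).toEquiv.symm y) := by
  have base : ∀ {F : X → Eucl n → ℝ}, HFam 0 F →
      HFam 0 fun x y => F x ((Φ x).toEquiv.symm y) := by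
    intro F hF
    refine hF.comp_zero (T := fun x => (Φ x).toEquiv.symm) (fun x => (Φ x).continuous_symm)
      (fun x₀ => ?_) fun x₀ ε hε => ?_
    · obtain ⟨C, hC⟩ := (Φ x₀).eventually_map_symm_volume_le hk
      exact ⟨C, (hΦ.tendsto x₀).eventually hC⟩
    · exact (hΦ.tendsto x₀).eventually ((Φ x₀).eventually_dist_symm_le (by omega) hε)
  have hJ : ∀ j i, AFam k fun x y => jacobian (Φ x).toEquiv y j i := fun j i =>
    (SobolevDiffeo.aFam_jacobian j i).comp hΦ
  induction l generalizing F with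
  | zero => exact base hF
  | succ l ih =>
    choose F' hF' hFd using fun i => hF.exists_deriv i
    refine HFam.succ (base (hF.mono (Nat.zero_le _)))
      (G := fun i x y => ∑ j, partialDeriv i (fun z => (Φ x).toEquiv.symm z j) y *
        F' j x ((Φ x).toEquiv.symm y)) (fun i => HFam.sum _ fun j _ => ?_) fun i x => ?_
    · have h1 : HFam l fun x y => (jacobian (Φ x).toEquiv y).adjugate j i * F' j x y /
          (jacobian (Φ x).toEquiv y).det := by
        refine ((AFam.adjugate hk hJ j i).mul_hFam hk (by omega) (hF' j)).div hk (by omega)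
          (AFam.det hk hJ) fun x => ?_
        obtain ⟨c, hc, hle⟩ := (Φ x).exists_pos_le_det hk
        exact ⟨c, hc, Eventually.of_forall hle⟩
      refine (ih (by omega) h1).congr fun x => Eventually.of_forall fun y => ?_
      simp only [(Φ x).isDiffPlus.partialDeriv_symm]
      ring
    · obtain ⟨u, -, hu⟩ := hF.mono (Nat.le_add_left 1 l)
      obtain ⟨C, hC⟩ := (Φ x).eventually_map_symm_volume_le hk
      exact isWeakDeriv_comp (Φ x).isDiffPlus.contDiff_symm hC.self_of_nhds i
        ((Φ x).exists_abs_partialDeriv_symm_le hk i) (hu x) (fun j => hFd j x)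
        fun j => (hF' j).locallyIntegrable x

theorem HFam.exists_vec {d : ℕ} {F : X → Eucl n → Eucl d}
    (hF : ∀ j, HFam l fun x y => F x y j) :
    ∃ u : X → SobolevVec n d l, Continuous u ∧ ∀ x, RepresentsVec (F x) (u x) := by
  choose v hv r using hF
  exact ⟨fun x => WithLp.toLp 2 fun j => v j x,
    (PiLp.continuous_toLp 2 _).comp (continuous_pi hv), fun x j => r j x⟩

end CompositionSobolev

/-! ### The group `D^s` -/

theorem Represents.unique {n l : ℕ} {f : Eucl n → ℝ} {u v : Sobolev n l} (hu : Represents f u)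
    (hv : Represents f v) : u = v :=
  Sobolev.toL2_injective (Lp.ext (hu.symm.trans hv))

namespace SobolevDiffeo

variable {n k s : ℕ} {X : Type*} [TopologicalSpace X]

theorem continuous_of_hFam {Ψ : X → SobolevDiffeo n s}
    (h : ∀ j, HFam s fun x y => (Ψ x).toEquiv y j - y j) : Continuous Ψ := by
  obtain ⟨u, hu, r⟩ := HFam.exists_vec (F := fun x y => (Ψ x).toEquiv y - y) h
  refine continuous_induced_rng.mpr ?_
  have e : subId ∘ Ψ = u := by
    funext x
    ext1 j
    exact ((Ψ x).subId_spec j).unique (r x j)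
  rwa [e]

/-- `φ ∘ ψ - id = (φ - id) ∘ ψ + (ψ - id)`. -/
theorem hFam_comp_sub_id (hk : n < 2 * k) (j : Fin n) :
    HFam (k + 1) fun (p : SobolevDiffeo n (k + 1) × SobolevDiffeo n (k + 1)) y =>
      p.1.toEquiv (p.2.toEquiv y) j - y j :=
  ((((hFam_sub_id j).comp continuous_fst).comp_diffeo hk continuous_snd le_rfl).add
    ((hFam_sub_id j).comp continuous_snd)).congr
      fun _ => Eventually.of_forall fun _ => (sub_add_sub_cancel _ _ _).symm

/-- `φ⁻¹ - id = -(φ - id) ∘ φ⁻¹`. -/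
theorem hFam_symm_sub_id (hk : n < 2 * k) (j : Fin n) :
    HFam (k + 1) fun (φ : SobolevDiffeo n (k + 1)) y => φ.toEquiv.symm y j - y j :=
  ((hFam_sub_id j).comp_diffeo_symm hk continuous_id le_rfl).neg.congr
    fun φ => Eventually.of_forall fun y => by simp

/-- The group structure of `D^{k+1}` under composition, for `k > n/2`. -/
abbrev group (hk : n < 2 * k) : Group (SobolevDiffeo n (k + 1)) where
  mul φ ψ := ⟨ψ.toEquiv.trans φ.toEquiv, ψ.isDiffPlus.trans φ.isDiffPlus,
    let ⟨u, _, h⟩ := HFam.exists_vec (F := fun p y => p.1.toEquiv (p.2.toEquiv y) - y)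
      (hFam_comp_sub_id hk)
    ⟨u (φ, ψ), h (φ, ψ)⟩⟩
  one := ⟨Equiv.refl _, IsDiffPlus.refl,
    let ⟨u, _, h⟩ := HFam.exists_vec (F := fun (_ : Unit) (y : Eucl n) => y - y)
      (fun j => by simpa using hFam_zero)
    ⟨u (), h ()⟩⟩
  inv φ := ⟨φ.toEquiv.symm, φ.isDiffPlus.symm,
    let ⟨u, _, h⟩ := HFam.exists_vec (F := fun φ y => φ.toEquiv.symm y - y) (hFam_symm_sub_id hk)
    ⟨u φ, h φ⟩⟩
  mul_assoc φ ψ χ := SobolevDiffeo.ext rfl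
  one_mul φ := SobolevDiffeo.ext rfl
  mul_one φ := SobolevDiffeo.ext rfl
  inv_mul_cancel φ := SobolevDiffeo.ext φ.toEquiv.self_trans_symm

end SobolevDiffeo

/-! ### Continuity of the group operations and of composition -/

section MainResults

variable {n k l d : ℕ}

theorem SobolevDiffeo.isTopologicalGroup (hk : n < 2 * k) :
    letI := SobolevDiffeo.group hk
    IsTopologicalGroup (SobolevDiffeo n (k + 1)) :=
  letI := SobolevDiffeo.group hk
  { continuous_mul := continuous_of_hFam (hFam_comp_sub_id hk)
    continuous_inv := continuous_of_hFam (hFam_symm_sub_id hk) }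

/-- Every representative `f` of `u ∈ H^l` may be used to form `u ∘ φ`, since preimages of null
sets under `φ` are null sets. -/
theorem Represents.comp_diffeo (hk : n < 2 * k) (φ : SobolevDiffeo n (k + 1))
    {f g : Eucl n → ℝ} {u v : Sobolev n l} (hf : Represents f u) (hg : Represents g u)
    (h : Represents (fun x => g (φ.toEquiv x)) v) : Represents (fun x => f (φ.toEquiv x)) v := by
  obtain ⟨C, hC⟩ := φ.eventually_map_volume_le hk
  have q := quasiMeasurePreserving_of_map_le φ.continuous_toEquiv.measurable hC.self_of_nhds
  exact (q.ae_eq_comp (hf.trans hg.symm)).trans h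

theorem exists_continuous_comp (hk : n < 2 * k) (hl : l ≤ k + 1) :
    ∃ μ : SobolevVec n d l × SobolevDiffeo n (k + 1) → SobolevVec n d l,
      (∀ (u : SobolevVec n d l) (φ : SobolevDiffeo n (k + 1)) (f : Eucl n → Eucl d),
        RepresentsVec f u → RepresentsVec (fun x => f (φ.toEquiv x)) (μ (u, φ))) ∧
      Continuous μ := by
  have hu : ∀ j, HFam l fun (p : SobolevVec n d l × SobolevDiffeo n (k + 1)) => (p.1 j).toL2 :=
    fun j => hFam_of_continuous ((PiLp.continuous_apply 2 _ j).comp continuous_fst)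
  obtain ⟨μ, hμ, r⟩ := HFam.exists_vec
    (F := fun (p : SobolevVec n d l × SobolevDiffeo n (k + 1)) y =>
      WithLp.toLp 2 fun j => (p.1 j).toL2 (p.2.toEquiv y))
    fun j => (hu j).comp_diffeo hk continuous_snd hl
  exact ⟨μ, fun u φ f hf j => (hf j).comp_diffeo hk φ ae_eq_rfl (r (u, φ) j), hμ⟩

theorem exists_continuous_comp_scalar (hk : n < 2 * k) (hl : l ≤ k + 1) :
    ∃ μ : Sobolev n l × SobolevDiffeo n (k + 1) → Sobolev n l,
      (∀ (u : Sobolev n l) (φ : SobolevDiffeo n (k + 1)) (f : Eucl n → ℝ),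
        Represents f u → Represents (fun x => f (φ.toEquiv x)) (μ (u, φ))) ∧
      Continuous μ := by
  obtain ⟨μ, hμ, r⟩ := (hFam_of_continuous (continuous_fst (X := Sobolev n l)
    (Y := SobolevDiffeo n (k + 1)))).comp_diffeo hk continuous_snd hl
  exact ⟨μ, fun u φ f hf => hf.comp_diffeo hk φ ae_eq_rfl (r (u, φ)), hμ⟩

end MainResults

end SobDiff

end

theorem mainTheorem3 (n s : ℕ) (hs : (n : ℝ) / 2 + 1 < s) :
    (∃ _ : Group (SobDiff.SobolevDiffeo n s),
      (∀ φ ψ : SobDiff.SobolevDiffeo n s, ∀ x, (φ * ψ).toEquiv x = φ.toEquiv (ψ.toEquiv x)) ∧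
      (∀ x, (1 : SobDiff.SobolevDiffeo n s).toEquiv x = x) ∧
      (∀ φ : SobDiff.SobolevDiffeo n s, (φ⁻¹).toEquiv = φ.toEquiv.symm) ∧
      IsTopologicalGroup (SobDiff.SobolevDiffeo n s)) ∧
    (∀ s' : ℕ, s' ≤ s →
      ∃ μ : SobDiff.Sobolev n s' × SobDiff.SobolevDiffeo n s → SobDiff.Sobolev n s',
        (∀ (u : SobDiff.Sobolev n s') (φ : SobDiff.SobolevDiffeo n s) (f : SobDiff.Eucl n → ℝ),
          SobDiff.Represents f u →
            SobDiff.Represents (fun x => f (φ.toEquiv x)) (μ (u, φ))) ∧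
        Continuous μ) ∧
    (∀ s' d : ℕ, s' ≤ s →
      ∃ μ : SobDiff.SobolevVec n d s' × SobDiff.SobolevDiffeo n s → SobDiff.SobolevVec n d s',
        (∀ (u : SobDiff.SobolevVec n d s') (φ : SobDiff.SobolevDiffeo n s)
            (f : SobDiff.Eucl n → SobDiff.Eucl d),
          SobDiff.RepresentsVec f u →
            SobDiff.RepresentsVec (fun x => f (φ.toEquiv x)) (μ (u, φ))) ∧
        Continuous μ) := by
  -- the first derivatives of elements of `H^s` lie in `H^k` with `k = s - 1 > n/2`
  obtain ⟨k, rfl, hk⟩ : ∃ k, s = k + 1 ∧ n < 2 * k := by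
    have h1 : (n : ℝ) + 2 < 2 * s := by linarith
    have h2 : n + 2 < 2 * s := by exact_mod_cast h1
    exact ⟨s - 1, by omega, by omega⟩
  refine ⟨⟨SobDiff.SobolevDiffeo.group hk, fun _ _ _ => rfl, fun _ => rfl, fun _ => rfl,
    SobDiff.SobolevDiffeo.isTopologicalGroup hk⟩, fun s' hs' => ?_, fun s' d hs' => ?_⟩
  · exact SobDiff.exists_continuous_comp_scalar hk hs'
  · exact SobDiff.exists_continuous_comp hk hs'
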